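/- Let $q\colon[0,\pi]\to\mathbb C$ belong to $W_1^2[0,\pi]$, that is, $q,q'\in AC[0,\pi]$ and $q''\in L(0,\pi)$, and let $q(0)+q(\pi)=0$. (1) Consider the eigenvalue problem with frozen argument $$-y''(x)+q(x)\,y(\pi/2)=\lambda y(x),\quad x\in(0,\pi),\qquad y(0)=y(\pi)=0.$$ Let $C(x,\lambda)$ and $S(x,\lambda)$ be the solutions of this equation with $C=1,\ C'=0$ and $S=0,\ S'=1$ at $x=\pi/2$, and let the multiplicity of an eigenvalue be its multiplicity as a zero of the entire function $\Delta(\lambda)=C(0,\lambda)S(\pi,\lambda)-S(0,\lambda)C(\pi,\lambda)$. The eigenvalues, counted with multiplicities, can be numbered as $\{\lambda_n\}_{n\ge1}$ so that $\lambda_n=n^2$ for all even $n$ and the $\lambda_n$ with odd $n$ are ordered by non-decreasing modulus. For every such numbering $$\lambda_n=n^2+O(n^{-2})\quad\text{for odd } n .$$ (2) For $m\ge1$ put $l=2m-1$, $h=\pi/(l+1)=\pi/(2m)$, $x_j=jh$, $q_j=q(x_j)$, and consider the finite-difference problem $$-\frac{y_{j+1}-2y_j+y_{j-1}}{h^2}+q_j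 y_m=\lambda y_j,\quad j=1,\dots,l,\qquad y_0=y_{l+1}=0.$$ Its $l$ eigenvalues, counted with algebraic multiplicities, can be numbered as $\{\lambda_{n,l}\}_{n=1}^{l}$ so that $\lambda_{n,l}=\frac{4\sin^2(nh/2)}{h^2}$ for all even $n$ and the $\lambda_{n,l}$ with odd $n$ are ordered by non-decreasing modulus. For every fixed $\alpha>0$ and every such numbering $$\lambda_{n,l}=\frac{4\sin^2(nh/2)}{h^2}+O(h^2)\quad\text{for odd } n,\ 1\le n\le l,$$ uniformly for $\frac{n}{2m}\ge\alpha$: there is a constant depending only on $q$ and $\alpha$ such that the remainder is at most this constant times $h^2$ for all $m\ge1$ and all odd $n\le l$ with $\frac n{2m}\ge\alpha$. -/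

import Mathlib

open MeasureTheory

noncomputable section

namespace FrozenArgument

/-- `f ∈ W_1^2[0, π]`: `f` and `f'` are absolutely continuous on `[0, π]` and `f'' ∈ L(0, π)`.
At the endpoints `f'` is the one-sided derivative. -/
structure MemW21 (f : ℝ → ℂ) : Prop where
  differentiableOn : DifferentiableOn ℝ f (Set.Icc 0 Real.pi)
  ac : AbsolutelyContinuousOnInterval f 0 Real.pi
  ac_deriv : AbsolutelyContinuousOnInterval (derivWithin f (Set.Icc 0 Real.pi)) 0 Real.pi
  integrable_deriv2 :
    IntegrableOn (deriv (derivWithin f (Set.Icc 0 Real.pi))) (Set.Ioo 0 Real.pi)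

/-! ### The continuous problem `-y'' + q(x) y(a) = z y` on `(0, π)`, `y(0) = y(π) = 0` -/

/-- `z` is an eigenvalue: the problem has a solution `y`, continuous on `[0, π]` and twice
differentiable in `(0, π)`, which is not identically zero on `[0, π]`. (`y'` is `y₁`.) -/
def IsEigenvalue (q : ℝ → ℂ) (a : ℝ) (z : ℂ) : Prop :=
  ∃ y y₁ : ℝ → ℂ,
    ContinuousOn y (Set.Icc 0 Real.pi) ∧
    (∀ x ∈ Set.Ioo 0 Real.pi, HasDerivAt y (y₁ x) x) ∧
    (∀ x ∈ Set.Ioo 0 Real.pi, HasDerivAt y₁ (q x * y a - z * y x) x) ∧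
    y 0 = 0 ∧ y Real.pi = 0 ∧ ∃ x ∈ Set.Icc 0 Real.pi, y x ≠ 0

/-- A square root `ρ` of `z`; the functions below do not depend on the choice of the branch. -/
def rho (z : ℂ) : ℂ := z ^ (1 / 2 : ℂ)

/-- `sin (ρ s) / ρ` with `ρ ^ 2 = z`, equal to `s` (its limit) at `z = 0`. -/
def sinDiv (s : ℝ) (z : ℂ) : ℂ :=
  if z = 0 then (s : ℂ) else Complex.sin (rho z * s) / rho z

/-- The solution `C(x, z)` of the equation, with `C(a, z) = 1`, `C'(a, z) = 0`. -/
def solC (q : ℝ → ℂ) (a x : ℝ) (z : ℂ) : ℂ :=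
  Complex.cos (rho z * ((x - a : ℝ) : ℂ)) + ∫ t in a..x, q t * sinDiv (x - t) z

/-- The solution `S(x, z)` of the equation, with `S(a, z) = 0`, `S'(a, z) = 1`. -/
def solS (a x : ℝ) (z : ℂ) : ℂ := sinDiv (x - a) z

/-- The characteristic function `Δ(z)`, an entire function of `z`. The multiplicity of an
eigenvalue is its multiplicity as a zero of `Δ`. -/
def charFun (q : ℝ → ℂ) (a : ℝ) (z : ℂ) : ℂ :=
  solC q a 0 z * solS a Real.pi z - solS a 0 z * solC q a Real.pi z

/-- `lam 1, lam 2, …` is a numbering of the eigenvalues of the continuous problem with `a = π / 2`,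
counted with multiplicities: the even indices carry the degenerate eigenvalues `n ^ 2`, the odd
indices carry all the others, in the order of non-decreasing modulus. -/
structure IsNumbering (q : ℝ → ℂ) (lam : ℕ → ℂ) : Prop where
  isEigenvalue_iff : ∀ z : ℂ, IsEigenvalue q (Real.pi / 2) z ↔ ∃ n : ℕ, 1 ≤ n ∧ lam n = z
  multiplicity : ∀ z : ℂ,
    Set.encard {n : ℕ | 1 ≤ n ∧ lam n = z} = analyticOrderAt (charFun q (Real.pi / 2)) z
  even : ∀ n : ℕ, 1 ≤ n → Even n → lam n = (n : ℂ) ^ 2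
  odd : ∀ n k : ℕ, Odd n → Odd k → n ≤ k → ‖lam n‖ ≤ ‖lam k‖

/-! ### The discrete problem -/

/-- The mesh step `h = π / (l + 1)`. -/
def step (l : ℕ) : ℝ := Real.pi / ((l : ℝ) + 1)

/-- The matrix of the system
`-(y_{j+1} - 2 y_j + y_{j-1}) / h ^ 2 + q(x_j) y_m = z y_j`, `j = 1, …, l`, `y_0 = y_{l+1} = 0`,
where `x_j = j h`. The entry `i : Fin l` stands for the index `i + 1`. -/
def discreteMatrix (q : ℝ → ℂ) (l m : ℕ) : Matrix (Fin l) (Fin l) ℂ := fun i j =>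
  (if i = j then 2 / (step l : ℂ) ^ 2
    else if (i : ℕ) + 1 = j ∨ (j : ℕ) + 1 = i then -1 / (step l : ℂ) ^ 2
    else 0)
  + (if (j : ℕ) + 1 = m then q (((i : ℕ) + 1 : ℝ) * step l) else 0)

/-- The eigenvalues `4 sin² (n h / 2) / h²` of the discrete problem with `q = 0`. -/
def freeEigenvalue (l n : ℕ) : ℝ := 4 * Real.sin ((n : ℝ) * step l / 2) ^ 2 / step l ^ 2

/-- `lam 1, …, lam l` is a numbering of the eigenvalues of the discrete problem (with `l = 2 m - 1`),
counted with their (algebraic) multiplicities: the even indices carry the degenerate eigenvalues,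
the odd indices carry all the others, in the order of non-decreasing modulus. -/
structure IsDiscreteNumbering (q : ℝ → ℂ) (l m : ℕ) (lam : ℕ → ℂ) : Prop where
  roots : (Finset.Icc 1 l).val.map lam = (discreteMatrix q l m).charpoly.roots
  even : ∀ n : ℕ, 1 ≤ n → n ≤ l → Even n → lam n = (freeEigenvalue l n : ℂ)
  odd : ∀ n k : ℕ, Odd n → Odd k → n ≤ k → k ≤ l → ‖lam n‖ ≤ ‖lam k‖

end FrozenArgument

end

/-! Write `z = ρ²`. Since `S(π) = -S(0) = sin(ρπ/2)/ρ`, the characteristic function factors as `S(π)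
· (C(0) + C(π))`. The first factor has the simple zeros `n²`, `n` even; the second, `oddFun`,
carries the other eigenvalues and equals `2 cos(ρπ/2)` plus two integrals of `q` against `sin/ρ`.
Two integrations by parts (`oddFun_sub_eq`) turn these integrals into `-2 q(π/2) cos(ρπ/2)/ρ²` plus
`O(exp(|Im ρ|π/2)/|ρ|³)`: the end terms combine to `(q(0) + q(π))/ρ² = 0`, the terms with `q'`
cancel or vanish. Everything is then compared with `|cos(ρπ/2)|` itself, through `exp|Im w| ≤ 2|cos
w| + 1` and the global bound `|ρ - k| ≤ |cos(ρπ/2)|` for a suitable odd integer `k`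
(`exists_odd_norm_sub_le_norm_cos`). Rouché's theorem on `|z| = (2M)²` gives exactly `M` zeros
inside, so ordering by modulus puts `λ_n` between consecutive circles. There `|cos(ρπ/2)| = O(n⁻³)`,
hence `ρ = ±n + O(n⁻³)` and `z = n² + O(n⁻²)`.

In the discrete problem the sine transform diagonalizes the free matrix and makes the frozen term a
rank-one matrix `u vᵀ` with `v_k = sin(kπ/2)`, which vanishes for even `k`. So the characteristic
polynomial splits off the factor with roots `f_n`, `n` even (`f_n` the free eigenvalues), and the
other factor is `∏ (z - f_n) · (1 - ∑ c_n/(z - f_n))` over odd `n` (`charpoly_discreteMatrix`). Two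
summations by parts, again with `q(0) + q(π) = 0` removing the boundary term, give `c_n = O(n⁻²)`
uniformly in the mesh (`exists_norm_discreteCoeff_le`). The gaps satisfy `|f_n - f_k| ≥ (4/π²)(n -
k)²`, and `∑ n⁻²(2J - n)⁻² = O(1/J)` over odd `n`. Hence Rouché's theorem applies on `|z| = f_{2J}`
for large `J`, and between two such circles the single term `c_n/(z - f_n)` must have modulus at
least `1/2`, so `|z - f_n| ≤ 2|c_n| = O(n⁻²)` (`exists_locate_roots`). For `n ≥ 2mα` this is
`O(h²)`; the indices too small for this argument occur only on finitely many meshes. -/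

namespace FrozenArgument

/-! ### Rouché's theorem on discs centred at the origin -/

/-- The function `z ↦ ∏ (z - a)`, the product being over a multiset. -/
def rootProd (s : Multiset ℂ) (z : ℂ) : ℂ := (s.map fun a => z - a).prod

@[simp] lemma rootProd_zero (z : ℂ) : rootProd 0 z = 1 := by simp [rootProd]

@[simp] lemma rootProd_cons (a : ℂ) (s : Multiset ℂ) (z : ℂ) :
    rootProd (a ::ₘ s) z = (z - a) * rootProd s z := by simp [rootProd]

lemma rootProd_ne_zero {s : Multiset ℂ} {z : ℂ} (h : z ∉ s) : rootProd s z ≠ 0 := by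
  refine Multiset.prod_ne_zero fun h0 => ?_
  obtain ⟨a, ha, he⟩ := Multiset.mem_map.1 h0
  exact h (sub_eq_zero.1 he ▸ ha)

lemma differentiable_rootProd (s : Multiset ℂ) : Differentiable ℂ (rootProd s) := by
  induction s using Multiset.induction_on with
  | empty => 
    have : rootProd 0 = fun _ => 1 := by ext; simp
    rw [this]; fun_prop
  | cons a s ih =>
    have : rootProd (a ::ₘ s) = fun z => (z - a) * rootProd s z := by ext; simp
    rw [this]; fun_prop

lemma analyticOrderAt_sub_const (a b : ℂ) :
    analyticOrderAt (fun z => z - b) a = if a = b then 1 else 0 := by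
  split_ifs with h
  · subst h
    have : AnalyticAt ℂ (fun z : ℂ => z - a) a := by fun_prop
    exact (this.analyticOrderAt_eq_natCast (n := 1)).2 ⟨fun _ => 1, by fun_prop, by simp, by simp⟩
  · exact analyticOrderAt_eq_zero.2 (Or.inr (sub_ne_zero.2 h))

lemma analyticOrderAt_rootProd_mul {s : Multiset ℂ} {g : ℂ → ℂ} {a : ℂ} (hg : AnalyticAt ℂ g a)
    (ha : g a ≠ 0) : analyticOrderAt (fun z => rootProd s z * g z) a = s.count a := by
  induction s using Multiset.induction_on with
  | empty => simpa using analyticOrderAt_eq_zero.2 (Or.inr ha)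
  | cons b s ih =>
    have e : (fun z => rootProd (b ::ₘ s) z * g z) =
        (fun z => z - b) * fun z => rootProd s z * g z := by
      ext z; simp [mul_assoc]
    have h2 : AnalyticAt ℂ (fun z => rootProd s z * g z) a :=
      ((differentiable_rootProd s).analyticAt a).mul hg
    rw [e, analyticOrderAt_mul (by fun_prop) h2, ih, analyticOrderAt_sub_const]
    by_cases h : a = b
    · subst h; simp [add_comm]
    · simp [h, Multiset.count_cons_of_ne h]

lemma exists_eq_pow_mul_of_analyticOrderAt_eq (a : ℂ) (n : ℕ) : ∀ {g : ℂ → ℂ},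
    Differentiable ℂ g → analyticOrderAt g a = n →
    ∃ k : ℂ → ℂ, Differentiable ℂ k ∧ k a ≠ 0 ∧
      ∀ z, g z = rootProd (Multiset.replicate n a) z * k z := by
  induction n with
  | zero =>
    intro g hg h
    refine ⟨g, hg, fun h0 => ?_, by simp⟩
    have := analyticOrderAt_eq_zero.1 (by simpa using h)
    simp [h0, hg.analyticAt a] at this
  | succ n ih =>
    intro g hg h
    have h0 : g a = 0 := by
      by_contra h0
      rw [analyticOrderAt_eq_zero.2 (Or.inr h0)] at h
      simp at h
      norm_cast at h
    have hd : Differentiable ℂ (dslope g a) := by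
      rw [← differentiableOn_univ]
      exact (Complex.differentiableOn_dslope Filter.univ_mem).2 hg.differentiableOn
    have e : g = (fun z => z - a) * dslope g a := by
      ext z
      have := sub_smul_dslope g a z
      simp [h0] at this
      simp [this]
    have ho : analyticOrderAt (dslope g a) a = n := by
      rw [e, analyticOrderAt_mul (by fun_prop) (hd.analyticAt a), analyticOrderAt_sub_const] at h
      simp only [if_true] at h
      push_cast at h
      rw [add_comm] at h
      exact ENat.add_left_injective_of_ne_top (n := 1) (by simp) h
    obtain ⟨k, hk, hka, hkz⟩ := ih hd ho
    refine ⟨k, hk, hka, fun z => ?_⟩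
    rw [Multiset.replicate_succ, rootProd_cons, mul_assoc, ← hkz]
    exact congrFun e z

/-- The points of `t` are divided out one at a time; by the identity theorem each order is finite
because `F` is not identically zero. This form lets zeros be counted by a finite product. -/
lemma exists_eq_rootProd_mul {F : ℂ → ℂ} (hF : Differentiable ℂ F) (h0 : ∃ z, F z ≠ 0)
    (t : Finset ℂ) : ∃ (s : Multiset ℂ) (g : ℂ → ℂ), (∀ x ∈ s, x ∈ t) ∧ Differentiable ℂ g ∧
      (∀ a ∈ t, g a ≠ 0) ∧ ∀ z, F z = rootProd s z * g z := by
  induction t using Finset.induction_on with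
  | empty => exact ⟨0, F, by simp, hF, by simp, by simp⟩
  | insert a t _ ih =>
    obtain ⟨s, g, hs, hg, hgt, hz⟩ := ih
    have hfin : analyticOrderAt g a ≠ ⊤ := by
      intro htop
      obtain ⟨w, hw⟩ := h0
      have : AnalyticOnNhd ℂ g Set.univ := fun z _ => hg.analyticAt z
      have h1 := this.eqOn_zero_of_preconnected_of_eventuallyEq_zero isPreconnected_univ
        (Set.mem_univ a) (analyticOrderAt_eq_top.1 htop) (Set.mem_univ w)
      exact hw (by simp [hz, h1])
    obtain ⟨n, hn⟩ := ENat.ne_top_iff_exists.1 hfin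
    obtain ⟨k, hk, hka, hkz⟩ := exists_eq_pow_mul_of_analyticOrderAt_eq a n hg hn.symm
    refine ⟨s + Multiset.replicate n a, k, fun x hx => ?_, hk, fun b hb => ?_, fun z => ?_⟩
    · rcases Multiset.mem_add.1 hx with h | h
      · exact Finset.mem_insert_of_mem (hs x h)
      · rw [Multiset.eq_of_mem_replicate h]; exact Finset.mem_insert_self _ _
    · rcases Finset.mem_insert.1 hb with rfl | h
      · exact hka
      · intro h'; exact hgt b h (by simp [hkz, h'])
    · rw [hz, hkz, ← mul_assoc]; simp [rootProd]

/-- The argument principle: each factor `z - a` contributes `∮ (z - a)⁻¹ = 2πi` and the zero-free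
factor contributes `0` by Cauchy's theorem. Continuity on the circle travels through the induction
to make the integral additive. -/
lemma circleIntegral_logDeriv_rootProd_mul {R : ℝ} (hR : 0 < R) {g : ℂ → ℂ}
    (hg : AnalyticOnNhd ℂ g (Metric.closedBall 0 R)) (h0 : ∀ z ∈ Metric.closedBall 0 R, g z ≠ 0)
    (s : Multiset ℂ) (hs : ∀ a ∈ s, a ∈ Metric.ball (0 : ℂ) R) :
    ContinuousOn (logDeriv fun z => rootProd s z * g z) (Metric.sphere 0 R) ∧
    (∮ z in C(0, R), logDeriv (fun z => rootProd s z * g z) z) =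
      (s.card : ℂ) * (2 * Real.pi * Complex.I) := by
  induction s using Multiset.induction_on with
  | empty =>
    have e : (fun z => rootProd 0 z * g z) = g := by ext; simp
    rw [e]
    have hd : DifferentiableOn ℂ (logDeriv g) (Metric.closedBall 0 R) := by
      intro z hz
      exact ((hg.deriv z hz).differentiableAt.div (hg z hz).differentiableAt
        (h0 z hz)).differentiableWithinAt
    refine ⟨hd.continuousOn.mono Metric.sphere_subset_closedBall, ?_⟩
    have := Complex.circleIntegral_eq_zero_of_differentiable_on_off_countable (c := 0) hR.le
      (s := ∅) (by simp) hd.continuousOn (fun z hz => hd.differentiableAt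
        (Filter.mem_of_superset (Metric.isOpen_ball.mem_nhds hz.1) Metric.ball_subset_closedBall))
    simpa using this
  | cons a s ih =>
    obtain ⟨ih1, ih2⟩ := ih (fun b hb => hs b (Multiset.mem_cons_of_mem hb))
    have ha := hs a (Multiset.mem_cons_self a s)
    have hne : ∀ z ∈ Metric.sphere (0 : ℂ) R, ∀ b ∈ a ::ₘ s, z ≠ b := by
      intro z hz b hb h
      have := hs b hb
      rw [← h] at this
      simp at this hz
      linarith
    have e : (fun z => rootProd (a ::ₘ s) z * g z) =
        fun z => (z - a) * (rootProd s z * g z) := by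
      ext z; simp [mul_assoc]
    have key : Set.EqOn (logDeriv fun z => rootProd (a ::ₘ s) z * g z)
        (fun z => (z - a)⁻¹ + logDeriv (fun z => rootProd s z * g z) z) (Metric.sphere 0 R) := by
      intro z hz
      have hz' := Metric.sphere_subset_closedBall hz
      have h1 : z - a ≠ 0 := sub_ne_zero.2 (hne z hz a (Multiset.mem_cons_self a s))
      have h2 : rootProd s z ≠ 0 := rootProd_ne_zero fun h =>
        hne z hz z (Multiset.mem_cons_of_mem h) rfl
      rw [e, logDeriv_mul (f := fun z => z - a) (g := fun z => rootProd s z * g z)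
          z h1 (mul_ne_zero h2 (h0 z hz')) (by fun_prop)
        (((differentiable_rootProd s) z).mul (hg z hz').differentiableAt)]
      simp [logDeriv_apply]
    have hc1 : ContinuousOn (fun z : ℂ => (z - a)⁻¹) (Metric.sphere 0 R) :=
      ContinuousOn.inv₀ (by fun_prop) fun z hz =>
        sub_ne_zero.2 (hne z hz a (Multiset.mem_cons_self a s))
    refine ⟨(hc1.add ih1).congr key, ?_⟩
    rw [circleIntegral.integral_congr hR.le key, circleIntegral.integral_add
      (hc1.circleIntegrable hR.le) (ih1.circleIntegrable hR.le), ih2,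
      circleIntegral.integral_sub_inv_of_mem_ball ha]
    simp; ring

lemma card_eq_card_of_norm_sub_lt {R : ℝ} (hR : 0 < R) {s t : Multiset ℂ} {g k : ℂ → ℂ}
    (hs : ∀ a ∈ s, a ∈ Metric.ball (0 : ℂ) R) (ht : ∀ a ∈ t, a ∈ Metric.ball (0 : ℂ) R)
    (hg : AnalyticOnNhd ℂ g (Metric.closedBall 0 R)) (hg0 : ∀ z ∈ Metric.closedBall 0 R, g z ≠ 0)
    (hk : AnalyticOnNhd ℂ k (Metric.closedBall 0 R)) (hk0 : ∀ z ∈ Metric.closedBall 0 R, k z ≠ 0)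
    (h : ∀ z ∈ Metric.sphere (0 : ℂ) R,
      ‖rootProd s z * g z - rootProd t z * k z‖ < ‖rootProd t z * k z‖) :
    s.card = t.card := by
  obtain ⟨c1, i1⟩ := circleIntegral_logDeriv_rootProd_mul hR hg hg0 s hs
  obtain ⟨c2, i2⟩ := circleIntegral_logDeriv_rootProd_mul hR hk hk0 t ht
  set f1 := fun z => rootProd s z * g z with hf1
  set f2 := fun z => rootProd t z * k z with hf2
  have d1 : ∀ z ∈ Metric.sphere (0 : ℂ) R, DifferentiableAt ℂ f1 z := fun z hz =>
    ((differentiable_rootProd s) z).mul (hg z (Metric.sphere_subset_closedBall hz)).differentiableAt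
  have d2 : ∀ z ∈ Metric.sphere (0 : ℂ) R, DifferentiableAt ℂ f2 z := fun z hz =>
    ((differentiable_rootProd t) z).mul (hk z (Metric.sphere_subset_closedBall hz)).differentiableAt
  have n2 : ∀ z ∈ Metric.sphere (0 : ℂ) R, f2 z ≠ 0 := fun z hz h0 => by
    have := h z hz
    change ‖_‖ < ‖f2 z‖ at this
    rw [h0, norm_zero] at this
    exact (norm_nonneg _).not_gt this
  have n1 : ∀ z ∈ Metric.sphere (0 : ℂ) R, f1 z ≠ 0 := fun z hz h0 => by
    have := h z hz
    change ‖f1 z - f2 z‖ < ‖f2 z‖ at this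
    rw [h0, zero_sub, norm_neg] at this
    exact lt_irrefl _ this
  have hslit : ∀ z ∈ Metric.sphere (0 : ℂ) R, f1 z / f2 z ∈ Complex.slitPlane := fun z hz => by
    have h1 := h z hz
    change ‖f1 z - f2 z‖ < ‖f2 z‖ at h1
    have h2 : ‖f1 z / f2 z - 1‖ < 1 := by
      rw [div_sub_one (n2 z hz), norm_div, div_lt_one (norm_pos_iff.2 (n2 z hz))]
      exact h1
    simpa using Complex.mem_slitPlane_of_norm_lt_one h2
  -- On the circle `f1 / f2` stays within distance `1` of `1`, so the principal logarithm of the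
  -- quotient is a single-valued primitive of the integrand.
  have i0 : (∮ z in C(0, R), logDeriv f1 z - logDeriv f2 z) = 0 := by
    refine circleIntegral.integral_eq_zero_of_hasDerivWithinAt hR.le
      (f := fun z => Complex.log (f1 z / f2 z)) fun z hz => ?_
    rw [← logDeriv_div z (n1 z hz) (n2 z hz) (d1 z hz) (d2 z hz)]
    exact (((d1 z hz).div (d2 z hz) (n2 z hz)).hasDerivAt.clog (hslit z hz)).hasDerivWithinAt
  rw [circleIntegral.integral_sub (c1.circleIntegrable hR.le) (c2.circleIntegrable hR.le), i1, i2,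
    ← sub_mul, mul_eq_zero] at i0
  rcases i0 with h | h
  · exact_mod_cast sub_eq_zero.1 h
  · simp [Real.pi_ne_zero] at h

/-- Rouché's theorem for entire functions. The zeros in the disc, with multiplicities, are listed
by multisets. -/
theorem exists_zeros_card_eq {F G : ℂ → ℂ} (hF : Differentiable ℂ F) (hG : Differentiable ℂ G)
    {R : ℝ} (hR : 0 < R) (h : ∀ z : ℂ, ‖z‖ = R → ‖F z - G z‖ < ‖G z‖) :
    ∃ s t : Multiset ℂ, (∀ a ∈ s, ‖a‖ < R) ∧ (∀ a ∈ t, ‖a‖ < R) ∧ s.card = t.card ∧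
      (∀ a : ℂ, ‖a‖ < R → analyticOrderAt F a = s.count a) ∧
      (∀ a : ℂ, ‖a‖ < R → analyticOrderAt G a = t.count a) := by
  have nG : ∀ z : ℂ, ‖z‖ = R → G z ≠ 0 := fun z hz h0 => by
    have := h z hz
    rw [h0, norm_zero] at this
    exact (norm_nonneg _).not_gt this
  have nF : ∀ z : ℂ, ‖z‖ = R → F z ≠ 0 := fun z hz h0 => by
    have := h z hz
    rw [h0, zero_sub, norm_neg] at this
    exact lt_irrefl _ this
  have main : ∀ H : ℂ → ℂ, Differentiable ℂ H → (∀ z : ℂ, ‖z‖ = R → H z ≠ 0) →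
      ∃ (s : Multiset ℂ) (g : ℂ → ℂ), (∀ a ∈ s, ‖a‖ < R) ∧ Differentiable ℂ g ∧
        (∀ a ∈ Metric.closedBall (0 : ℂ) R, g a ≠ 0) ∧ ∀ z, H z = rootProd s z * g z := by
    intro H hH nH
    have hex : ∃ z, H z ≠ 0 := ⟨R, nH R (by simp [hR.le])⟩
    -- Infinitely many zeros in a compact disc would accumulate, and the identity theorem would
    -- force `H = 0`.
    have hfin : {z ∈ Metric.closedBall (0 : ℂ) R | H z = 0}.Finite := by
      by_contra hinf
      obtain ⟨x, hx, hacc⟩ := Set.Infinite.exists_accPt_of_subset_isCompact hinf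
        (isCompact_closedBall (0 : ℂ) R) (Set.sep_subset _ _)
      have ha : AnalyticOnNhd ℂ H Set.univ := fun z _ => hH.analyticAt z
      have := ha.eqOn_zero_of_preconnected_of_frequently_eq_zero isPreconnected_univ
        (Set.mem_univ x) ((accPt_iff_frequently_nhdsNE.1 hacc).mono fun z hz => hz.2)
      obtain ⟨w, hw⟩ := hex
      exact hw (this (Set.mem_univ w))
    obtain ⟨s, g, hs, hg, hg0, hz⟩ := exists_eq_rootProd_mul hH hex hfin.toFinset
    refine ⟨s, g, fun a ha => ?_, hg, fun a ha h0 => ?_, hz⟩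
    · have := hs a ha
      simp only [Set.Finite.mem_toFinset, Set.mem_ofPred_eq, mem_closedBall_zero_iff] at this
      exact lt_of_le_of_ne this.1 fun e => nH a e this.2
    · refine hg0 a ?_ h0
      simp only [Set.Finite.mem_toFinset, Set.mem_ofPred_eq]
      exact ⟨ha, by simp [hz, h0]⟩
  obtain ⟨s, g, hs, hg, hg0, hz⟩ := main F hF nF
  obtain ⟨t, k, ht, hk, hk0, hw⟩ := main G hG nG
  refine ⟨s, t, hs, ht, ?_, fun a ha => ?_, fun a ha => ?_⟩
  · refine card_eq_card_of_norm_sub_lt hR (g := g) (k := k) (by simpa using hs) (by simpa using ht)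
      (fun z _ => hg.analyticAt z) hg0 (fun z _ => hk.analyticAt z) hk0 fun z hz' => ?_
    rw [← hz, ← hw]
    exact h z (by simpa using hz')
  · rw [← analyticOrderAt_rootProd_mul (hg.analyticAt a) (hg0 a (by simpa using ha.le))]
    congr 1; ext z; exact hz z
  · rw [← analyticOrderAt_rootProd_mul (hk.analyticAt a) (hk0 a (by simpa using ha.le))]
    congr 1; ext z; exact hw z

/-! ### Enumerations by non-decreasing modulus -/

/-- If a sequence with non-decreasing moduli, defined on an initial segment `I` of `ℕ`, lists the
points of the disc `‖z‖ < R` with multiplicities prescribed by `s`, then exactly its first `card s`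
terms lie in the disc. -/
lemma norm_lt_iff_lt_card {μ : ℕ → ℂ} {I : Set ℕ} (hI : ∀ i ∈ I, ∀ j ≤ i, j ∈ I)
    (hμ : ∀ i ∈ I, ∀ j ≤ i, ‖μ j‖ ≤ ‖μ i‖) {R : ℝ} {s : Multiset ℂ} (hs : ∀ a ∈ s, ‖a‖ < R)
    (hcount : ∀ z : ℂ, ‖z‖ < R → {i ∈ I | μ i = z}.encard = s.count z) {i : ℕ} (hi : i ∈ I) :
    ‖μ i‖ < R ↔ i < s.card := by
  classical
  -- `B` is an initial segment because the moduli do not decrease, and counting it fibre by fibre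
  -- over the values of `μ` gives `card s` elements.
  set B : Set ℕ := {i ∈ I | ‖μ i‖ < R} with hB
  have hmaps : ∀ j ∈ B, μ j ∈ s.toFinset := by
    intro j hj
    rw [Multiset.mem_toFinset, ← Multiset.count_ne_zero]
    intro h0
    have := hcount (μ j) hj.2
    rw [h0, Nat.cast_zero, Set.encard_eq_zero] at this
    exact (Set.mem_empty_iff_false j).1 (this ▸ ⟨hj.1, rfl⟩)
  have hfib : ∀ z ∈ s.toFinset, {i ∈ I | μ i = z}.Finite := fun z hz =>
    Set.finite_of_encard_eq_coe (hcount z (hs z (Multiset.mem_toFinset.1 hz)))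
  have hBfin : B.Finite := by
    refine (Set.Finite.biUnion s.toFinset.finite_toSet hfib).subset fun j hj => ?_
    simp only [Set.mem_iUnion]
    exact ⟨μ j, hmaps j hj, hj.1, rfl⟩
  have hcard : hBfin.toFinset.card = s.card := by
    rw [Finset.card_eq_sum_card_fiberwise (f := μ) (t := s.toFinset)
      (fun j hj => hmaps j (by simpa using hj)), ← Multiset.toFinset_sum_count_eq s]
    refine Finset.sum_congr rfl fun z hz => ?_
    have hzR := hs z (Multiset.mem_toFinset.1 hz)
    have e : ((hBfin.toFinset.filter fun j => μ j = z : Finset ℕ) : Set ℕ) =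
        {i ∈ I | μ i = z} := by
      ext j
      simp only [Finset.coe_filter, Set.Finite.mem_toFinset, Set.mem_ofPred_eq, hB]
      constructor
      · rintro ⟨⟨h1, _⟩, h2⟩; exact ⟨h1, h2⟩
      · rintro ⟨h1, h2⟩; exact ⟨⟨h1, h2 ▸ hzR⟩, h2⟩
    have := hcount z hzR
    rw [← e, Set.encard_coe_eq_coe_finsetCard] at this
    exact_mod_cast this
  constructor
  · intro h
    have : Finset.range (i + 1) ⊆ hBfin.toFinset := fun j hj => by
      have hj : j ≤ i := Nat.lt_succ_iff.1 (Finset.mem_range.1 hj)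
      simpa using ⟨hI i hi j hj, (hμ i hi j hj).trans_lt h⟩
    have := Finset.card_le_card this
    rw [Finset.card_range, hcard] at this
    exact this
  · intro h
    by_contra hn
    have : hBfin.toFinset ⊆ Finset.range i := fun j hj => by
      have hj : j ∈ B := by simpa using hj
      rw [Finset.mem_range]
      by_contra hji
      exact hn ((hμ j hj.1 i (not_lt.1 hji)).trans_lt hj.2)
    have := Finset.card_le_card this
    rw [Finset.card_range, hcard] at this
    omega

/-- Each point `z` is replaced by `ord z` copies `(z, i)`, ordered lexicographically by modulus,
real part, imaginary part and `i`. Discs contain finitely many copies, so initial segments are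
finite; the clause `M ≤ s.card` makes the whole set infinite. Such a linear order is isomorphic to
`ℕ`, and the isomorphism is the enumeration. -/
lemma exists_enumeration {ord : ℂ → ℕ}
    (h : ∀ (M : ℕ) (r : ℝ), ∃ R ≥ r, ∃ s : Multiset ℂ, (∀ a ∈ s, ‖a‖ < R) ∧ M ≤ s.card ∧
      ∀ a, ‖a‖ < R → ord a = s.count a) :
    ∃ μ : ℕ → ℂ, (∀ i j, i ≤ j → ‖μ i‖ ≤ ‖μ j‖) ∧ ∀ z, {i | μ i = z}.encard = ord z := by
  classical
  let T := {p : ℂ × ℕ // p.2 < ord p.1}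
  let f : T → ℝ ×ₗ (ℝ ×ₗ (ℝ ×ₗ ℕ)) := fun p =>
    toLex (‖p.1.1‖, toLex (p.1.1.re, toLex (p.1.1.im, p.1.2)))
  have hf : Function.Injective f := by
    rintro ⟨⟨z, i⟩, hz⟩ ⟨⟨w, j⟩, hw⟩ he
    simp only [f, EmbeddingLike.apply_eq_iff_eq, Prod.mk.injEq] at he
    obtain ⟨-, h1, h2, h3⟩ := he
    exact Subtype.ext (Prod.ext (Complex.ext h1 h2) h3)
  let : LinearOrder T := LinearOrder.lift' f hf
  have hnorm : ∀ p q : T, p ≤ q → ‖p.1.1‖ ≤ ‖q.1.1‖ := by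
    intro p q hpq
    have : f p ≤ f q := hpq
    rcases Prod.Lex.le_iff.1 this with h | h
    · exact h.le
    · exact h.1.le
  have hIic : ∀ t : T, (Set.Iic t).Finite := by
    intro t
    obtain ⟨R, hR, s, -, -, hs⟩ := h 0 (‖t.1.1‖ + 1)
    refine Set.Finite.of_finite_image (f := Subtype.val)
      (s.toEnumFinset.finite_toSet.subset ?_) Subtype.val_injective.injOn
    rintro _ ⟨p, hp, rfl⟩
    have h1 : ‖p.1.1‖ < R := by have := hnorm p t hp; linarith
    have := p.2
    rw [hs _ h1] at this
    simpa [Multiset.mem_toEnumFinset] using this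
  have hcardT : ∀ M : ℕ, ∃ t : Finset T, M ≤ t.card := by
    intro M
    obtain ⟨R, -, s, hsR, hM, hs⟩ := h M 0
    have hp : ∀ p ∈ s.toEnumFinset, p.2 < ord p.1 := by
      intro p hp
      have := (Multiset.mem_toEnumFinset s p).1 hp
      rwa [hs p.1 (hsR _ (Multiset.count_pos.1 (by omega)))]
    refine ⟨s.toEnumFinset.subtype _, ?_⟩
    rw [Finset.card_subtype, Finset.filter_true_of_mem hp, Multiset.card_toEnumFinset]
    exact hM
  have : Infinite T := by
    by_contra hfin
    have := not_infinite_iff_finite.1 hfin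
    have := Fintype.ofFinite T
    obtain ⟨t, ht⟩ := hcardT (Fintype.card T + 1)
    have := Finset.card_le_univ t
    omega
  have : NoMaxOrder T := ⟨fun a => by
    by_contra! hn
    have : (Set.univ : Set T).Finite := (hIic a).subset fun x _ => hn x
    exact Set.infinite_univ this⟩
  let : LocallyFiniteOrder T := LocallyFiniteOrder.ofFiniteIcc fun a b =>
    (hIic b).subset Set.Icc_subset_Iic_self
  obtain ⟨t0⟩ := (inferInstance : Nonempty T)
  obtain ⟨b, hb, hbmin⟩ := Set.exists_min_image (Set.Iic t0) id (hIic t0) ⟨t0, Set.mem_Iic.2 le_rfl⟩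
  have hbot : ∀ x : T, b ≤ x := fun x => by
    rcases le_total x t0 with hx | hx
    · exact hbmin x hx
    · exact (Set.mem_Iic.1 hb).trans hx
  let : OrderBot T := { bot := b, bot_le := hbot }
  let : SuccOrder T := LinearLocallyFiniteOrder.succOrder T
  let : PredOrder T := LinearLocallyFiniteOrder.predOrder T
  let e := (orderIsoNatOfLinearSuccPredArch (ι := T)).symm
  refine ⟨fun i => (e i).1.1, fun i j hij => hnorm _ _ (e.monotone hij), fun z => ?_⟩
  have : {i | (e i).1.1 = z} = e ⁻¹' {p : T | p.1.1 = z} := rfl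
  rw [this, Set.encard_preimage_of_bijective e.bijective]
  have h2 : (Subtype.val : T → ℂ × ℕ) '' {p : T | p.1.1 = z} =
      (Prod.mk z) '' (Finset.range (ord z) : Set ℕ) := by
    ext ⟨w, i⟩
    simp only [Set.mem_image, Finset.coe_range, Set.mem_Iio, Prod.mk.injEq]
    constructor
    · rintro ⟨p, hp, hpe⟩
      have hp : p.1.1 = z := hp
      have := p.2
      rw [hpe] at this hp
      simp only at hp this
      exact ⟨i, hp ▸ this, hp.symm, rfl⟩
    · rintro ⟨j, hj, rfl, rfl⟩
      exact ⟨⟨(z, j), hj⟩, rfl, rfl⟩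
  rw [← Subtype.val_injective.encard_image, h2, (Prod.mk_right_injective z).encard_image,
    Set.encard_coe_eq_coe_finsetCard, Finset.card_range]

/-! ### The entire functions `cos (ρ s)` and `sin (ρ s) / ρ` of `z = ρ ^ 2` -/

lemma rho_sq (z : ℂ) : rho z ^ 2 = z := by
  simp [rho]

lemma norm_rho_sq (z : ℂ) : ‖rho z‖ ^ 2 = ‖z‖ := by rw [← norm_pow, rho_sq]

lemma rho_zero : rho 0 = 0 := by simpa using rho_sq 0

lemma rho_ne_zero {z : ℂ} (hz : z ≠ 0) : rho z ≠ 0 := fun h => hz (by rw [← rho_sq z, h]; simp)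

lemma continuousAt_rho_zero : ContinuousAt rho 0 := by
  rw [ContinuousAt, rho_zero, tendsto_zero_iff_norm_tendsto_zero]
  have h : ∀ z : ℂ, ‖rho z‖ = √‖z‖ := fun z => by
    rw [← norm_rho_sq z, Real.sqrt_sq (norm_nonneg _)]
  simp only [h]
  have : ContinuousAt (fun z : ℂ => √‖z‖) 0 := by fun_prop
  simpa [ContinuousAt] using this

/-- The entire function `cos (ρ s)` of `z = ρ ^ 2`. -/
noncomputable def cosRho (s : ℝ) (z : ℂ) : ℂ := Complex.cos (rho z * s)

lemma cosRho_eq {w z : ℂ} (h : w ^ 2 = z) (s : ℝ) : cosRho s z = Complex.cos (w * s) := by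
  rcases sq_eq_sq_iff_eq_or_eq_neg.1 (h.trans (rho_sq z).symm) with h | h
  · rw [cosRho, h]
  · rw [cosRho, h, neg_mul, Complex.cos_neg]

lemma sinDiv_eq {w z : ℂ} (h : w ^ 2 = z) (hz : z ≠ 0) (s : ℝ) :
    sinDiv s z = Complex.sin (w * s) / w := by
  rw [sinDiv, if_neg hz]
  rcases sq_eq_sq_iff_eq_or_eq_neg.1 (h.trans (rho_sq z).symm) with h | h
  · rw [h]
  · rw [h, neg_mul, Complex.sin_neg, neg_div_neg_eq]

lemma sinDiv_eq_rho {z : ℂ} (hz : z ≠ 0) (s : ℝ) :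
    sinDiv s z = Complex.sin (rho z * s) / rho z := sinDiv_eq (rho_sq z) hz s

lemma rho_mul_sinDiv (s : ℝ) (z : ℂ) : rho z * sinDiv s z = Complex.sin (rho z * s) := by
  by_cases hz : z = 0
  · simp [hz, rho_zero]
  · rw [sinDiv_eq_rho hz, mul_div_cancel₀ _ (rho_ne_zero hz)]

lemma cosRho_sq_add (s : ℝ) (z : ℂ) : cosRho s z ^ 2 + z * sinDiv s z ^ 2 = 1 := by
  have h := Complex.sin_sq_add_cos_sq (rho z * s)
  rw [← rho_mul_sinDiv, mul_pow, rho_sq] at h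
  rw [cosRho, add_comm, h]

lemma sinDiv_neg (s : ℝ) (z : ℂ) : sinDiv (-s) z = -sinDiv s z := by
  by_cases hz : z = 0
  · simp [hz, sinDiv]
  · simp [sinDiv_eq_rho hz, neg_div]

lemma cosRho_neg (s : ℝ) (z : ℂ) : cosRho (-s) z = cosRho s z := by simp [cosRho]

@[simp] lemma sinDiv_zero (z : ℂ) : sinDiv 0 z = 0 := by
  by_cases hz : z = 0
  · simp [hz, sinDiv]
  · simp [sinDiv_eq_rho hz]

@[simp] lemma cosRho_zero (z : ℂ) : cosRho 0 z = 1 := by simp [cosRho]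

lemma sinDiv_add (s t : ℝ) (z : ℂ) :
    sinDiv (s + t) z = sinDiv s z * cosRho t z + cosRho s z * sinDiv t z := by
  by_cases hz : z = 0
  · simp [hz, sinDiv, cosRho, rho_zero]
  · rw [sinDiv_eq_rho hz, sinDiv_eq_rho hz, sinDiv_eq_rho hz, cosRho, cosRho]
    push_cast
    rw [mul_add, Complex.sin_add]
    ring

/-- `dslope Complex.sin 0` is the entire function `sin w / w`, so this formula covers `z = 0`
without a case split and yields continuity and bounds there. -/
lemma sinDiv_eq_mul_dslope (s : ℝ) (z : ℂ) :
    sinDiv s z = s * dslope Complex.sin 0 (rho z * s) := by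
  by_cases hz : z = 0
  · simp [hz, sinDiv, rho_zero]
  · by_cases hs : s = 0
    · simp [hs]
    · have h1 : rho z * s ≠ 0 := mul_ne_zero (rho_ne_zero hz) (by exact_mod_cast hs)
      have h2 := rho_ne_zero hz
      have h3 : (s : ℂ) ≠ 0 := by exact_mod_cast hs
      rw [dslope_of_ne _ h1, slope_def_field, sinDiv_eq_rho hz]
      simp
      field_simp

lemma continuous_dslope_sin : Continuous (dslope Complex.sin 0) := by
  have : DifferentiableOn ℂ (dslope Complex.sin 0) Set.univ :=
    (Complex.differentiableOn_dslope Filter.univ_mem).2 Complex.differentiable_sin.differentiableOn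
  exact (differentiableOn_univ.1 this).continuous

@[fun_prop] lemma continuous_sinDiv (z : ℂ) : Continuous fun s => sinDiv s z := by
  simp only [sinDiv_eq_mul_dslope]
  have := continuous_dslope_sin
  fun_prop

@[fun_prop] lemma continuous_cosRho (z : ℂ) : Continuous fun s => cosRho s z := by
  unfold cosRho; fun_prop

lemma exists_norm_sinDiv_cosRho_le (K : ℝ) : ∃ B : ℝ, ∀ (s : ℝ) (z : ℂ), |s| ≤ K → ‖z‖ ≤ K →
    ‖sinDiv s z‖ ≤ B ∧ ‖cosRho s z‖ ≤ B := by
  obtain ⟨B1, h1⟩ := (isCompact_closedBall (0 : ℂ) (√K * K)).exists_bound_of_continuousOn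
    continuous_dslope_sin.continuousOn
  obtain ⟨B2, h2⟩ := (isCompact_closedBall (0 : ℂ) (√K * K)).exists_bound_of_continuousOn
    Complex.continuous_cos.continuousOn
  refine ⟨max (K * B1) B2, fun s z hs hz => ?_⟩
  have hK : 0 ≤ K := (abs_nonneg s).trans hs
  have hmem : rho z * s ∈ Metric.closedBall (0 : ℂ) (√K * K) := by
    rw [mem_closedBall_zero_iff, norm_mul, Complex.norm_real, Real.norm_eq_abs]
    refine mul_le_mul (Real.le_sqrt_of_sq_le ?_) hs (abs_nonneg _) (Real.sqrt_nonneg _)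
    rw [norm_rho_sq]; exact hz
  constructor
  · rw [sinDiv_eq_mul_dslope, norm_mul, Complex.norm_real, Real.norm_eq_abs]
    exact (mul_le_mul hs (h1 _ hmem) (norm_nonneg _) hK).trans (le_max_left _ _)
  · exact (h2 _ hmem).trans (le_max_right _ _)

/-- `cosRho` and `sinDiv` do not see the sign of the root, so they may be differentiated with any
branch that is holomorphic near `z`: `rho` off its cut, and `I * rho (-u)` on the cut. -/
lemma exists_local_sqrt {z : ℂ} (hz : z ≠ 0) : ∃ w : ℂ → ℂ, (∀ u, w u ^ 2 = u) ∧
    HasDerivAt w (1 / (2 * w z)) z := by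
  have main : ∀ v ∈ Complex.slitPlane, HasDerivAt rho (1 / (2 * rho v)) v := by
    intro v hv
    have h := (hasDerivAt_id v).cpow_const (c := 1 / 2) hv
    have hv0 := Complex.slitPlane_ne_zero hv
    have e : (1 / 2 : ℂ) * id v ^ ((1 / 2 : ℂ) - 1) * 1 = 1 / (2 * rho v) := by
      have h2 := rho_ne_zero hv0
      rw [id, Complex.cpow_sub _ _ hv0, Complex.cpow_one]
      change 1 / 2 * (rho v / v) * 1 = _
      nth_rewrite 2 [← rho_sq v]
      field_simp
    rw [e] at h
    exact h
  by_cases h : z ∈ Complex.slitPlane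
  · exact ⟨rho, rho_sq, main z h⟩
  · have h' : -z ∈ Complex.slitPlane := by
      rcases Complex.mem_slitPlane_or_neg_mem_slitPlane hz with h1 | h1
      · exact absurd h1 h
      · exact h1
    refine ⟨fun u => Complex.I * rho (-u), fun u => by rw [mul_pow, rho_sq]; simp, ?_⟩
    have h3 := ((main _ h').comp z (hasDerivAt_neg z)).const_mul Complex.I
    have h2 : rho (-z) ≠ 0 := rho_ne_zero (neg_ne_zero.2 hz)
    have e : Complex.I * (1 / (2 * rho (-z)) * -1) = 1 / (2 * (Complex.I * rho (-z))) := by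
      field_simp
      simp
    rw [e] at h3
    exact h3

lemma hasDerivAt_cosRho (s : ℝ) {z : ℂ} (hz : z ≠ 0) :
    HasDerivAt (cosRho s) (-(s / 2) * sinDiv s z) z := by
  obtain ⟨w, hw, hd⟩ := exists_local_sqrt hz
  have hwz : w z ≠ 0 := fun h => hz (by rw [← hw z, h]; simp)
  have e : cosRho s = fun u => Complex.cos (w u * s) := by
    ext u; exact cosRho_eq (hw u) s
  rw [e]
  convert (hd.mul_const (s : ℂ)).ccos using 1
  rw [sinDiv_eq (hw z) hz]
  field_simp

lemma hasDerivAt_sinDiv (s : ℝ) {z : ℂ} (hz : z ≠ 0) :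
    HasDerivAt (sinDiv s) ((s * cosRho s z - sinDiv s z) / (2 * z)) z := by
  obtain ⟨w, hw, hd⟩ := exists_local_sqrt hz
  have hwz : w z ≠ 0 := fun h => hz (by rw [← hw z, h]; simp)
  have e : sinDiv s =ᶠ[nhds z] fun u => Complex.sin (w u * s) / w u := by
    filter_upwards [isOpen_ne.mem_nhds hz] with u hu using sinDiv_eq (hw u) hu s
  refine HasDerivAt.congr_of_eventuallyEq ?_ e
  have h := (hd.mul_const (s : ℂ)).csin.div hd hwz
  refine h.congr_deriv ?_
  rw [sinDiv_eq (hw z) hz, cosRho_eq (hw z)]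
  have : z = w z ^ 2 := (hw z).symm
  rw [show (2 : ℂ) * z = 2 * w z ^ 2 by rw [hw]]
  field_simp

lemma differentiable_of_punctured {f : ℂ → ℂ} (h : ∀ z ≠ 0, DifferentiableAt ℂ f z)
    (hc : ContinuousAt f 0) : Differentiable ℂ f := by
  intro z
  by_cases hz : z = 0
  · subst hz
    refine (Complex.analyticAt_of_differentiable_on_punctured_nhds_of_continuousAt ?_
      hc).differentiableAt
    filter_upwards [self_mem_nhdsWithin] with z hz using h z hz
  · exact h z hz

lemma continuousAt_sinDiv_zero (s : ℝ) : ContinuousAt (sinDiv s) 0 := by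
  have e : sinDiv s = fun z => s * dslope Complex.sin 0 (rho z * s) := by
    ext z; exact sinDiv_eq_mul_dslope s z
  rw [e]
  exact continuousAt_const.mul (continuous_dslope_sin.continuousAt.comp
    (continuousAt_rho_zero.mul continuousAt_const))

lemma differentiable_sinDiv (s : ℝ) : Differentiable ℂ (sinDiv s) :=
  differentiable_of_punctured (fun _ hz => (hasDerivAt_sinDiv s hz).differentiableAt)
    (continuousAt_sinDiv_zero s)

lemma differentiable_cosRho (s : ℝ) : Differentiable ℂ (cosRho s) :=
  differentiable_of_punctured (fun _ hz => (hasDerivAt_cosRho s hz).differentiableAt)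
    (Complex.continuous_cos.continuousAt.comp (continuousAt_rho_zero.mul continuousAt_const))

/-- Away from `0` one differentiates under the integral sign; at `0`, where the derivative formula
divides by `z`, dominated convergence gives continuity and the singularity is removable. -/
lemma differentiable_integral_mul_sinDiv {p : ℝ → ℂ} (hp : Continuous p) {φ : ℝ → ℝ}
    (hφ : Continuous φ) (c d : ℝ) :
    Differentiable ℂ fun z => ∫ t in c..d, p t * sinDiv (φ t) z := by
  obtain ⟨P, hP⟩ := (isCompact_uIcc (a := c) (b := d)).exists_bound_of_continuousOn hp.continuousOn
  obtain ⟨Q, hQ⟩ := (isCompact_uIcc (a := c) (b := d)).exists_bound_of_continuousOn hφ.continuousOn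
  have hQ0 : 0 ≤ Q := (norm_nonneg _).trans (hQ c Set.left_mem_uIcc)
  have hP0 : 0 ≤ P := (norm_nonneg _).trans (hP c Set.left_mem_uIcc)
  have hcont : ∀ z, Continuous fun t => p t * sinDiv (φ t) z := fun z =>
    hp.mul ((continuous_sinDiv z).comp hφ)
  refine differentiable_of_punctured (fun z hz => ?_) ?_
  · obtain ⟨B, hB⟩ := exists_norm_sinDiv_cosRho_le (max Q (‖z‖ + ‖z‖))
    have hz0 : 0 < ‖z‖ := norm_pos_iff.2 hz
    have hball : ∀ u ∈ Metric.ball z (‖z‖ / 2), ‖z‖ / 2 ≤ ‖u‖ ∧ ‖u‖ ≤ ‖z‖ + ‖z‖ := by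
      intro u hu
      rw [mem_ball_iff_norm] at hu
      have h1 := norm_sub_norm_le z u
      have h2 := norm_sub_norm_le u z
      rw [norm_sub_rev] at h1
      constructor <;> linarith
    refine (intervalIntegral.hasDerivAt_integral_of_dominated_loc_of_deriv_le
      (F' := fun u t => p t * ((φ t * cosRho (φ t) u - sinDiv (φ t) u) / (2 * u)))
      (bound := fun _ => P * ((Q * B + B) / ‖z‖))
      (Metric.ball_mem_nhds z (half_pos hz0)) ?_ ?_ ?_ ?_ ?_ ?_).2.differentiableAt
    · exact Filter.Eventually.of_forall fun u => (hcont u).aestronglyMeasurable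
    · exact (hcont z).intervalIntegrable _ _
    · refine Continuous.aestronglyMeasurable ?_
      have h1 := (continuous_sinDiv z).comp hφ
      have h2 := (continuous_cosRho z).comp hφ
      simp only [Function.comp_def] at h1 h2
      fun_prop
    · refine Filter.Eventually.of_forall fun t ht u hu => ?_
      have ht' := Set.uIoc_subset_uIcc ht
      obtain ⟨h1, h2⟩ := hball u hu
      have hq := hQ t ht'
      rw [Real.norm_eq_abs] at hq
      obtain ⟨hs, hc⟩ := hB (φ t) u (hq.trans (le_max_left _ _)) (h2.trans (le_max_right _ _))
      have hB0 : 0 ≤ B := (norm_nonneg _).trans hs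
      rw [norm_mul, norm_div]
      refine mul_le_mul (hP t ht') ?_ (by positivity) hP0
      refine div_le_div₀ (by positivity) ?_ hz0 ?_
      · refine (norm_sub_le _ _).trans (add_le_add ?_ hs)
        rw [norm_mul, Complex.norm_real, Real.norm_eq_abs]
        exact mul_le_mul hq hc (norm_nonneg _) hQ0
      · rw [norm_mul]; norm_num; linarith
    · simp
    · refine Filter.Eventually.of_forall fun t ht u hu => ?_
      have hu0 : u ≠ 0 := norm_pos_iff.1 (by have := (hball u hu).1; linarith)
      exact (hasDerivAt_sinDiv (φ t) hu0).const_mul (p t)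
  · obtain ⟨B, hB⟩ := exists_norm_sinDiv_cosRho_le (max Q 1)
    refine intervalIntegral.continuousAt_of_dominated_interval (bound := fun _ => P * B) ?_ ?_ ?_ ?_
    · exact Filter.Eventually.of_forall fun u => (hcont u).aestronglyMeasurable
    · filter_upwards [Metric.closedBall_mem_nhds (0 : ℂ) one_pos] with u hu
      refine Filter.Eventually.of_forall fun t ht => ?_
      have ht' := Set.uIoc_subset_uIcc ht
      have hq := hQ t ht'
      rw [Real.norm_eq_abs] at hq
      rw [mem_closedBall_zero_iff] at hu
      rw [norm_mul]
      exact mul_le_mul (hP t ht') (hB (φ t) u (hq.trans (le_max_left _ _))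
        (hu.trans (le_max_right _ _))).1 (norm_nonneg _) hP0
    · simp
    · exact Filter.Eventually.of_forall fun t _ =>
        continuousAt_const.mul (continuousAt_sinDiv_zero (φ t))

lemma cosRho_eq_zero_iff {z : ℂ} :
    cosRho (Real.pi / 2) z = 0 ↔ ∃ i : ℕ, z = (2 * i + 1 : ℂ) ^ 2 := by
  have hpi : (Real.pi : ℂ) ≠ 0 := by exact_mod_cast Real.pi_ne_zero
  constructor
  · intro h
    obtain ⟨k, hk⟩ := Complex.cos_eq_zero_iff.1 h
    have hk' : rho z = 2 * k + 1 := by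
      push_cast at hk
      field_simp at hk
      exact hk
    have hz : z = (2 * k + 1 : ℂ) ^ 2 := by rw [← hk', rho_sq]
    rcases le_or_gt 0 k with h0 | h0
    · lift k to ℕ using h0
      exact ⟨k, by simpa using hz⟩
    · obtain ⟨i, hi⟩ := Int.eq_ofNat_of_zero_le (a := -k - 1) (by omega)
      refine ⟨i, ?_⟩
      have : (k : ℂ) = -i - 1 := by
        have : k = -(i : ℤ) - 1 := by omega
        rw [this]; push_cast; ring
      rw [hz, this]; ring
  · rintro ⟨i, rfl⟩
    rw [cosRho_eq rfl, Complex.cos_eq_zero_iff]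
    exact ⟨i, by push_cast; ring⟩

lemma sinDiv_eq_zero_iff {z : ℂ} :
    sinDiv (Real.pi / 2) z = 0 ↔ ∃ n : ℕ, 1 ≤ n ∧ Even n ∧ z = (n : ℂ) ^ 2 := by
  have hpi : (Real.pi : ℂ) ≠ 0 := by exact_mod_cast Real.pi_ne_zero
  constructor
  · intro h
    have hz0 : z ≠ 0 := by
      rintro rfl
      simp [sinDiv, hpi] at h
    have h1 : Complex.sin (rho z * (Real.pi / 2 : ℝ)) = 0 := by
      rw [← rho_mul_sinDiv, h, mul_zero]
    obtain ⟨k, hk⟩ := Complex.sin_eq_zero_iff.1 h1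
    have hk' : rho z = 2 * k := by
      push_cast at hk
      field_simp at hk
      rw [hk]
    have hz : z = (2 * k : ℂ) ^ 2 := by rw [← hk', rho_sq]
    refine ⟨2 * k.natAbs, ?_, even_two_mul _, ?_⟩
    · have : k ≠ 0 := by rintro rfl; simp at hz; exact hz0 hz
      have := Int.natAbs_pos.2 this
      omega
    · rw [hz]
      push_cast
      rw [mul_pow, mul_pow, Nat.cast_natAbs]
      congr 1
      exact_mod_cast (sq_abs k).symm
  · rintro ⟨n, hn, ⟨k, rfl⟩, rfl⟩
    have h0 : ((k + k : ℕ) : ℂ) ≠ 0 := by exact_mod_cast (by omega)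
    rw [sinDiv_eq rfl (pow_ne_zero 2 h0), div_eq_zero_iff]
    left
    rw [Complex.sin_eq_zero_iff]
    exact ⟨k, by push_cast; ring⟩

/-- By `cosRho_sq_add` the cosine and the sine have no common zero, so the derivative of either does
not vanish at its zeros. -/
lemma analyticOrderAt_sinDiv {z : ℂ} (h : sinDiv (Real.pi / 2) z = 0) :
    analyticOrderAt (sinDiv (Real.pi / 2)) z = 1 := by
  have hz : z ≠ 0 := by
    rintro rfl
    simp [sinDiv, Real.pi_ne_zero] at h
  refine ((differentiable_sinDiv _).analyticAt z).analyticOrderAt_eq_one_of_zero_deriv_ne_zero h ?_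
  rw [(hasDerivAt_sinDiv _ hz).deriv, h]
  have h1 := cosRho_sq_add (Real.pi / 2) z
  have h2 : cosRho (Real.pi / 2) z ≠ 0 := by
    intro h3; simp [h, h3] at h1
  simp [hz, h2, Real.pi_ne_zero]

lemma analyticOrderAt_cosRho {z : ℂ} (h : cosRho (Real.pi / 2) z = 0) :
    analyticOrderAt (fun z => 2 * cosRho (Real.pi / 2) z) z = 1 := by
  have hz : z ≠ 0 := by
    rintro rfl
    simp [cosRho, rho_zero] at h
  have hd : Differentiable ℂ fun z => 2 * cosRho (Real.pi / 2) z :=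
    (differentiable_cosRho _).const_mul 2
  refine (hd.analyticAt z).analyticOrderAt_eq_one_of_zero_deriv_ne_zero (by simp [h]) ?_
  rw [((hasDerivAt_cosRho _ hz).const_mul 2).deriv]
  have h1 := cosRho_sq_add (Real.pi / 2) z
  have h2 : sinDiv (Real.pi / 2) z ≠ 0 := by
    intro h3; simp [h, h3] at h1
  simp [h2, Real.pi_ne_zero]

/-- The zeros are the simple points `(2i + 1)²`, and `2i + 1 < 2M` means `i < M`. -/
lemma card_zeros_cosRho {M : ℕ} {t : Multiset ℂ} (ht : ∀ a ∈ t, ‖a‖ < (2 * M : ℝ) ^ 2)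
    (hcount : ∀ a : ℂ, ‖a‖ < (2 * M : ℝ) ^ 2 →
      analyticOrderAt (fun z => 2 * cosRho (Real.pi / 2) z) a = t.count a) : t.card = M := by
  have hnorm : ∀ i : ℕ, ‖(2 * i + 1 : ℂ) ^ 2‖ = (2 * i + 1 : ℝ) ^ 2 := by
    intro i
    rw [norm_pow]
    congr 1
    exact_mod_cast Complex.norm_natCast (2 * i + 1)
  have hinj : Function.Injective fun i : ℕ => (2 * i + 1 : ℂ) ^ 2 := by
    intro i j h
    have h := congrArg norm h
    simp only [hnorm] at h
    have h : (2 * i + 1) ^ 2 = (2 * j + 1) ^ 2 := by exact_mod_cast h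
    have := Nat.pow_left_injective (n := 2) (by norm_num) h
    omega
  have hlt : ∀ i : ℕ, ‖(2 * i + 1 : ℂ) ^ 2‖ < (2 * M : ℝ) ^ 2 ↔ i < M := by
    intro i
    rw [hnorm, sq_lt_sq₀ (by positivity) (by positivity)]
    norm_cast
    omega
  have hd : Differentiable ℂ fun z => 2 * cosRho (Real.pi / 2) z :=
    (differentiable_cosRho _).const_mul 2
  have : t = (Multiset.range M).map fun i : ℕ => (2 * i + 1 : ℂ) ^ 2 := by
    ext a
    by_cases ha : ‖a‖ < (2 * M : ℝ) ^ 2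
    · have hc := hcount a ha
      by_cases h0 : cosRho (Real.pi / 2) a = 0
      · rw [analyticOrderAt_cosRho h0] at hc
        obtain ⟨i, rfl⟩ := cosRho_eq_zero_iff.1 h0
        rw [Multiset.count_map_eq_count' (fun i : ℕ => (2 * i + 1 : ℂ) ^ 2) _ hinj,
          Multiset.count_eq_one_of_mem (Multiset.nodup_range M)
            (Multiset.mem_range.2 ((hlt i).1 ha))]
        exact_mod_cast hc.symm
      · rw [analyticOrderAt_eq_zero.2 (Or.inr (by simpa using h0))] at hc
        rw [Multiset.count_eq_zero_of_notMem (s := Multiset.map _ _)]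
        · exact_mod_cast hc.symm
        · intro hm
          obtain ⟨i, -, hi⟩ := Multiset.mem_map.1 hm
          exact h0 (cosRho_eq_zero_iff.2 ⟨i, hi.symm⟩)
    · rw [Multiset.count_eq_zero_of_notMem fun h => ha (ht a h),
        Multiset.count_eq_zero_of_notMem]
      intro hm
      obtain ⟨i, hi, rfl⟩ := Multiset.mem_map.1 hm
      exact ha ((hlt i).2 (Multiset.mem_range.1 hi))
  rw [this, Multiset.card_map, Multiset.card_range]

/-! ### Bounds for the sine and the cosine of a complex argument -/

lemma norm_cos_sq (w : ℂ) : ‖Complex.cos w‖ ^ 2 = Real.cos w.re ^ 2 + Real.sinh w.im ^ 2 := by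
  rw [Complex.cos_eq w, ← Complex.ofReal_cos, ← Complex.ofReal_cosh, ← Complex.ofReal_sin,
    ← Complex.ofReal_sinh, Complex.sq_norm, Complex.normSq_apply]
  simp only [Complex.sub_re, Complex.mul_re, Complex.ofReal_re, Complex.ofReal_im, Complex.I_re,
    Complex.I_im, Complex.sub_im, Complex.mul_im]
  have h1 := Real.cosh_sq w.im
  have h2 := Real.sin_sq_add_cos_sq w.re
  ring_nf
  rw [h1, show Real.sin w.re ^ 2 = 1 - Real.cos w.re ^ 2 by linarith]
  ring

/-- With `k` an odd integer nearest to `Re w` and `d = Re w - k`, one has `|cos(wπ/2)|² = sin²(dπ/2)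
+ sinh²(Im w · π/2)`. Jordan's inequality bounds the first term below by `d²`, and `sinh x ≥ x` for
`x ≥ 0` bounds the second by `(Im w)²`. No local inversion of the cosine is needed. -/
lemma exists_odd_norm_sub_le_norm_cos (w : ℂ) :
    ∃ k : ℤ, Odd k ∧ ‖w - k‖ ≤ ‖Complex.cos (w * (Real.pi / 2 : ℝ))‖ := by
  set j := round ((w.re - 1) / 2) with hj
  have hpi := Real.pi_pos
  have hd : |(w.re - 1) / 2 - j| ≤ 1 / 2 := abs_sub_round _
  set d := w.re - (2 * j + 1) with hdd
  have hd1 : |d| ≤ 1 := by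
    have : d = 2 * ((w.re - 1) / 2 - j) := by rw [hdd]; ring
    rw [this, abs_mul, abs_two]; linarith
  refine ⟨2 * j + 1, odd_two_mul_add_one j, ?_⟩
  have hre : (w * (Real.pi / 2 : ℝ)).re = w.re * (Real.pi / 2) := Complex.re_mul_ofReal _ _
  have him : (w * (Real.pi / 2 : ℝ)).im = w.im * (Real.pi / 2) := Complex.im_mul_ofReal _ _
  rw [← sq_le_sq₀ (norm_nonneg _) (norm_nonneg _), norm_cos_sq, hre, him, Complex.sq_norm,
    Complex.normSq_apply]
  have e1 : (w - ((2 * j + 1 : ℤ) : ℂ)).re = d := by simp [hdd]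
  have e2 : (w - ((2 * j + 1 : ℤ) : ℂ)).im = w.im := by simp
  rw [e1, e2, ← pow_two, ← pow_two]
  refine add_le_add ?_ ?_
  · rw [sq_le_sq]
    have e : w.re * (Real.pi / 2) = (d * (Real.pi / 2) + Real.pi / 2) + j * Real.pi := by
      rw [hdd]; ring
    rw [e, Real.cos_add_int_mul_pi, Real.cos_add_pi_div_two, abs_mul, abs_neg]
    have : |((-1 : ℝ)) ^ j| = 1 := by rw [abs_zpow]; simp
    rw [this, one_mul]
    have h := Real.mul_abs_le_abs_sin (x := d * (Real.pi / 2)) (by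
      rw [abs_mul, abs_of_pos (by positivity : (0 : ℝ) < Real.pi / 2)]
      nlinarith)
    rw [abs_mul, abs_of_pos (by positivity : (0 : ℝ) < Real.pi / 2)] at h
    calc |d| = 2 / Real.pi * (|d| * (Real.pi / 2)) := by field_simp
      _ ≤ _ := h
  · rw [sq_le_sq, Real.abs_sinh, abs_mul, abs_of_pos (by positivity : (0 : ℝ) < Real.pi / 2)]
    have h1 : |w.im| ≤ |w.im| * (Real.pi / 2) := by
      have := Real.two_le_pi
      nlinarith [abs_nonneg w.im]
    exact h1.trans (Real.self_le_sinh_iff.2 (by positivity))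

/-- From `exp x = 2 sinh x + exp(-x)` and `sinh |Im w| ≤ |cos w|`. Exponential growth of the
remainder is thereby measured by the cosine, even near the cosine's zeros. -/
lemma exp_abs_im_le (w : ℂ) : Real.exp |w.im| ≤ 2 * ‖Complex.cos w‖ + 1 := by
  have h1 : Real.sinh |w.im| ≤ ‖Complex.cos w‖ := by
    refine le_of_sq_le_sq ?_ (norm_nonneg _)
    rw [norm_cos_sq, ← Real.abs_sinh, sq_abs]
    nlinarith [sq_nonneg (Real.cos w.re)]
  have h2 : Real.exp (-|w.im|) ≤ 1 := Real.exp_le_one_iff.2 (by simp)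
  rw [Real.sinh_eq] at h1
  linarith

lemma norm_sin_le_exp (w : ℂ) : ‖Complex.sin w‖ ≤ Real.exp |w.im| := by
  have h : ‖Complex.exp (-w * Complex.I) - Complex.exp (w * Complex.I)‖ ≤
      Real.exp |w.im| + Real.exp |w.im| := by
    refine (norm_sub_le _ _).trans (add_le_add ?_ ?_)
    · rw [Complex.norm_exp]
      exact Real.exp_le_exp.2 (by simpa using le_abs_self w.im)
    · rw [Complex.norm_exp]
      exact Real.exp_le_exp.2 (by simpa using neg_le_abs w.im)
  rw [Complex.sin, norm_div, norm_mul, Complex.norm_I, mul_one, Complex.norm_ofNat]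
  linarith

lemma hasDerivAt_sin_mul_ofReal (w : ℂ) (t : ℝ) :
    HasDerivAt (fun t : ℝ => Complex.sin (w * t)) (Complex.cos (w * t) * w) t := by
  have h := (((hasDerivAt_id (t : ℂ)).const_mul w).csin).comp_ofReal
  simpa using h

lemma hasDerivAt_cos_mul_ofReal (w : ℂ) (t : ℝ) :
    HasDerivAt (fun t : ℝ => Complex.cos (w * t)) (-Complex.sin (w * t) * w) t := by
  have h := (((hasDerivAt_id (t : ℂ)).const_mul w).ccos).comp_ofReal
  simpa using h

/-! ### Absolutely continuous functions -/

/-- Real and imaginary parts are `1`-Lipschitz images of `f`, hence absolutely continuous, and the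
real fundamental theorem applies to each. -/
lemma ftc_re_im {f : ℝ → ℂ} {c d : ℝ} (hf : AbsolutelyContinuousOnInterval f c d)
    {f' : ℝ → ℂ} (hi : IntervalIntegrable f' volume c d)
    (hd : ∀ᵐ x, x ∈ Set.uIoc c d → HasDerivAt f (f' x) x) : ∫ x in c..d, f' x = f d - f c := by
  have lip : ∀ L : ℂ →L[ℝ] ℝ, (∀ z, ‖L z‖ ≤ ‖z‖) →
      AbsolutelyContinuousOnInterval (fun x => L (f x)) c d := by
    intro L hL
    rw [absolutelyContinuousOnInterval_iff] at hf ⊢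
    intro ε hε
    obtain ⟨δ, hδ, h⟩ := hf ε hε
    refine ⟨δ, hδ, fun E hE hE' => lt_of_le_of_lt (Finset.sum_le_sum fun i _ => ?_) (h E hE hE')⟩
    rw [dist_eq_norm, dist_eq_norm, ← map_sub]
    exact hL _
  have key : ∀ L : ℂ →L[ℝ] ℝ, (∀ z, ‖L z‖ ≤ ‖z‖) → ∫ x in c..d, L (f' x) = L (f d) - L (f c) := by
    intro L hL
    rw [← (lip L hL).integral_deriv_eq_sub]
    refine intervalIntegral.integral_congr_ae ?_
    filter_upwards [hd] with x hx hxm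
    exact ((L.hasFDerivAt.comp_hasDerivAt x (hx hxm)).deriv).symm
  have h1 := key Complex.reCLM fun z => Complex.abs_re_le_norm z
  have h2 := key Complex.imCLM fun z => Complex.abs_im_le_norm z
  rw [Complex.reCLM.intervalIntegral_comp_comm hi] at h1
  rw [Complex.imCLM.intervalIntegral_comp_comm hi] at h2
  exact Complex.ext (by simpa using h1) (by simpa using h2)

section W21

variable {q : ℝ → ℂ}

lemma MemW21.hasDerivAt (hq : MemW21 q) {x : ℝ} (hx : x ∈ Set.Ioo 0 Real.pi) :
    HasDerivAt q (derivWithin q (Set.Icc 0 Real.pi) x) x :=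
  ((hq.differentiableOn x (Set.Ioo_subset_Icc_self hx)).hasDerivWithinAt).hasDerivAt
    (Icc_mem_nhds hx.1 hx.2)

lemma MemW21.intervalIntegrable (hq : MemW21 q) {c d : ℝ} (hc : c ∈ Set.Icc 0 Real.pi)
    (hd : d ∈ Set.Icc 0 Real.pi) :
    IntervalIntegrable (deriv (derivWithin q (Set.Icc 0 Real.pi))) volume c d := by
  have h := (intervalIntegrable_iff_integrableOn_Ioo_of_le Real.pi_pos.le).2 hq.integrable_deriv2
  refine h.mono_set ?_
  rw [Set.uIcc_of_le Real.pi_pos.le]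
  exact Set.uIcc_subset_Icc hc hd

/-- Both integrations by parts at once: `B q' - B' q` is absolutely continuous with derivative `B
q'' - B'' q` almost everywhere. -/
lemma MemW21.integral_by_parts (hq : MemW21 q) {c d : ℝ} (hc : c ∈ Set.Icc 0 Real.pi)
    (hd : d ∈ Set.Icc 0 Real.pi) {B B₁ B₂ : ℝ → ℂ}
    (h₁ : ∀ t, HasDerivAt B (B₁ t) t) (h₂ : ∀ t, HasDerivAt B₁ (B₂ t) t) (hB₂ : Continuous B₂) :
    ∫ t in c..d, q t * B₂ t =
      (∫ t in c..d, B t * deriv (derivWithin q (Set.Icc 0 Real.pi)) t)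
      - ((B d * derivWithin q (Set.Icc 0 Real.pi) d - B₁ d * q d)
        - (B c * derivWithin q (Set.Icc 0 Real.pi) c - B₁ c * q c)) := by
  set q₁ := derivWithin q (Set.Icc 0 Real.pi) with hq₁
  have hB₁ : ContDiff ℝ 1 B₁ := contDiff_one_iff_deriv.2
    ⟨fun t => (h₂ t).differentiableAt, by rwa [funext fun t => (h₂ t).deriv]⟩
  have hB : ContDiff ℝ 1 B := contDiff_one_iff_deriv.2
    ⟨fun t => (h₁ t).differentiableAt, by rw [funext fun t => (h₁ t).deriv]; exact hB₁.continuous⟩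
  have hsub : Set.uIcc c d ⊆ Set.uIcc 0 Real.pi := by
    rw [Set.uIcc_of_le Real.pi_pos.le]; exact Set.uIcc_subset_Icc hc hd
  have ac := hq.ac.mono hsub
  have ac₁ := hq.ac_deriv.mono hsub
  have acH := (hB.contDiffOn.absolutelyContinuousOnInterval.smul ac₁).sub
    (hB₁.contDiffOn.absolutelyContinuousOnInterval.smul ac)
  have i1 : IntervalIntegrable (fun t => B t * deriv q₁ t) volume c d :=
    (hq.intervalIntegrable hc hd).continuousOn_mul hB.continuous.continuousOn
  have i2 : IntervalIntegrable (fun t => q t * B₂ t) volume c d :=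
    (ac.continuousOn.mul hB₂.continuousOn).intervalIntegrable
  have key := ftc_re_im acH (f' := fun t => B t * deriv q₁ t - q t * B₂ t) (i1.sub i2) (by
    -- The endpoints are discarded because `derivWithin q` is known to be a two-sided derivative
    -- only inside `(0, π)`.
    have hne : ∀ y : ℝ, ∀ᵐ x : ℝ, x ≠ y := fun y => by
      simp [ae_iff]
    filter_upwards [hq.ac_deriv.boundedVariationOn.ae_differentiableAt_of_mem_uIcc, hne 0,
      hne Real.pi] with x hx h0 hpi hxm
    have hx1 := hsub (Set.uIoc_subset_uIcc hxm)
    have hx2 := hx1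
    rw [Set.uIcc_of_le Real.pi_pos.le] at hx2
    have hx3 : x ∈ Set.Ioo 0 Real.pi :=
      ⟨lt_of_le_of_ne hx2.1 (Ne.symm h0), lt_of_le_of_ne hx2.2 hpi⟩
    have hd1 := (h₁ x).smul (hx hx1).hasDerivAt
    have hd2 := (h₂ x).smul (hq.hasDerivAt hx3)
    refine (hd1.sub hd2).congr_deriv ?_
    simp only [smul_eq_mul]
    ring)
  rw [intervalIntegral.integral_sub i1 i2] at key
  simp only [Pi.sub_apply, smul_eq_mul, Pi.mul_apply, ← hq₁] at key
  linear_combination -key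

end W21

/-! ### The non-degenerate factor of the characteristic function -/

/-- The factor of the characteristic function carrying the non-degenerate eigenvalues. -/
noncomputable def oddFun (q : ℝ → ℂ) (z : ℂ) : ℂ :=
  2 * cosRho (Real.pi / 2) z + ((∫ t in (0 : ℝ)..Real.pi / 2, q t * sinDiv t z) +
    ∫ t in Real.pi / 2..Real.pi, q t * sinDiv (Real.pi - t) z)

/-- The terms with `q'` vanish at `0` and `π`, where the sine is `0`, and cancel at `π/2`. The terms
with `q` add up at `π/2`, and at the endpoints they combine to `(q(0) + q(π))/z = 0`. -/
lemma oddFun_sub_eq {q : ℝ → ℂ} (hq : MemW21 q) (hq0 : q 0 + q Real.pi = 0) {z : ℂ} (hz : z ≠ 0) :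
    oddFun q z - 2 * cosRho (Real.pi / 2) z =
      -(2 * q (Real.pi / 2) / z) * cosRho (Real.pi / 2) z -
      ((∫ t in (0 : ℝ)..Real.pi / 2, Complex.sin (rho z * t) / rho z ^ 3 *
          deriv (derivWithin q (Set.Icc 0 Real.pi)) t) +
        ∫ t in Real.pi / 2..Real.pi, Complex.sin (rho z * (Real.pi - t : ℝ)) / rho z ^ 3 *
          deriv (derivWithin q (Set.Icc 0 Real.pi)) t) := by
  have hr := rho_ne_zero hz
  have hpi := Real.pi_pos
  have m0 : (0 : ℝ) ∈ Set.Icc 0 Real.pi := ⟨le_rfl, hpi.le⟩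
  have m1 : Real.pi / 2 ∈ Set.Icc 0 Real.pi := ⟨by positivity, by linarith⟩
  have m2 : Real.pi ∈ Set.Icc 0 Real.pi := ⟨hpi.le, le_rfl⟩
  have k1 := hq.integral_by_parts m0 m1 (B := fun t => -Complex.sin (rho z * t) / rho z ^ 3)
    (B₁ := fun t => -Complex.cos (rho z * t) / rho z ^ 2)
    (B₂ := fun t => Complex.sin (rho z * t) / rho z)
    (fun t => by
      have h := (hasDerivAt_sin_mul_ofReal (rho z) t).neg.div_const (rho z ^ 3)
      refine h.congr_deriv ?_
      field_simp)
    (fun t => by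
      have h := (hasDerivAt_cos_mul_ofReal (rho z) t).neg.div_const (rho z ^ 2)
      refine h.congr_deriv ?_
      simp; field_simp) (by fun_prop)
  have k2 := hq.integral_by_parts m1 m2
    (B := fun t => -Complex.sin (rho z * (Real.pi - t : ℝ)) / rho z ^ 3)
    (B₁ := fun t => Complex.cos (rho z * (Real.pi - t : ℝ)) / rho z ^ 2)
    (B₂ := fun t => Complex.sin (rho z * (Real.pi - t : ℝ)) / rho z)
    (fun t => by
      have h := ((hasDerivAt_sin_mul_ofReal (rho z) (Real.pi - t)).scomp t
        ((hasDerivAt_id t).const_sub Real.pi)).neg.div_const (rho z ^ 3)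
      refine h.congr_deriv ?_
      simp; field_simp)
    (fun t => by
      have h := ((hasDerivAt_cos_mul_ofReal (rho z) (Real.pi - t)).scomp t
        ((hasDerivAt_id t).const_sub Real.pi)).div_const (rho z ^ 2)
      refine h.congr_deriv ?_
      simp; field_simp) (by simp only [Complex.ofReal_sub]; fun_prop)
  unfold oddFun
  simp only [sinDiv_eq_rho hz]
  rw [k1, k2]
  have hpp : Real.pi - Real.pi / 2 = Real.pi / 2 := by ring
  simp only [neg_div, neg_mul, intervalIntegral.integral_neg, hpp, sub_self, Complex.ofReal_zero,
    mul_zero, Complex.sin_zero, Complex.cos_zero, zero_div, zero_mul, neg_zero]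
  rw [← cosRho, ← rho_sq z]
  simp only [rho_sq z]
  have : q Real.pi = -q 0 := by linear_combination hq0
  rw [this]
  ring

lemma exists_norm_oddFun_sub_le {q : ℝ → ℂ} (hq : MemW21 q) (hq0 : q 0 + q Real.pi = 0) :
    ∃ W : ℝ, 0 ≤ W ∧ ∀ z : ℂ, 1 ≤ ‖z‖ →
      ‖oddFun q z - 2 * cosRho (Real.pi / 2) z‖ ≤ W / ‖z‖ * ‖cosRho (Real.pi / 2) z‖ +
        W / ‖rho z‖ ^ 3 * (2 * ‖cosRho (Real.pi / 2) z‖ + 1) := by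
  have hpi := Real.pi_pos
  have m0 : (0 : ℝ) ∈ Set.Icc 0 Real.pi := ⟨le_rfl, hpi.le⟩
  have m1 : Real.pi / 2 ∈ Set.Icc 0 Real.pi := ⟨by positivity, by linarith⟩
  have m2 : Real.pi ∈ Set.Icc 0 Real.pi := ⟨hpi.le, le_rfl⟩
  set q₂ := deriv (derivWithin q (Set.Icc 0 Real.pi)) with hq₂
  have i1 := (hq.intervalIntegrable m0 m1).norm
  have i2 := (hq.intervalIntegrable m1 m2).norm
  set I1 := ∫ t in (0 : ℝ)..Real.pi / 2, ‖q₂ t‖ with hI1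
  set I2 := ∫ t in Real.pi / 2..Real.pi, ‖q₂ t‖ with hI2
  have I1_nonneg : 0 ≤ I1 := intervalIntegral.integral_nonneg (by positivity) fun _ _ => norm_nonneg _
  have I2_nonneg : 0 ≤ I2 := intervalIntegral.integral_nonneg (by linarith) fun _ _ => norm_nonneg _
  refine ⟨2 * ‖q (Real.pi / 2)‖ + (I1 + I2), by positivity, fun z hz1 => ?_⟩
  have hz : z ≠ 0 := norm_pos_iff.1 (by linarith)
  have hr : 0 < ‖rho z‖ := norm_pos_iff.2 (rho_ne_zero hz)
  have hE : ∀ s : ℝ, |s| ≤ Real.pi / 2 → ‖Complex.sin (rho z * s) / rho z ^ 3‖ ≤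
      (2 * ‖cosRho (Real.pi / 2) z‖ + 1) / ‖rho z‖ ^ 3 := by
    intro s hs
    rw [norm_div, norm_pow]
    refine div_le_div_of_nonneg_right ?_ (by positivity)
    refine (norm_sin_le_exp _).trans (le_trans ?_ (exp_abs_im_le _))
    refine Real.exp_le_exp.2 ?_
    rw [Complex.im_mul_ofReal, Complex.im_mul_ofReal, abs_mul, abs_mul,
      abs_of_pos (by positivity : (0 : ℝ) < Real.pi / 2)]
    exact mul_le_mul_of_nonneg_left hs (abs_nonneg _)
  set E := (2 * ‖cosRho (Real.pi / 2) z‖ + 1) / ‖rho z‖ ^ 3 with hEdef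
  rw [oddFun_sub_eq hq hq0 hz]
  have b1 : ‖∫ t in (0 : ℝ)..Real.pi / 2, Complex.sin (rho z * t) / rho z ^ 3 * q₂ t‖ ≤ E * I1 := by
    rw [hI1, ← intervalIntegral.integral_const_mul]
    refine intervalIntegral.norm_integral_le_of_norm_le (by positivity) ?_ (i1.const_mul E)
    refine Filter.Eventually.of_forall fun t ht => ?_
    rw [norm_mul]
    refine mul_le_mul_of_nonneg_right (hE t ?_) (norm_nonneg _)
    rw [abs_of_pos ht.1]; exact ht.2
  have b2 : ‖∫ t in Real.pi / 2..Real.pi,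
      Complex.sin (rho z * (Real.pi - t : ℝ)) / rho z ^ 3 * q₂ t‖ ≤ E * I2 := by
    rw [hI2, ← intervalIntegral.integral_const_mul]
    refine intervalIntegral.norm_integral_le_of_norm_le (by linarith) ?_ (i2.const_mul E)
    refine Filter.Eventually.of_forall fun t ht => ?_
    rw [norm_mul]
    refine mul_le_mul_of_nonneg_right (hE _ ?_) (norm_nonneg _)
    rw [abs_of_nonneg (by linarith [ht.2])]; linarith [ht.1]
  refine (norm_sub_le _ _).trans (add_le_add ?_ ?_)
  · rw [norm_mul, norm_neg, norm_div, norm_mul, Complex.norm_ofNat]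
    refine mul_le_mul_of_nonneg_right ?_ (norm_nonneg _)
    exact div_le_div_of_nonneg_right (by linarith) (norm_nonneg _)
  · refine (norm_add_le _ _).trans ((add_le_add b1 b2).trans ?_)
    have hE0 : 0 ≤ E := by positivity
    calc E * I1 + E * I2 = E * (I1 + I2) := by ring
      _ ≤ E * (2 * ‖q (Real.pi / 2)‖ + (I1 + I2)) :=
        mul_le_mul_of_nonneg_left (by linarith [norm_nonneg (q (Real.pi / 2))]) hE0
      _ = _ := by rw [hEdef]; ring

lemma oddFun_congr {q p : ℝ → ℂ} (h : Set.EqOn q p (Set.Icc 0 Real.pi)) (z : ℂ) :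
    oddFun q z = oddFun p z := by
  have hpi := Real.pi_pos
  unfold oddFun
  congr 2
  · refine intervalIntegral.integral_congr fun t ht => ?_
    rw [Set.uIcc_of_le (by positivity)] at ht
    simp only [h ⟨ht.1, by linarith [ht.2]⟩]
  · refine intervalIntegral.integral_congr fun t ht => ?_
    rw [Set.uIcc_of_le (by linarith)] at ht
    simp only [h ⟨by linarith [ht.1], ht.2⟩]

/-- The eigenvalue problem and `oddFun` see `q` only on `[0, π]`, so `q` may be replaced by a
function continuous on the whole line. -/
lemma exists_continuous_eqOn {q : ℝ → ℂ} (hq : ContinuousOn q (Set.Icc 0 Real.pi)) :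
    ∃ p : ℝ → ℂ, Continuous p ∧ Set.EqOn q p (Set.Icc 0 Real.pi) :=
  ⟨Set.IccExtend Real.pi_pos.le ((Set.Icc 0 Real.pi).domRestrict q),
    (continuousOn_iff_continuous_domRestrict.1 hq).Icc_extend', fun x hx => by
      rw [Set.IccExtend_of_mem _ _ hx]; rfl⟩

lemma differentiable_oddFun {q : ℝ → ℂ} (hq : ContinuousOn q (Set.Icc 0 Real.pi)) :
    Differentiable ℂ (oddFun q) := by
  obtain ⟨p, hp, he⟩ := exists_continuous_eqOn hq
  rw [funext (oddFun_congr he)]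
  exact ((differentiable_cosRho _).const_mul 2).add
    ((differentiable_integral_mul_sinDiv hp continuous_id _ _).add
      (differentiable_integral_mul_sinDiv hp (by fun_prop) _ _))

lemma charFun_eq (q : ℝ → ℂ) (z : ℂ) :
    charFun q (Real.pi / 2) z = sinDiv (Real.pi / 2) z * oddFun q z := by
  have e1 : Real.pi - Real.pi / 2 = Real.pi / 2 := by ring
  have h0 : solC q (Real.pi / 2) 0 z =
      cosRho (Real.pi / 2) z + ∫ t in (0 : ℝ)..Real.pi / 2, q t * sinDiv t z := by
    rw [solC, zero_sub, intervalIntegral.integral_symm, ← intervalIntegral.integral_neg]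
    congr 1
    · exact cosRho_neg _ z
    · refine intervalIntegral.integral_congr fun t _ => ?_
      simp only [zero_sub, sinDiv_neg, mul_neg, neg_neg]
  have h1 : solC q (Real.pi / 2) Real.pi z =
      cosRho (Real.pi / 2) z + ∫ t in Real.pi / 2..Real.pi, q t * sinDiv (Real.pi - t) z := by
    rw [solC, e1, cosRho]
  rw [charFun, h0, h1, solS, solS, e1, zero_sub, sinDiv_neg, oddFun]
  ring

/-! ### Counting the non-degenerate eigenvalues -/

/-- Here `|ρ| = 2M` differs by at least `1` from the modulus of any odd integer. -/
lemma one_le_norm_cosRho {z : ℂ} {M : ℕ} (hz : ‖z‖ = (2 * M : ℝ) ^ 2) :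
    1 ≤ ‖cosRho (Real.pi / 2) z‖ := by
  obtain ⟨k, hk, h⟩ := exists_odd_norm_sub_le_norm_cos (rho z)
  refine le_trans ?_ h
  have hr : ‖rho z‖ = 2 * M := by
    have := norm_rho_sq z
    rw [hz] at this
    exact (pow_left_inj₀ (norm_nonneg _) (by positivity) two_ne_zero).1 this
  have h1 := norm_sub_norm_le (rho z) k
  have h2 := norm_sub_norm_le (k : ℂ) (rho z)
  rw [norm_sub_rev] at h2
  rw [hr, Complex.norm_intCast] at h1 h2
  have h3 : |k| + 1 ≤ 2 * M ∨ 2 * M + 1 ≤ |k| := by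
    have : Odd |k| := odd_abs.2 hk
    obtain ⟨j, hj⟩ := this
    omega
  rcases h3 with h3 | h3
  · have : ((|k| : ℤ) : ℝ) + 1 ≤ 2 * M := by exact_mod_cast h3
    push_cast at this; linarith
  · have : (2 * M : ℝ) + 1 ≤ ((|k| : ℤ) : ℝ) := by exact_mod_cast h3
    push_cast at this; linarith

/-- Beyond `8W + 1` both `W/|z|` and `W/|ρ|³` are at most `1/8`. With `c = |cos(ρπ/2)| ≥ 1` on the
circles the perturbation is at most `(3c + 1)/8 < 2c`, as Rouché's theorem requires. At a zero, `2c
≤ c/8 + c/4 + W/|ρ|³`. -/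
lemma exists_zeros_oddFun {q : ℝ → ℂ} (hq : MemW21 q) (hq0 : q 0 + q Real.pi = 0) :
    ∃ W : ℝ, 0 ≤ W ∧ (∀ M : ℕ, 8 * W + 1 ≤ (2 * M : ℝ) ^ 2 →
      ∃ s : Multiset ℂ, (∀ a ∈ s, ‖a‖ < (2 * M : ℝ) ^ 2) ∧ s.card = M ∧
        ∀ a : ℂ, ‖a‖ < (2 * M : ℝ) ^ 2 → analyticOrderAt (oddFun q) a = s.count a) ∧
      ∀ z : ℂ, 8 * W + 1 ≤ ‖z‖ → oddFun q z = 0 →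
        ‖cosRho (Real.pi / 2) z‖ ≤ W / ‖rho z‖ ^ 3 := by
  obtain ⟨W, hW, h⟩ := exists_norm_oddFun_sub_le hq hq0
  have small : ∀ z : ℂ, 8 * W + 1 ≤ ‖z‖ → 1 ≤ ‖z‖ ∧ W / ‖z‖ ≤ 1 / 8 ∧ W / ‖rho z‖ ^ 3 ≤ 1 / 8 := by
    intro z hz
    have hz1 : 1 ≤ ‖z‖ := by linarith
    have h1 : W / ‖z‖ ≤ 1 / 8 := by
      rw [div_le_iff₀ (by linarith)]; linarith
    have hr := norm_rho_sq z
    have hr1 : 1 ≤ ‖rho z‖ := by nlinarith [norm_nonneg (rho z)]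
    refine ⟨hz1, h1, le_trans (div_le_div_of_nonneg_left hW (by linarith) ?_) h1⟩
    rw [← hr]
    exact pow_le_pow_right₀ hr1 (by norm_num)
  refine ⟨W, hW, fun M hM => ?_, fun z hz h0 => ?_⟩
  · have hd : Differentiable ℂ fun z => 2 * cosRho (Real.pi / 2) z :=
      (differentiable_cosRho _).const_mul 2
    obtain ⟨s, t, hs, ht, hst, hcs, hct⟩ := exists_zeros_card_eq
      (differentiable_oddFun hq.differentiableOn.continuousOn) hd (R := (2 * M : ℝ) ^ 2)
      (by linarith) (fun z hz => by
        obtain ⟨h1, h2, h3⟩ := small z (by rwa [hz])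
        have hc := one_le_norm_cosRho hz
        refine (h z h1).trans_lt ?_
        rw [norm_mul, Complex.norm_ofNat]
        have h4 := mul_le_mul_of_nonneg_right h2 (norm_nonneg (cosRho (Real.pi / 2) z))
        have h5 := mul_le_mul_of_nonneg_right h3
          (by positivity : 0 ≤ 2 * ‖cosRho (Real.pi / 2) z‖ + 1)
        linarith)
    exact ⟨s, hs, hst.trans (card_zeros_cosRho ht hct), hcs⟩
  · obtain ⟨h1, h2, h3⟩ := small z hz
    have h4 := h z h1
    rw [h0, zero_sub, norm_neg, norm_mul, Complex.norm_ofNat] at h4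
    have h5 := mul_le_mul_of_nonneg_right h2 (norm_nonneg (cosRho (Real.pi / 2) z))
    have h6 := mul_le_mul_of_nonneg_right h3 (norm_nonneg (cosRho (Real.pi / 2) z))
    have h7 := norm_nonneg (cosRho (Real.pi / 2) z)
    nlinarith

/-- The bounds on `|z|` leave `|k| = n` as the only odd candidate near `ρ`. In `z - n² = (ρ - k)(ρ +
k)` the first factor is at most `8W/n³`, since `|ρ| ≥ n/2`, and the second at most `3n`; hence `24`.
-/
lemma norm_sub_sq_le {W : ℝ} (hW : 0 ≤ W) {z : ℂ} (hz : 8 * W + 1 ≤ ‖z‖)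
    (hc : ‖cosRho (Real.pi / 2) z‖ ≤ W / ‖rho z‖ ^ 3) {n : ℕ} (hn : Odd n)
    (h1 : ((n : ℝ) - 1) ^ 2 ≤ ‖z‖) (h2 : ‖z‖ < ((n : ℝ) + 1) ^ 2) :
    ‖z - (n : ℂ) ^ 2‖ ≤ 24 * W / (n : ℝ) ^ 2 := by
  have hr := norm_rho_sq z
  have hz1 : 1 ≤ ‖z‖ := by linarith
  have hr1 : 1 ≤ ‖rho z‖ := by nlinarith [norm_nonneg (rho z)]
  have hn1 : (1 : ℝ) ≤ n := by exact_mod_cast hn.pos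
  have hlo : (n : ℝ) - 1 ≤ ‖rho z‖ :=
    le_of_sq_le_sq (by rw [hr]; exact h1) (by linarith)
  have hhi : ‖rho z‖ < (n : ℝ) + 1 :=
    lt_of_pow_lt_pow_left₀ 2 (by linarith) (by rw [hr]; exact h2)
  obtain ⟨k, hk, h⟩ := exists_odd_norm_sub_le_norm_cos (rho z)
  have hk1 : ‖rho z - k‖ ≤ W / ‖rho z‖ ^ 3 := h.trans hc
  have h8 : W / ‖rho z‖ ^ 3 ≤ 1 / 8 := by
    have : W / ‖z‖ ≤ 1 / 8 := by rw [div_le_iff₀ (by linarith)]; linarith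
    refine le_trans (div_le_div_of_nonneg_left hW (by linarith) ?_) this
    rw [← hr]
    exact pow_le_pow_right₀ hr1 (by norm_num)
  have d1 := norm_sub_norm_le (rho z) k
  have d2 := norm_sub_norm_le (k : ℂ) (rho z)
  rw [norm_sub_rev] at d2
  rw [Complex.norm_intCast] at d1 d2
  have hkn : |k| = n := by
    have a1 : ((|k| : ℤ) : ℝ) < n + 2 := by push_cast; linarith
    have a2 : (n : ℝ) - 2 < ((|k| : ℤ) : ℝ) := by push_cast; linarith
    have a1 : |k| < n + 2 := by exact_mod_cast a1
    have a2 : (n : ℤ) - 2 < |k| := by exact_mod_cast a2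
    obtain ⟨i, hi⟩ := odd_abs.2 hk
    obtain ⟨j, hj⟩ := hn
    omega
  have hkr : |(k : ℝ)| = n := by exact_mod_cast congrArg (Int.cast : ℤ → ℝ) hkn
  have hksq : (k : ℂ) ^ 2 = (n : ℂ) ^ 2 := by
    have : k ^ 2 = (n : ℤ) ^ 2 := by rw [← hkn, sq_abs]
    exact_mod_cast this
  have e : z - (n : ℂ) ^ 2 = (rho z - k) * (rho z + k) := by
    rw [← hksq]; linear_combination -(rho_sq z)
  have hp : ‖rho z + k‖ ≤ 3 * n := by
    refine (norm_add_le _ _).trans ?_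
    rw [Complex.norm_intCast, hkr]; linarith
  have hhalf : (n : ℝ) / 2 ≤ ‖rho z‖ := by
    rw [hkr] at d2; linarith
  have hn0 : (0 : ℝ) < n := by linarith
  rw [e, norm_mul]
  calc ‖rho z - k‖ * ‖rho z + k‖ ≤ W / ((n : ℝ) / 2) ^ 3 * (3 * n) := by
        refine mul_le_mul (hk1.trans ?_) hp (norm_nonneg _) (by positivity)
        exact div_le_div_of_nonneg_left hW (by positivity)
          (pow_le_pow_left₀ (by positivity) hhalf 3)
    _ = 24 * W / (n : ℝ) ^ 2 := by field_simp; ring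

/-! ### Numberings of the eigenvalues of the continuous problem -/

/-- The even indices account exactly for the zeros of `sinDiv (π/2)`. Cancelling their finite
contribution leaves the odd indices to count the zeros of `oddFun`, even where the two factors share
a zero. -/
lemma encard_even_add_odd (lam : ℕ → ℂ) (heven : ∀ n : ℕ, 1 ≤ n → Even n → lam n = (n : ℂ) ^ 2)
    (z : ℂ) : {n : ℕ | 1 ≤ n ∧ lam n = z}.encard =
      analyticOrderAt (sinDiv (Real.pi / 2)) z + {i : ℕ | lam (2 * i + 1) = z}.encard := by
  have e : {n : ℕ | 1 ≤ n ∧ lam n = z} = {n : ℕ | 1 ≤ n ∧ Even n ∧ z = (n : ℂ) ^ 2} ∪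
      (fun i => 2 * i + 1) '' {i : ℕ | lam (2 * i + 1) = z} := by
    ext n
    constructor
    · rintro ⟨h1, h2⟩
      rcases Nat.even_or_odd n with h | h
      · exact Or.inl ⟨h1, h, by rw [← h2, heven n h1 h]⟩
      · obtain ⟨i, rfl⟩ := h
        exact Or.inr ⟨i, h2, rfl⟩
    · rintro (⟨h1, h2, h3⟩ | ⟨i, hi, rfl⟩)
      · exact ⟨h1, by rw [heven n h1 h2, h3]⟩
      · exact ⟨by simp, hi⟩
  have hdisj : Disjoint {n : ℕ | 1 ≤ n ∧ Even n ∧ z = (n : ℂ) ^ 2}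
      ((fun i => 2 * i + 1) '' {i : ℕ | lam (2 * i + 1) = z}) := by
    rw [Set.disjoint_left]
    rintro _ ⟨-, h, -⟩ ⟨i, -, rfl⟩
    exact (Nat.not_even_iff_odd.2 (odd_two_mul_add_one i)) h
  have hinj : Function.Injective fun i : ℕ => 2 * i + 1 := fun i j h => by simpa using h
  rw [e, Set.encard_union_eq hdisj, hinj.encard_image]
  congr 1
  by_cases h : sinDiv (Real.pi / 2) z = 0
  · rw [analyticOrderAt_sinDiv h, Set.encard_eq_one]
    obtain ⟨n, h1, h2, h3⟩ := sinDiv_eq_zero_iff.1 h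
    refine ⟨n, Set.eq_singleton_iff_unique_mem.2 ⟨⟨h1, h2, h3⟩, ?_⟩⟩
    rintro k ⟨-, -, hk⟩
    rw [h3] at hk
    have : n ^ 2 = k ^ 2 := by exact_mod_cast hk
    exact (Nat.pow_left_injective (n := 2) (by norm_num) this).symm
  · rw [analyticOrderAt_eq_zero.2 (Or.inr h), Set.encard_eq_zero,
      Set.eq_empty_iff_forall_notMem]
    rintro n hn
    exact h (sinDiv_eq_zero_iff.2 ⟨n, hn⟩)

lemma analyticOrderAt_charFun {q : ℝ → ℂ} (hq : ContinuousOn q (Set.Icc 0 Real.pi)) (z : ℂ) :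
    analyticOrderAt (charFun q (Real.pi / 2)) z =
      analyticOrderAt (sinDiv (Real.pi / 2)) z + analyticOrderAt (oddFun q) z := by
  rw [show charFun q (Real.pi / 2) = sinDiv (Real.pi / 2) * oddFun q from funext (charFun_eq q)]
  exact analyticOrderAt_mul ((differentiable_sinDiv _).analyticAt z)
    ((differentiable_oddFun hq).analyticAt z)

lemma IsNumbering.encard_odd {q : ℝ → ℂ} (hq : ContinuousOn q (Set.Icc 0 Real.pi)) {lam : ℕ → ℂ}
    (h : IsNumbering q lam) (z : ℂ) :
    {i : ℕ | lam (2 * i + 1) = z}.encard = analyticOrderAt (oddFun q) z := by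
  have h1 := h.multiplicity z
  rw [encard_even_add_odd lam h.even, analyticOrderAt_charFun hq] at h1
  refine ENat.add_right_injective_of_ne_top ?_ h1
  by_cases h : sinDiv (Real.pi / 2) z = 0
  · simp [analyticOrderAt_sinDiv h]
  · simp [analyticOrderAt_eq_zero.2 (Or.inr h)]

theorem exists_bound_numbering {q : ℝ → ℂ} (hq : MemW21 q) (hq0 : q 0 + q Real.pi = 0) :
    ∃ C : ℝ, ∀ lam : ℕ → ℂ, IsNumbering q lam →
      ∀ n : ℕ, Odd n → ‖lam n - (n : ℂ) ^ 2‖ ≤ C / (n : ℝ) ^ 2 := by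
  obtain ⟨W, hW, hs, hz⟩ := exists_zeros_oddFun hq hq0
  obtain ⟨K, hK⟩ := exists_nat_ge (8 * W + 1)
  have hK1 : (1 : ℝ) ≤ K := by linarith
  have hlarge : ∀ M : ℕ, K ≤ M → 8 * W + 1 ≤ (2 * M : ℝ) ^ 2 := fun M hM => by
    have : (K : ℝ) ≤ M := by exact_mod_cast hM
    nlinarith
  -- The second summand serves the indices `n = 2i + 1` with `i < K`: there `|λ_n|` and `n²` are at
  -- most `(2K)²`, and so is the factor `n²` cleared from the denominator.
  refine ⟨24 * W + 2 * (2 * K) ^ 4, fun lam hlam n hn => ?_⟩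
  have hq' := hq.differentiableOn.continuousOn
  obtain ⟨i, rfl⟩ := hn
  have hlt : ∀ M : ℕ, K ≤ M → ∀ i : ℕ, ‖lam (2 * i + 1)‖ < (2 * M : ℝ) ^ 2 ↔ i < M := by
    intro M hM i
    obtain ⟨s, hs1, hs2, hs3⟩ := hs M (hlarge M hM)
    rw [norm_lt_iff_lt_card (μ := fun i => lam (2 * i + 1)) (I := Set.univ) (s := s) (by simp)
      (fun i _ j hj => hlam.odd _ _ (odd_two_mul_add_one j) (odd_two_mul_add_one i) (by omega))
      hs1 (fun z hz => by
        rw [← hs3 z hz, ← hlam.encard_odd hq' z]; simp) (Set.mem_univ i), hs2]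
  have hn0 : (0 : ℝ) < ((2 * i + 1 : ℕ) : ℝ) := by positivity
  rcases lt_or_ge i K with hi | hi
  · have h1 := (hlt K le_rfl i).2 hi
    have h2 : ((2 * i + 1 : ℕ) : ℝ) ≤ 2 * K := by exact_mod_cast (by omega : 2 * i + 1 ≤ 2 * K)
    have h3 : ((2 * i + 1 : ℕ) : ℝ) ^ 2 ≤ (2 * K) ^ 2 := pow_le_pow_left₀ hn0.le h2 2
    rw [le_div_iff₀ (by positivity)]
    have h4 : ‖lam (2 * i + 1) - ((2 * i + 1 : ℕ) : ℂ) ^ 2‖ ≤ 2 * (2 * K) ^ 2 := by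
      refine (norm_sub_le _ _).trans ?_
      rw [norm_pow, Complex.norm_natCast]
      linarith
    calc _ ≤ 2 * (2 * K) ^ 2 * (2 * (K : ℝ)) ^ 2 :=
          mul_le_mul h4 h3 (by positivity) (by positivity)
      _ ≤ _ := by nlinarith
  -- The counts for the discs with `M = i` and `M = i + 1` place `λ_{2i+1}` in the annulus between
  -- `(2i)²` and `(2i + 2)²`.
  · have h1 := not_lt.1 (mt (hlt i hi i).1 (lt_irrefl i))
    have h2 := (hlt (i + 1) (by omega) i).2 (Nat.lt_succ_self i)
    have h3 := (hlarge i hi).trans h1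
    have h0 : oddFun q (lam (2 * i + 1)) = 0 := by
      have h5 := hlam.encard_odd hq' (lam (2 * i + 1))
      by_contra h0
      rw [analyticOrderAt_eq_zero.2 (Or.inr h0), Set.encard_eq_zero] at h5
      exact (Set.mem_empty_iff_false i).1 (h5 ▸ rfl)
    refine (norm_sub_sq_le hW h3 (hz _ h3 h0) (odd_two_mul_add_one i) ?_ ?_).trans ?_
    · push_cast; simpa using h1
    · push_cast at h2 ⊢
      convert h2 using 2; ring
    · exact div_le_div_of_nonneg_right (by nlinarith [sq_nonneg ((2 * (K : ℝ)) ^ 2)]) (by positivity)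

theorem exists_numbering_of_iff {q : ℝ → ℂ} (hq : MemW21 q) (hq0 : q 0 + q Real.pi = 0)
    (hiff : ∀ z, IsEigenvalue q (Real.pi / 2) z ↔ charFun q (Real.pi / 2) z = 0) :
    ∃ lam : ℕ → ℂ, IsNumbering q lam := by
  obtain ⟨W, hW, hs, hz⟩ := exists_zeros_oddFun hq hq0
  have hq' := hq.differentiableOn.continuousOn
  have hnat : ∀ a (m : ℕ), analyticOrderAt (oddFun q) a = m → analyticOrderNatAt (oddFun q) a = m :=
    fun a m h => by simp [analyticOrderNatAt, h]
  have hM : ∀ (M : ℕ) (r : ℝ), ∃ K : ℕ, M ≤ K ∧ r ≤ (2 * K : ℝ) ^ 2 ∧ 8 * W + 1 ≤ (2 * K : ℝ) ^ 2 := by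
    intro M r
    obtain ⟨K, hK⟩ := exists_nat_ge (max (max r (8 * W + 1)) M)
    have h1 := (le_max_left _ _).trans ((le_max_left _ _).trans hK)
    have h2 := (le_max_right _ _).trans ((le_max_left _ _).trans hK)
    have h3 := (le_max_right _ _).trans hK
    refine ⟨K, by exact_mod_cast h3, by nlinarith, by nlinarith⟩
  obtain ⟨μ, hμ, hμc⟩ := exists_enumeration (ord := analyticOrderNatAt (oddFun q)) (by
    intro M r
    obtain ⟨K, h1, h2, h3⟩ := hM M r
    obtain ⟨s, hs1, hs2, hs3⟩ := hs K h3
    exact ⟨_, h2, s, hs1, by omega, fun a ha => hnat _ _ (hs3 a ha)⟩)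
  -- `analyticOrderNatAt` would turn an infinite order into `0`; the count in a disc around `z`
  -- shows that the order is finite.
  have hord : ∀ z, {i | μ i = z}.encard = analyticOrderAt (oddFun q) z := by
    intro z
    obtain ⟨K, -, h2, h3⟩ := hM 0 (‖z‖ + 1)
    obtain ⟨s, -, -, hs3⟩ := hs K h3
    have := hs3 z (by linarith)
    rw [hμc, this, hnat _ _ this]
  set lam : ℕ → ℂ := fun n => if Even n then (n : ℂ) ^ 2 else μ (n / 2) with hlam
  have heven : ∀ n : ℕ, 1 ≤ n → Even n → lam n = (n : ℂ) ^ 2 := fun n _ h => by simp [hlam, h]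
  have hodd : ∀ i, lam (2 * i + 1) = μ i := fun i => by
    have : (2 * i + 1) / 2 = i := by omega
    simp [hlam, this]
  have hmult : ∀ z : ℂ, Set.encard {n : ℕ | 1 ≤ n ∧ lam n = z} =
      analyticOrderAt (charFun q (Real.pi / 2)) z := by
    intro z
    rw [encard_even_add_odd lam heven, analyticOrderAt_charFun hq', ← hord]
    simp only [hodd]
  refine ⟨lam, fun z => ?_, hmult, heven, ?_⟩
  · have hd : AnalyticAt ℂ (charFun q (Real.pi / 2)) z := by
      rw [show charFun q (Real.pi / 2) = sinDiv (Real.pi / 2) * oddFun q from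
        funext (charFun_eq q)]
      exact ((differentiable_sinDiv _).mul (differentiable_oddFun hq')).analyticAt z
    have h0 : charFun q (Real.pi / 2) z = 0 ↔ analyticOrderAt (charFun q (Real.pi / 2)) z ≠ 0 :=
      hd.analyticOrderAt_ne_zero.symm
    rw [hiff, h0, ← hmult, Set.encard_ne_zero]
    rfl
  · rintro _ _ ⟨i, rfl⟩ ⟨j, rfl⟩ hij
    rw [hodd, hodd]
    exact hμ i j (by omega)

/-! ### Eigenvalues are the zeros of the characteristic function -/

lemma hasDerivAt_sinDiv_left (z : ℂ) (s : ℝ) :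
    HasDerivAt (fun s => sinDiv s z) (cosRho s z) s := by
  by_cases hz : z = 0
  · subst hz
    have h : HasDerivAt (fun s : ℝ => (s : ℂ)) 1 s := Complex.ofRealCLM.hasDerivAt
    simpa [sinDiv, cosRho, rho_zero] using h
  · have hr := rho_ne_zero hz
    have h := (hasDerivAt_sin_mul_ofReal (rho z) s).div_const (rho z)
    rw [mul_div_cancel_right₀ _ hr] at h
    simpa only [sinDiv_eq_rho hz, cosRho] using h

lemma hasDerivAt_cosRho_left (z : ℂ) (s : ℝ) :
    HasDerivAt (fun s => cosRho s z) (-z * sinDiv s z) s := by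
  have h := hasDerivAt_cos_mul_ofReal (rho z) s
  refine h.congr_deriv ?_
  rw [← rho_mul_sinDiv]
  nth_rewrite 4 [← rho_sq z]
  ring

/-- The addition formula separates `x` from `t` in the kernel, so `x` survives under the integral
only as a limit and the fundamental theorem of calculus applies. -/
lemma solC_eq {p : ℝ → ℂ} (hp : Continuous p) (a x : ℝ) (z : ℂ) :
    solC p a x z = cosRho (x - a) z + (sinDiv x z * (∫ t in a..x, p t * cosRho t z) -
      cosRho x z * ∫ t in a..x, p t * sinDiv t z) := by
  rw [solC, ← cosRho, ← intervalIntegral.integral_const_mul, ← intervalIntegral.integral_const_mul,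
    ← intervalIntegral.integral_sub]
  · congr 1
    refine intervalIntegral.integral_congr fun t _ => ?_
    rw [sub_eq_add_neg, sinDiv_add, cosRho_neg, sinDiv_neg]
    ring
  · exact Continuous.intervalIntegrable (by fun_prop) _ _
  · exact Continuous.intervalIntegrable (by fun_prop) _ _

lemma exists_hasDerivAt_solC {p : ℝ → ℂ} (hp : Continuous p) (a : ℝ) (z : ℂ) :
    ∃ C₁ : ℝ → ℂ, ∀ x, HasDerivAt (fun x => solC p a x z) (C₁ x) x ∧
      HasDerivAt C₁ (p x - z * solC p a x z) x := by
  have hA : ∀ x, HasDerivAt (fun x => ∫ t in a..x, p t * cosRho t z) (p x * cosRho x z) x :=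
    fun x => intervalIntegral.integral_hasDerivAt_right
      (Continuous.intervalIntegrable (by fun_prop) _ _)
      (Continuous.stronglyMeasurableAtFilter (by fun_prop) _ _)
      (Continuous.continuousAt (by fun_prop))
  have hB : ∀ x, HasDerivAt (fun x => ∫ t in a..x, p t * sinDiv t z) (p x * sinDiv x z) x :=
    fun x => intervalIntegral.integral_hasDerivAt_right
      (Continuous.intervalIntegrable (by fun_prop) _ _)
      (Continuous.stronglyMeasurableAtFilter (by fun_prop) _ _)
      (Continuous.continuousAt (by fun_prop))
  refine ⟨fun x => -z * sinDiv (x - a) z + (cosRho x z * (∫ t in a..x, p t * cosRho t z) +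
    z * sinDiv x z * ∫ t in a..x, p t * sinDiv t z), fun x => ⟨?_, ?_⟩⟩
  · rw [funext fun x => solC_eq hp a x z]
    have h := ((hasDerivAt_cosRho_left z (x - a)).comp_sub_const x a).add
      (((hasDerivAt_sinDiv_left z x).mul (hA x)).sub ((hasDerivAt_cosRho_left z x).mul (hB x)))
    refine h.congr_deriv ?_
    ring
  · have h := (((hasDerivAt_sinDiv_left z (x - a)).comp_sub_const x a).const_mul (-z)).add
      (((hasDerivAt_cosRho_left z x).mul (hA x)).add
        (((hasDerivAt_sinDiv_left z x).const_mul z).mul (hB x)))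
    refine h.congr_deriv ?_
    rw [solC_eq hp]
    linear_combination p x * cosRho_sq_add x z

lemma solC_self (p : ℝ → ℂ) (a : ℝ) (z : ℂ) : solC p a a z = 1 := by simp [solC]

/-- Duhamel's formula: along a solution, `y(t) cos ρ(t-x) - y'(t) sin ρ(t-x)/ρ` has derivative `y(c)
p(t) sin ρ(x-t)/ρ`. Integrating from `c` to `x` represents `y`, and with it uniqueness. -/
lemma eq_solC_add_solS {p : ℝ → ℂ} (hp : Continuous p) {a b c : ℝ} (hc : c ∈ Set.Ioo a b) {z : ℂ}
    {y y₁ : ℝ → ℂ} (hy : ∀ x ∈ Set.Ioo a b, HasDerivAt y (y₁ x) x)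
    (hy₁ : ∀ x ∈ Set.Ioo a b, HasDerivAt y₁ (p x * y c - z * y x) x) {x : ℝ}
    (hx : x ∈ Set.Ioo a b) : y x = y c * solC p c x z + y₁ c * solS c x z := by
  have hsub : Set.uIcc c x ⊆ Set.Ioo a b := Set.ordConnected_Ioo.uIcc_subset hc hx
  have key := intervalIntegral.integral_eq_sub_of_hasDerivAt (a := c) (b := x)
    (f := fun t => y t * cosRho (t - x) z - y₁ t * sinDiv (t - x) z)
    (f' := fun t => y c * (p t * sinDiv (x - t) z)) (fun t ht => by
      have h := ((hy t (hsub ht)).mul ((hasDerivAt_cosRho_left z (t - x)).comp_sub_const t x)).sub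
        ((hy₁ t (hsub ht)).mul ((hasDerivAt_sinDiv_left z (t - x)).comp_sub_const t x))
      refine h.congr_deriv ?_
      rw [show x - t = -(t - x) by ring, sinDiv_neg]
      ring)
    (Continuous.intervalIntegrable (by
      have := (continuous_sinDiv z).comp (continuous_const.sub continuous_id : Continuous (x - ·))
      simp only [Function.comp_def] at this
      fun_prop) _ _)
  rw [intervalIntegral.integral_const_mul] at key
  simp only [sub_self, cosRho_zero, sinDiv_zero, mul_one, mul_zero, sub_zero] at key
  rw [show c - x = -(x - c) by ring, cosRho_neg, sinDiv_neg] at key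
  rw [solC, ← cosRho, solS]
  linear_combination -key

lemma isEigenvalue_iff_of_continuous {p : ℝ → ℂ} (hp : Continuous p) (z : ℂ) :
    IsEigenvalue p (Real.pi / 2) z ↔ charFun p (Real.pi / 2) z = 0 := by
  have hpi := Real.pi_pos
  have hc : Real.pi / 2 ∈ Set.Ioo 0 Real.pi := ⟨by positivity, by linarith⟩
  obtain ⟨C₁, hC⟩ := exists_hasDerivAt_solC hp (Real.pi / 2) z
  have hS : ∀ x, HasDerivAt (fun x => solS (Real.pi / 2) x z) (cosRho (x - Real.pi / 2) z) x :=
    fun x => (hasDerivAt_sinDiv_left z _).comp_sub_const x _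
  have hS₁ : ∀ x, HasDerivAt (fun x => cosRho (x - Real.pi / 2) z)
      (-z * solS (Real.pi / 2) x z) x :=
    fun x => (hasDerivAt_cosRho_left z _).comp_sub_const x _
  have hS0 : solS (Real.pi / 2) 0 z = -sinDiv (Real.pi / 2) z := by rw [solS, zero_sub, sinDiv_neg]
  have hSpi : solS (Real.pi / 2) Real.pi z = sinDiv (Real.pi / 2) z := by
    rw [solS]; congr 1; ring
  have hSc : solS (Real.pi / 2) (Real.pi / 2) z = 0 := by simp [solS]
  rw [charFun, hS0, hSpi]
  set s := sinDiv (Real.pi / 2) z with hs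
  constructor
  · rintro ⟨y, y₁, hyc, hy, hy₁, h0, hpi0, x, hx, hxne⟩
    have heq : Set.EqOn y (fun x => y (Real.pi / 2) * solC p (Real.pi / 2) x z +
        y₁ (Real.pi / 2) * solS (Real.pi / 2) x z) (Set.Icc 0 Real.pi) := by
      refine Set.EqOn.of_subset_closure (s := Set.Ioo 0 Real.pi)
        (fun x hx => eq_solC_add_solS hp hc hy hy₁ hx) hyc ?_ Set.Ioo_subset_Icc_self
        (by rw [closure_Ioo hpi.ne])
      exact (Continuous.add
        (continuous_const.mul (continuous_iff_continuousAt.2 fun x => (hC x).1.continuousAt))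
        (continuous_const.mul
          (continuous_iff_continuousAt.2 fun x => (hS x).continuousAt))).continuousOn
    have e0 := heq (Set.left_mem_Icc.2 hpi.le)
    have e1 := heq (Set.right_mem_Icc.2 hpi.le)
    simp only at e0 e1
    rw [h0, hS0] at e0
    rw [hpi0, hSpi] at e1
    by_contra hne
    have hsne : s ≠ 0 := by rintro h; simp [h] at hne
    have hsum : solC p (Real.pi / 2) 0 z + solC p (Real.pi / 2) Real.pi z ≠ 0 := by
      intro h
      exact hne (by linear_combination s * h)
    -- Adding the two boundary conditions eliminates `S`, which takes opposite values at `0` and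
    -- `π`.
    have hα : y (Real.pi / 2) = 0 := by
      refine (mul_eq_zero.1 ?_).resolve_right hsum
      linear_combination -e0 - e1
    have hβ : y₁ (Real.pi / 2) = 0 := by
      refine (mul_eq_zero.1 ?_).resolve_right hsne
      rw [hα] at e1
      linear_combination -e1
    exact hxne (by rw [heq hx]; simp [hα, hβ])
  · intro h
    by_cases hs0 : s = 0
    -- A degenerate eigenvalue: `S` vanishes at `π/2`, so the frozen term drops out and `S` itself
    -- is an eigenfunction.
    · refine ⟨fun x => solS (Real.pi / 2) x z, fun x => cosRho (x - Real.pi / 2) z,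
        (continuous_iff_continuousAt.2 fun x => (hS x).continuousAt).continuousOn,
        fun x _ => hS x, fun x _ => ?_, by simp only [hS0, hs0, neg_zero], by simp only [hSpi, hs0],
        ?_⟩
      · simpa only [hSc, mul_zero, zero_sub, neg_mul] using hS₁ x
      · by_contra! hall
        have h1 := hS (Real.pi / 2)
        rw [sub_self, cosRho_zero] at h1
        have h2 : (fun x => solS (Real.pi / 2) x z) =ᶠ[nhds (Real.pi / 2)] fun _ => 0 := by
          filter_upwards [Icc_mem_nhds hc.1 hc.2] with x hx using hall x hx
        exact one_ne_zero (h1.unique ((hasDerivAt_const _ (0 : ℂ)).congr_of_eventuallyEq h2))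
    · set β := -solC p (Real.pi / 2) Real.pi z / s with hβ
      have hβs : β * s = -solC p (Real.pi / 2) Real.pi z := div_mul_cancel₀ _ hs0
      have hsum : solC p (Real.pi / 2) 0 z + solC p (Real.pi / 2) Real.pi z = 0 := by
        refine (mul_eq_zero.1 ?_).resolve_left hs0
        linear_combination h
      have hd : ∀ x, HasDerivAt (fun x => solC p (Real.pi / 2) x z +
          β * solS (Real.pi / 2) x z) (C₁ x + β * cosRho (x - Real.pi / 2) z) x :=
        fun x => (hC x).1.add ((hS x).const_mul β)
      refine ⟨fun x => solC p (Real.pi / 2) x z + β * solS (Real.pi / 2) x z,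
        fun x => C₁ x + β * cosRho (x - Real.pi / 2) z,
        (continuous_iff_continuousAt.2 fun x => (hd x).continuousAt).continuousOn,
        fun x _ => hd x, fun x _ => ?_, ?_, ?_, Real.pi / 2, Set.Ioo_subset_Icc_self hc, ?_⟩
      · refine ((hC x).2.add ((hS₁ x).const_mul β)).congr_deriv ?_
        simp only [solC_self, hSc]
        ring
      · simp only [hS0]
        linear_combination hsum - hβs
      · simp only [hSpi]
        linear_combination hβs
      · simp only [solC_self, hSc, mul_zero, add_zero]
        exact one_ne_zero

lemma isEigenvalue_iff {q : ℝ → ℂ} (hq : ContinuousOn q (Set.Icc 0 Real.pi)) (z : ℂ) :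
    IsEigenvalue q (Real.pi / 2) z ↔ charFun q (Real.pi / 2) z = 0 := by
  obtain ⟨p, hp, he⟩ := exists_continuous_eqOn hq
  rw [charFun_eq, oddFun_congr he, ← charFun_eq, ← isEigenvalue_iff_of_continuous hp]
  unfold IsEigenvalue
  refine exists_congr fun y => exists_congr fun y₁ => and_congr_right fun _ =>
    and_congr_right fun _ => and_congr_left fun _ => forall₂_congr fun x hx => ?_
  rw [he (Set.Ioo_subset_Icc_self hx)]

/-! ### Eigenvalues of the free discrete problem -/

lemma step_pos (l : ℕ) : 0 < step l := by unfold step; positivity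

lemma step_odd (M : ℕ) : step (2 * M + 1) = Real.pi / (2 * (M + 1)) := by
  unfold step; push_cast; congr 1; ring

lemma mul_step_le_pi {M n : ℕ} (hn : n ≤ 2 * M + 2) : n * step (2 * M + 1) ≤ Real.pi := by
  have h : (n : ℝ) ≤ 2 * (M + 1) := by
    have : (n : ℝ) ≤ (2 * M + 2 : ℕ) := by exact_mod_cast hn
    push_cast at this; linarith
  rw [step_odd]
  calc (n : ℝ) * (Real.pi / (2 * (M + 1))) ≤ 2 * (M + 1) * (Real.pi / (2 * (M + 1))) :=
        mul_le_mul_of_nonneg_right h (by positivity)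
    _ = Real.pi := by field_simp

@[simp] lemma freeEigenvalue_zero (l : ℕ) : freeEigenvalue l 0 = 0 := by simp [freeEigenvalue]

lemma two_div_pi_mul_le_sin {x y : ℝ} (hy : 0 ≤ y) (h1 : y ≤ x) (h2 : y ≤ Real.pi - x) :
    2 / Real.pi * y ≤ Real.sin x := by
  have hp : 0 ≤ 2 / Real.pi := by positivity
  rcases le_total x (Real.pi / 2) with h | h
  · exact (mul_le_mul_of_nonneg_left h1 hp).trans (Real.mul_le_sin (hy.trans h1) h)
  · rw [← Real.sin_pi_sub]
    exact (mul_le_mul_of_nonneg_left h2 hp).trans (Real.mul_le_sin (hy.trans h2) (by linarith))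

/-- The difference is `(4/h²) sin((n-k)h/2) sin((n+k)h/2)`. Both sines are at least `(2/π)(n-k)h/2`;
for the second this uses `nh ≤ π`, since its argument may pass `π/2`. -/
lemma freeEigenvalue_gap {M n k : ℕ} (hkn : k ≤ n) (hn : n ≤ 2 * M + 2) :
    4 / Real.pi ^ 2 * ((n : ℝ) - k) ^ 2 ≤
      freeEigenvalue (2 * M + 1) n - freeEigenvalue (2 * M + 1) k := by
  have hh := step_pos (2 * M + 1)
  have hpi := Real.pi_pos
  have hnp := mul_step_le_pi hn
  set h := step (2 * M + 1) with hdef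
  have hkn' : (k : ℝ) ≤ n := by exact_mod_cast hkn
  have hk0 : (0 : ℝ) ≤ k := k.cast_nonneg
  set y := ((n : ℝ) - k) * h / 2 with hy
  have hy0 : 0 ≤ y := by
    have : 0 ≤ (n : ℝ) - k := by linarith
    positivity
  have hkh : 0 ≤ (k : ℝ) * h := by positivity
  have s1 : 2 / Real.pi * y ≤ Real.sin y :=
    two_div_pi_mul_le_sin hy0 le_rfl (by rw [hy]; nlinarith)
  have s2 : 2 / Real.pi * y ≤ Real.sin (((n : ℝ) + k) * h / 2) :=
    two_div_pi_mul_le_sin hy0 (by rw [hy]; nlinarith) (by rw [hy]; nlinarith)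
  have e : freeEigenvalue (2 * M + 1) n - freeEigenvalue (2 * M + 1) k =
      4 / h ^ 2 * (Real.sin y * Real.sin (((n : ℝ) + k) * h / 2)) := by
    have h1 : y = n * h / 2 - k * h / 2 := by rw [hy]; ring
    have h2 : ((n : ℝ) + k) * h / 2 = n * h / 2 + k * h / 2 := by ring
    rw [freeEigenvalue, freeEigenvalue, h1, h2, Real.sin_sub, Real.sin_add]
    have c1 := Real.sin_sq_add_cos_sq (n * h / 2)
    have c2 := Real.sin_sq_add_cos_sq (k * h / 2)
    rw [← hdef]
    linear_combination 4 / h ^ 2 * (Real.sin (k * h / 2) ^ 2 * c1 - Real.sin (n * h / 2) ^ 2 * c2)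
  rw [e]
  have hm := mul_le_mul s1 s2 (by positivity) (le_trans (by positivity) s1)
  calc 4 / Real.pi ^ 2 * ((n : ℝ) - k) ^ 2 = 4 / h ^ 2 * (2 / Real.pi * y * (2 / Real.pi * y)) := by
        rw [hy]; field_simp
    _ ≤ _ := mul_le_mul_of_nonneg_left hm (by positivity)

lemma le_freeEigenvalue {M n : ℕ} (hn : n ≤ 2 * M + 2) :
    4 / Real.pi ^ 2 * (n : ℝ) ^ 2 ≤ freeEigenvalue (2 * M + 1) n := by
  simpa using freeEigenvalue_gap (Nat.zero_le n) hn

lemma freeEigenvalue_nonneg (l n : ℕ) : 0 ≤ freeEigenvalue l n := by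
  unfold freeEigenvalue; positivity

lemma freeEigenvalue_lt {M n k : ℕ} (hkn : k < n) (hn : n ≤ 2 * M + 2) :
    freeEigenvalue (2 * M + 1) k < freeEigenvalue (2 * M + 1) n := by
  have h := freeEigenvalue_gap hkn.le hn
  have : (0 : ℝ) < (n : ℝ) - k := sub_pos.2 (by exact_mod_cast hkn)
  have : 0 < 4 / Real.pi ^ 2 * ((n : ℝ) - k) ^ 2 := by positivity
  linarith

/-! ### A convolution of inverse squares -/

/-- With `a = 2i + 1` and `b = |2J - a|`, both at least `1`, one has `ab ≥ a + b - 1 ≥ 2J - 1 ≥ J`.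
One factor `1/(ab)` is bounded by `1/J`, the other by `(1/a² + 1/b²)/2`, which is summable uniformly
in `J`. -/
lemma exists_sum_inv_sq_mul_le : ∃ T : ℝ, 0 ≤ T ∧ ∀ (s : Finset ℕ) (J : ℕ), 1 ≤ J →
    ∑ i ∈ s, 1 / ((2 * i + 1 : ℝ) ^ 2 * (2 * J - (2 * i + 1) : ℝ) ^ 2) ≤ T / J := by
  have hsum : Summable fun n : ℤ => 1 / (n : ℝ) ^ 2 :=
    Real.summable_one_div_int_pow.2 (by norm_num)
  refine ⟨∑' n : ℤ, 1 / (n : ℝ) ^ 2, tsum_nonneg fun n => by positivity, fun s J hJ => ?_⟩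
  set T := ∑' n : ℤ, 1 / (n : ℝ) ^ 2 with hT
  have hinj : ∀ φ : ℕ → ℤ, Function.Injective φ → ∑ i ∈ s, 1 / (φ i : ℝ) ^ 2 ≤ T := by
    intro φ hφ
    have := hsum.sum_le_tsum (s.map ⟨φ, hφ⟩) fun n _ => by positivity
    simpa [hT] using this
  have h1 := hinj (fun i => 2 * i + 1) fun i j h => by simpa using h
  have h2 := hinj (fun i => 2 * J - (2 * i + 1)) fun i j h => by simpa using h
  push_cast at h1 h2
  have hJ0 : (0 : ℝ) < J := by exact_mod_cast hJ
  calc ∑ i ∈ s, 1 / ((2 * i + 1 : ℝ) ^ 2 * (2 * J - (2 * i + 1) : ℝ) ^ 2)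
      ≤ ∑ i ∈ s, 1 / (J : ℝ) * ((1 / (2 * i + 1 : ℝ) ^ 2 + 1 / (2 * J - (2 * i + 1) : ℝ) ^ 2) / 2) := by
        refine Finset.sum_le_sum fun i _ => ?_
        have ha : (1 : ℝ) ≤ 2 * i + 1 := by
          have : (0 : ℝ) ≤ i := i.cast_nonneg
          linarith
        have hb : (1 : ℝ) ≤ |(2 * J - (2 * i + 1) : ℝ)| := by
          have : (1 : ℤ) ≤ |2 * (J : ℤ) - (2 * i + 1)| := Int.one_le_abs (by omega)
          exact_mod_cast this
        have hab := le_abs_self (2 * J - (2 * i + 1) : ℝ)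
        rw [← sq_abs (2 * J - (2 * i + 1) : ℝ)]
        set a : ℝ := 2 * i + 1 with hadef
        set b : ℝ := |(2 * J - a : ℝ)| with hbdef
        have hJab : (J : ℝ) ≤ a * b := by
          have hJ1 : (1 : ℝ) ≤ J := by exact_mod_cast hJ
          nlinarith [mul_nonneg (sub_nonneg.2 ha) (sub_nonneg.2 hb)]
        have ha0 : 0 < a := by linarith
        have hb0 : 0 < b := by linarith
        have e1 : 1 / (a ^ 2 * b ^ 2) = 1 / (a * b) * (1 / (a * b)) := by field_simp
        rw [e1]
        refine mul_le_mul (one_div_le_one_div_of_le hJ0 hJab) ?_ (by positivity) (by positivity)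
        have : 0 ≤ (1 / a - 1 / b) ^ 2 := sq_nonneg _
        have e2 : 1 / (a * b) = 1 / a * (1 / b) := by field_simp
        have e3 : 1 / a ^ 2 = (1 / a) ^ 2 := by field_simp
        have e4 : 1 / b ^ 2 = (1 / b) ^ 2 := by field_simp
        rw [e2, e3, e4]
        nlinarith
    _ = 1 / (J : ℝ) * ((∑ i ∈ s, 1 / (2 * i + 1 : ℝ) ^ 2 +
          ∑ i ∈ s, 1 / (2 * J - (2 * i + 1) : ℝ) ^ 2) / 2) := by
        rw [← Finset.mul_sum, ← Finset.sum_div, Finset.sum_add_distrib]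
    _ ≤ 1 / (J : ℝ) * T := mul_le_mul_of_nonneg_left (by linarith) (by positivity)
    _ = T / J := by ring

/-! ### Summation by parts and second differences -/

lemma sum_mul_second_difference (a b : ℕ → ℂ) (N : ℕ) :
    ∑ j ∈ Finset.range N, a (j + 1) * (2 * b (j + 1) - b (j + 2) - b j) =
      ∑ j ∈ Finset.range N, (2 * a (j + 1) - a (j + 2) - a j) * b (j + 1) +
        ((a (N + 1) * b N - a N * b (N + 1)) - (a 1 * b 0 - a 0 * b 1)) := by
  induction N with
  | zero => simp
  | succ N ih => rw [Finset.sum_range_succ, Finset.sum_range_succ, ih]; ring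

lemma MemW21.exists_norm_second_difference_le {q : ℝ → ℂ} (hq : MemW21 q) :
    ∃ Q : ℝ, 0 ≤ Q ∧ ∀ M : ℕ, ∑ j ∈ Finset.range (2 * M + 1),
      ‖2 * q ((j + 1 : ℕ) * step (2 * M + 1)) - q ((j + 2 : ℕ) * step (2 * M + 1)) -
        q (j * step (2 * M + 1))‖ ≤ Q * step (2 * M + 1) := by
  have hpi := Real.pi_pos
  set q₁ := derivWithin q (Set.Icc 0 Real.pi) with hq₁
  have hint := fun {c d} hc hd => (hq.intervalIntegrable (c := c) (d := d) hc hd).norm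
  set I : ℝ → ℝ := fun x => ∫ t in (0 : ℝ)..x, ‖deriv q₁ t‖ with hI
  have m0 : (0 : ℝ) ∈ Set.Icc 0 Real.pi := ⟨le_rfl, hpi.le⟩
  have hsub : ∀ x ∈ Set.Icc 0 Real.pi, ∀ y ∈ Set.Icc 0 Real.pi,
      I y - I x = ∫ t in x..y, ‖deriv q₁ t‖ := fun x hx y hy =>
    intervalIntegral.integral_interval_sub_left (hint m0 hy) (hint m0 hx)
  have hmono : ∀ x ∈ Set.Icc 0 Real.pi, ∀ y ∈ Set.Icc 0 Real.pi, x ≤ y → I x ≤ I y := by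
    intro x hx y hy hxy
    have := hsub x hx y hy
    have h2 : 0 ≤ ∫ t in x..y, ‖deriv q₁ t‖ :=
      intervalIntegral.integral_nonneg hxy fun _ _ => norm_nonneg _
    linarith
  have hq₁b : ∀ x ∈ Set.Icc 0 Real.pi, ∀ y ∈ Set.Icc 0 Real.pi, x ≤ y →
      ‖q₁ y - q₁ x‖ ≤ I y - I x := by
    intro x hx y hy hxy
    have hu : Set.uIcc x y ⊆ Set.uIcc 0 Real.pi := by
      rw [Set.uIcc_of_le hpi.le]; exact Set.uIcc_subset_Icc hx hy
    have ac := hq.ac_deriv.mono hu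
    rw [hsub x hx y hy, ← ftc_re_im ac (hq.intervalIntegrable hx hy) (by
      filter_upwards [hq.ac_deriv.boundedVariationOn.ae_differentiableAt_of_mem_uIcc] with t ht htm
      exact (ht (hu (Set.uIoc_subset_uIcc htm))).hasDerivAt)]
    exact intervalIntegral.norm_integral_le_integral_norm hxy
  -- Up to sign, the second difference is the increment over `[x, x + h]` of `t ↦ q(t + h) - q(t)`,
  -- whose derivative is bounded by the integral of `|q''|` over `[x, x + 2h]`.
  have hdiff : ∀ x h : ℝ, 0 ≤ x → 0 ≤ h → x + 2 * h ≤ Real.pi →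
      ‖2 * q (x + h) - q (x + 2 * h) - q x‖ ≤ (I (x + 2 * h) - I x) * h := by
    intro x h hx hh hxh
    have mI : ∀ t ∈ Set.Icc x (x + h), t ∈ Set.Icc 0 Real.pi ∧ t + h ∈ Set.Icc 0 Real.pi := by
      rintro t ⟨h1, h2⟩
      exact ⟨⟨by linarith, by linarith⟩, ⟨by linarith, by linarith⟩⟩
    have hD : ∀ t ∈ Set.Icc x (x + h), HasDerivWithinAt (fun t => q (t + h) - q t)
        (q₁ (t + h) - q₁ t) (Set.Icc x (x + h)) t := by
      intro t ht
      have d1 := ((hq.differentiableOn t (mI t ht).1).hasDerivWithinAt).mono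
        (t := Set.Icc 0 Real.pi) (s := Set.Icc x (x + h)) fun u hu => (mI u hu).1
      have d2 := (hq.differentiableOn _ (mI t ht).2).hasDerivWithinAt.scomp t
        (((hasDerivAt_id t).add_const h).hasDerivWithinAt (s := Set.Icc x (x + h)))
        fun u hu => (mI u hu).2
      rw [one_smul] at d2
      exact d2.sub d1
    have key := (convex_Icc x (x + h)).norm_image_sub_le_of_norm_hasDerivWithin_le hD
      (C := I (x + 2 * h) - I x) (fun t ht => by
        have h1 := hq₁b t (mI t ht).1 (t + h) (mI t ht).2 (by linarith)
        have h2 := hmono (t + h) (mI t ht).2 (x + 2 * h) ⟨by linarith, hxh⟩ (by linarith [ht.2])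
        have h3 := hmono x ⟨hx, by linarith⟩ t (mI t ht).1 ht.1
        linarith)
      (Set.left_mem_Icc.2 (by linarith)) (Set.right_mem_Icc.2 (by linarith))
    rw [show x + h + h = x + 2 * h by ring, show x + h - x = h by ring, Real.norm_of_nonneg hh,
      ← norm_neg] at key
    refine le_of_eq_of_le ?_ key
    congr 1; ring
  have hIpi : 0 ≤ I Real.pi := intervalIntegral.integral_nonneg hpi.le fun _ _ => norm_nonneg _
  refine ⟨2 * I Real.pi, by positivity, fun M => ?_⟩
  have hh := step_pos (2 * M + 1)
  have hle := fun {n} hn => mul_step_le_pi (M := M) (n := n) hn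
  set h := step (2 * M + 1) with hdef
  have mem : ∀ n : ℕ, n ≤ 2 * M + 2 → (n * h : ℝ) ∈ Set.Icc 0 Real.pi := fun n hn =>
    ⟨by positivity, hle hn⟩
  -- Intervals of length `2h` at steps of `h` cover each point at most twice, hence the factor `2`
  -- in the constant.
  have htel : ∀ N : ℕ, ∑ j ∈ Finset.range N, (I ((j + 2 : ℕ) * h) - I (j * h)) =
      I ((N + 1 : ℕ) * h) + I (N * h) - I ((1 : ℕ) * h) - I ((0 : ℕ) * h) := by
    intro N
    induction N with
    | zero => simp
    | succ N ih => rw [Finset.sum_range_succ, ih]; push_cast; ring_nf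
  calc _ ≤ ∑ j ∈ Finset.range (2 * M + 1), (I ((j + 2 : ℕ) * h) - I (j * h)) * h := by
        refine Finset.sum_le_sum fun j hj => ?_
        have hj : j < 2 * M + 1 := Finset.mem_range.1 hj
        have e1 : ((j + 1 : ℕ) * h : ℝ) = j * h + h := by push_cast; ring
        have e2 : ((j + 2 : ℕ) * h : ℝ) = j * h + 2 * h := by push_cast; ring
        have := hle (n := j + 2) (by omega)
        rw [e1, e2] at *
        exact hdiff _ _ (by positivity) hh.le this
    _ ≤ 2 * I Real.pi * h := by
        rw [← Finset.sum_mul, htel]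
        refine mul_le_mul_of_nonneg_right ?_ hh.le
        have h1 := hmono _ (mem (2 * M + 1 + 1) le_rfl) Real.pi ⟨hpi.le, le_rfl⟩ (hle le_rfl)
        have h2 := hmono _ (mem (2 * M + 1) (by omega)) Real.pi ⟨hpi.le, le_rfl⟩ (hle (by omega))
        have h3 := hmono 0 m0 _ (mem 1 (by omega)) (mem 1 (by omega)).1
        have h4 := hmono 0 m0 _ (mem 0 (by omega)) (mem 0 (by omega)).1
        have h5 : I 0 = 0 := intervalIntegral.integral_same
        linarith

/-- The coefficients of the expansion `1 - ∑ c_i / (z - f_{2 i + 1})`, where `f_n` are the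
eigenvalues of the free problem with `l = 2 M + 1`. -/
noncomputable def discreteCoeff (q : ℝ → ℂ) (M i : ℕ) : ℂ :=
  (-1) ^ i / (M + 1) * ∑ j ∈ Finset.range (2 * M + 1),
    q ((j + 1 : ℕ) * step (2 * M + 1)) *
      (Real.sin ((2 * i + 1 : ℕ) * ((j + 1 : ℕ) * step (2 * M + 1))) : ℂ)

lemma second_difference_sin (l n j : ℕ) :
    2 * Real.sin (n * ((j + 1 : ℕ) * step l)) - Real.sin (n * ((j + 2 : ℕ) * step l)) -
      Real.sin (n * (j * step l)) =
    step l ^ 2 * freeEigenvalue l n * Real.sin (n * ((j + 1 : ℕ) * step l)) := by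
  have hh := step_pos l
  have e1 : (n * ((j + 2 : ℕ) * step l) : ℝ) = n * ((j + 1 : ℕ) * step l) + n * step l := by
    push_cast; ring
  have e2 : (n * (j * step l) : ℝ) = n * ((j + 1 : ℕ) * step l) - n * step l := by
    push_cast; ring
  have e3 : step l ^ 2 * freeEigenvalue l n = 2 - 2 * Real.cos (n * step l) := by
    have : (n * step l : ℝ) = 2 * (n * step l / 2) := by ring
    rw [this, Real.cos_two_mul, Real.cos_sq', freeEigenvalue]
    field_simp
    ring
  rw [e1, e2, e3, Real.sin_add, Real.sin_sub]
  ring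

/-- The discrete analogue of two integrations by parts: the sine is an eigenvector of the second
difference, so `h² f S` is a sum of second differences of `q` against sines, of size at most `Qh`.
Together with `1/(M + 1) = 2h/π` and `f ≥ 4n²/π²` this gives `Qπ/2`. -/
lemma exists_norm_discreteCoeff_le {q : ℝ → ℂ} (hq : MemW21 q) (hq0 : q 0 + q Real.pi = 0) :
    ∃ K : ℝ, 0 ≤ K ∧ ∀ M i : ℕ, i ≤ M → ‖discreteCoeff q M i‖ ≤ K / (2 * i + 1 : ℝ) ^ 2 := by
  obtain ⟨Q, hQ, hb⟩ := hq.exists_norm_second_difference_le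
  have hpi := Real.pi_pos
  refine ⟨Q * Real.pi / 2, by positivity, fun M i hi => ?_⟩
  have hh := step_pos (2 * M + 1)
  have hstep := step_odd M
  have hgap := le_freeEigenvalue (M := M) (n := 2 * i + 1) (by omega)
  have hsin := second_difference_sin (2 * M + 1) (2 * i + 1)
  have hb := hb M
  unfold discreteCoeff
  set h := step (2 * M + 1) with hdef
  set f := freeEigenvalue (2 * M + 1) (2 * i + 1) with hf
  set n : ℕ := 2 * i + 1 with hn
  set S := ∑ j ∈ Finset.range (2 * M + 1), q ((j + 1 : ℕ) * h) *
    (Real.sin (n * ((j + 1 : ℕ) * h)) : ℂ) with hS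
  have hNh : ((2 * M + 1 + 1 : ℕ) * h : ℝ) = Real.pi := by
    rw [hstep]; push_cast; field_simp; ring
  have hend : Real.sin (n * ((2 * M + 1 + 1 : ℕ) * h)) = 0 := by
    rw [hNh, Real.sin_nat_mul_pi]
  -- For odd `n` the sine is symmetric about `π/2`, so the boundary term becomes `(q(0) + q(π))
  -- sin(nh) = 0`.
  have hrefl : Real.sin (n * ((2 * M + 1 : ℕ) * h)) = Real.sin (n * ((1 : ℕ) * h)) := by
    have : (n * ((2 * M + 1 : ℕ) * h) : ℝ) = Real.pi - n * ((1 : ℕ) * h) + i * (2 * Real.pi) := by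
      rw [← hNh, hn]; push_cast; ring
    rw [this, Real.sin_add_nat_mul_two_pi, Real.sin_pi_sub]
  have key := sum_mul_second_difference (fun j => q (j * h))
    (fun j => (Real.sin (n * (j * h)) : ℂ)) (2 * M + 1)
  have e1 : ∀ j : ℕ, (2 * (Real.sin (n * ((j + 1 : ℕ) * h)) : ℂ) -
      (Real.sin (n * ((j + 2 : ℕ) * h)) : ℂ) - (Real.sin (n * (j * h)) : ℂ)) =
      (h ^ 2 * f : ℝ) * (Real.sin (n * ((j + 1 : ℕ) * h)) : ℂ) := by
    intro j; exact_mod_cast hsin j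
  simp only [e1] at key
  rw [hend, hrefl, hNh] at key
  have e2 : ∑ j ∈ Finset.range (2 * M + 1), q ((j + 1 : ℕ) * h) *
      ((h ^ 2 * f : ℝ) * (Real.sin (n * ((j + 1 : ℕ) * h)) : ℂ)) = (h ^ 2 * f : ℝ) * S := by
    rw [hS, Finset.mul_sum]
    exact Finset.sum_congr rfl fun j _ => by ring
  rw [e2] at key
  have e3 : (q Real.pi * (Real.sin (n * ((1 : ℕ) * h)) : ℂ) - q ((2 * M + 1 : ℕ) * h) * ((0 : ℝ) : ℂ) -
      (q ((1 : ℕ) * h) * (Real.sin (n * ((0 : ℕ) * h)) : ℂ) -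
        q ((0 : ℕ) * h) * (Real.sin (n * ((1 : ℕ) * h)) : ℂ))) = 0 := by
    simp only [Nat.cast_zero, zero_mul, mul_zero, Real.sin_zero, Complex.ofReal_zero]
    linear_combination (Real.sin (n * ((1 : ℕ) * h)) : ℂ) * hq0
  rw [e3, add_zero] at key
  have hn0 : (0 : ℝ) < 2 * i + 1 := by positivity
  have hnc : (n : ℝ) = 2 * i + 1 := by rw [hn]; push_cast; ring
  rw [hnc] at hgap
  have hf0 : 0 < f := lt_of_lt_of_le (by positivity) hgap
  have hSb : h ^ 2 * f * ‖S‖ ≤ Q * h := by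
    have : ‖((h ^ 2 * f : ℝ) : ℂ) * S‖ = h ^ 2 * f * ‖S‖ := by
      rw [norm_mul, Complex.norm_real, Real.norm_of_nonneg (by positivity)]
    rw [← this, key]
    refine (norm_sum_le _ _).trans (le_trans (Finset.sum_le_sum fun j _ => ?_) hb)
    rw [norm_mul, Complex.norm_real]
    exact mul_le_of_le_one_right (norm_nonneg _) (Real.abs_sin_le_one _)
  have hM : ((M : ℝ) + 1) = Real.pi / (2 * h) := by rw [hstep]; field_simp
  have hMn : ‖((M : ℂ) + 1)‖ = Real.pi / (2 * h) := by
    rw [← hM]; exact_mod_cast Complex.norm_natCast (M + 1)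
  rw [norm_mul, norm_div, norm_pow, norm_neg, norm_one, one_pow, hMn]
  have hS2 : ‖S‖ ≤ Q / (h * f) := by
    rw [le_div_iff₀ (by positivity)]
    refine le_of_mul_le_mul_left ?_ hh
    nlinarith
  calc 1 / (Real.pi / (2 * h)) * ‖S‖ ≤ 1 / (Real.pi / (2 * h)) * (Q / (h * f)) :=
        mul_le_mul_of_nonneg_left hS2 (by positivity)
    _ = 2 * Q / Real.pi / f := by field_simp
    _ ≤ 2 * Q / Real.pi / (4 / Real.pi ^ 2 * (2 * i + 1 : ℝ) ^ 2) :=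
        div_le_div_of_nonneg_left (by positivity) (by positivity) hgap
    _ = Q * Real.pi / 2 / (2 * i + 1 : ℝ) ^ 2 := by field_simp; ring

/-! ### Orthogonality of the discrete sines -/

lemma succ_mul_step (M : ℕ) : ((2 * M + 1 + 1 : ℕ) * step (2 * M + 1) : ℝ) = Real.pi := by
  rw [step_odd]; push_cast; field_simp; ring

lemma two_sin_mul_sum_cos (β : ℝ) (N : ℕ) :
    2 * Real.sin β * ∑ j ∈ Finset.range N, Real.cos (2 * (β * j)) =
      Real.sin (2 * (β * N) - β) + Real.sin β := by
  induction N with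
  | zero => simp
  | succ N ih =>
    rw [Finset.sum_range_succ, mul_add, ih]
    have : 2 * (β * (N + 1 : ℕ)) - β = 2 * (β * N) + β := by push_cast; ring
    rw [this, Real.sin_sub, Real.sin_add]
    ring

lemma sin_mul_step_pos {M n : ℕ} (h1 : 1 ≤ n) (h2 : n ≤ 2 * M + 1) :
    0 < Real.sin (n * step (2 * M + 1)) := by
  have hh := step_pos (2 * M + 1)
  have hn : (0 : ℝ) < n := by exact_mod_cast h1
  refine Real.sin_pos_of_pos_of_lt_pi (by positivity) ?_
  rw [← succ_mul_step M]
  exact mul_lt_mul_of_pos_right (by exact_mod_cast (by omega)) hh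

lemma sum_sin_sq {M n : ℕ} (h1 : 1 ≤ n) (h2 : n ≤ 2 * M + 1) :
    ∑ j ∈ Finset.range (2 * M + 1), Real.sin (n * ((j + 1 : ℕ) * step (2 * M + 1))) ^ 2 =
      (M + 1 : ℝ) := by
  have hs := sin_mul_step_pos h1 h2
  have key := two_sin_mul_sum_cos (n * step (2 * M + 1)) (2 * M + 1 + 1)
  have e : 2 * (n * step (2 * M + 1) * (2 * M + 1 + 1 : ℕ)) - n * step (2 * M + 1) =
      n * (2 * Real.pi) - n * step (2 * M + 1) := by rw [← succ_mul_step M]; ring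
  rw [e, Real.sin_nat_mul_two_pi_sub, neg_add_cancel, mul_eq_zero] at key
  have key := key.resolve_left (by positivity)
  rw [Finset.sum_range_succ'] at key
  have e2 : ∀ j : ℕ, Real.sin (n * ((j + 1 : ℕ) * step (2 * M + 1))) ^ 2 =
      1 / 2 - Real.cos (2 * (n * step (2 * M + 1) * (j + 1 : ℕ))) / 2 := by
    intro j
    rw [Real.cos_two_mul, Real.cos_sq']
    have : (n * ((j + 1 : ℕ) * step (2 * M + 1)) : ℝ) = n * step (2 * M + 1) * (j + 1 : ℕ) := by ring
    rw [this]; ring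
  rw [Finset.sum_congr rfl fun j _ => e2 j, Finset.sum_sub_distrib, ← Finset.sum_div,
    ← Finset.sum_div]
  simp only [Nat.cast_zero, mul_zero, Real.cos_zero] at key
  rw [eq_neg_of_add_eq_zero_left key]
  simp
  ring

/-- Both vectors are eigenvectors of the symmetric second difference with zero boundary values, and
their eigenvalues differ. -/
lemma sum_sin_mul_sin {M n k : ℕ} (hn : n ≤ 2 * M + 1) (hk : k ≤ 2 * M + 1) (hnk : n ≠ k) :
    ∑ j ∈ Finset.range (2 * M + 1), Real.sin (n * ((j + 1 : ℕ) * step (2 * M + 1))) *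
      Real.sin (k * ((j + 1 : ℕ) * step (2 * M + 1))) = 0 := by
  have hne : freeEigenvalue (2 * M + 1) n ≠ freeEigenvalue (2 * M + 1) k := by
    rcases lt_or_gt_of_ne hnk with h | h
    · exact (freeEigenvalue_lt h (by omega)).ne
    · exact (freeEigenvalue_lt h (by omega)).ne'
  have hh := step_pos (2 * M + 1)
  have key := sum_mul_second_difference (fun j => (Real.sin (n * (j * step (2 * M + 1))) : ℂ))
    (fun j => (Real.sin (k * (j * step (2 * M + 1))) : ℂ)) (2 * M + 1)
  simp only [← Complex.ofReal_mul, ← Complex.ofReal_sub, ← Complex.ofReal_add,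
    ← Complex.ofReal_sum, ← Complex.ofReal_ofNat, Complex.ofReal_inj] at key
  simp only [second_difference_sin, succ_mul_step, Real.sin_nat_mul_pi] at key
  simp only [Nat.cast_zero, zero_mul, mul_zero, Real.sin_zero, sub_zero, add_zero] at key
  set A := ∑ j ∈ Finset.range (2 * M + 1), Real.sin (n * ((j + 1 : ℕ) * step (2 * M + 1))) *
      Real.sin (k * ((j + 1 : ℕ) * step (2 * M + 1))) with hA
  have e1 : step (2 * M + 1) ^ 2 * freeEigenvalue (2 * M + 1) k * A =
      step (2 * M + 1) ^ 2 * freeEigenvalue (2 * M + 1) n * A := by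
    rw [hA, Finset.mul_sum, Finset.mul_sum]
    convert key using 2 <;> ring
  by_contra hA0
  have e2 := mul_right_cancel₀ hA0 e1
  exact hne (mul_left_cancel₀ (by positivity) e2).symm

/-- The matrix of the discrete sine transform. -/
noncomputable def sineMatrix (M : ℕ) : Matrix (Fin (2 * M + 1)) (Fin (2 * M + 1)) ℂ := fun i j =>
  (Real.sin (((j : ℕ) + 1 : ℕ) * (((i : ℕ) + 1 : ℕ) * step (2 * M + 1))) : ℂ)

lemma sineMatrix_mul_self (M : ℕ) :
    sineMatrix M * sineMatrix M = Matrix.diagonal fun _ => (M + 1 : ℂ) := by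
  ext i k
  have e : (sineMatrix M * sineMatrix M) i k = ((∑ j ∈ Finset.range (2 * M + 1),
      Real.sin (((i : ℕ) + 1 : ℕ) * ((j + 1 : ℕ) * step (2 * M + 1))) *
      Real.sin (((k : ℕ) + 1 : ℕ) * ((j + 1 : ℕ) * step (2 * M + 1))) : ℝ) : ℂ) := by
    rw [Matrix.mul_apply, Complex.ofReal_sum, ← Fin.sum_univ_eq_sum_range
      (fun j => ((Real.sin (((i : ℕ) + 1 : ℕ) * ((j + 1 : ℕ) * step (2 * M + 1))) *
      Real.sin (((k : ℕ) + 1 : ℕ) * ((j + 1 : ℕ) * step (2 * M + 1))) : ℝ) : ℂ))]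
    refine Finset.sum_congr rfl fun j _ => ?_
    rw [sineMatrix, sineMatrix, Complex.ofReal_mul]
    congr 3
    ring
  rw [e]
  by_cases hik : i = k
  · subst hik
    rw [Matrix.diagonal_apply_eq]
    simp only [← pow_two]
    rw [sum_sin_sq (by omega) (by omega)]
    push_cast; ring
  · rw [Matrix.diagonal_apply_ne _ hik, sum_sin_mul_sin (by omega) (by omega), Complex.ofReal_zero]
    intro h
    exact hik (Fin.ext (by omega))

/-- The zero boundary values supply the neighbours missing in the first and last rows. -/
lemma sum_tridiagonal_mul (l : ℕ) (h : ℂ) (s : ℕ → ℂ) (h0 : s 0 = 0) (hl : s (l + 1) = 0)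
    (i : Fin l) :
    ∑ j : Fin l, (if i = j then 2 / h ^ 2
      else if (i : ℕ) + 1 = j ∨ (j : ℕ) + 1 = i then -1 / h ^ 2 else 0) * s (j + 1) =
      (2 * s (i + 1) - s (i + 2) - s i) / h ^ 2 := by
  have e : ∀ j : Fin l, (if i = j then 2 / h ^ 2
      else if (i : ℕ) + 1 = j ∨ (j : ℕ) + 1 = i then -1 / h ^ 2 else 0) * s (j + 1) =
      (if (j : ℕ) = i then 2 / h ^ 2 * s (i + 1) else 0) +
      ((if (j : ℕ) = i + 1 then -1 / h ^ 2 * s (i + 2) else 0) +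
        (if (j : ℕ) + 1 = i then -1 / h ^ 2 * s i else 0)) := by
    intro j
    by_cases h1 : i = j
    · subst h1; simp
    · have h1' : (j : ℕ) ≠ i := fun h => h1 (Fin.ext h.symm)
      by_cases h2 : (i : ℕ) + 1 = j
      · have : ¬ (j : ℕ) + 1 = i := by omega
        rw [if_neg h1, if_pos (Or.inl h2), if_neg h1', if_pos h2.symm, if_neg this, ← h2]
        ring
      · by_cases h3 : (j : ℕ) + 1 = i
        · have : ¬ (j : ℕ) = i + 1 := by omega
          simp [h1, h1', h2, h3, this]
        · have : ¬ (j : ℕ) = i + 1 := by omega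
          simp [h1, h1', h2, h3, this]
  rw [Finset.sum_congr rfl fun j _ => e j,
    Fin.sum_univ_eq_sum_range (fun j => (if j = i then 2 / h ^ 2 * s (i + 1) else 0) +
      ((if j = i + 1 then -1 / h ^ 2 * s (i + 2) else 0) +
        (if j + 1 = i then -1 / h ^ 2 * s i else 0))),
    Finset.sum_add_distrib, Finset.sum_add_distrib, Finset.sum_ite_eq', Finset.sum_ite_eq']
  have e2 : (if (i : ℕ) + 1 ∈ Finset.range l then -1 / h ^ 2 * s (i + 2) else 0) =
      -1 / h ^ 2 * s (i + 2) := by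
    split_ifs with hi
    · rfl
    · have : (i : ℕ) + 2 = l + 1 := by
        have := i.2
        simp only [Finset.mem_range] at hi
        omega
      rw [this, hl, mul_zero]
  have e3 : ∑ j ∈ Finset.range l, (if j + 1 = (i : ℕ) then -1 / h ^ 2 * s i else 0) =
      -1 / h ^ 2 * s i := by
    rcases Nat.eq_zero_or_pos (i : ℕ) with hi | hi
    · rw [hi, h0]; simp
    · rw [Finset.sum_eq_single ((i : ℕ) - 1)]
      · rw [if_pos (by omega)]
      · intro j _ hj; rw [if_neg (by omega)]
      · intro hj; simp only [Finset.mem_range] at hj; omega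
  rw [e2, e3, if_pos (Finset.mem_range.2 i.2)]
  ring

lemma discreteMatrix_mul_sineMatrix (q : ℝ → ℂ) (M : ℕ) :
    discreteMatrix q (2 * M + 1) (M + 1) * sineMatrix M =
      sineMatrix M * Matrix.diagonal (fun k : Fin (2 * M + 1) =>
        (freeEigenvalue (2 * M + 1) ((k : ℕ) + 1) : ℂ)) +
      Matrix.vecMulVec (fun i : Fin (2 * M + 1) => q (((i : ℕ) + 1 : ℕ) * step (2 * M + 1)))
        (fun k : Fin (2 * M + 1) =>
          (Real.sin (((k : ℕ) + 1 : ℕ) * ((M + 1 : ℕ) * step (2 * M + 1))) : ℂ)) := by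
  have hh := step_pos (2 * M + 1)
  have hh' : (step (2 * M + 1) : ℂ) ≠ 0 := by exact_mod_cast hh.ne'
  ext i k
  rw [Matrix.mul_apply, Matrix.add_apply, Matrix.mul_diagonal, Matrix.vecMulVec_apply]
  simp only [discreteMatrix, add_mul, Finset.sum_add_distrib]
  congr 1
  · have key := sum_tridiagonal_mul (2 * M + 1) (step (2 * M + 1))
      (fun j => (Real.sin (((k : ℕ) + 1 : ℕ) * (j * step (2 * M + 1))) : ℂ)) (by simp)
      (by rw [succ_mul_step, Real.sin_nat_mul_pi, Complex.ofReal_zero]) i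
    refine Eq.trans key ?_
    have := second_difference_sin (2 * M + 1) (k + 1) i
    have this := congrArg (fun x : ℝ => (x : ℂ)) this
    push_cast at this ⊢
    rw [this, sineMatrix]
    push_cast
    field_simp
  · rw [Finset.sum_eq_single ⟨M, by omega⟩]
    · simp only [if_true, sineMatrix, Nat.cast_add, Nat.cast_one]
      congr 2
      ring
    · intro j _ hj
      rw [if_neg, zero_mul]
      intro h
      exact hj (Fin.ext (by simpa using h))
    · simp

/-! ### The characteristic polynomial -/

/-- The matrix determinant lemma after factoring out the diagonal; it produces the secular function
of a rank-one perturbation. -/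
lemma det_diagonal_sub_vecMulVec {n : Type*} [Fintype n] [DecidableEq n] (e u v : n → ℂ)
    (he : ∀ i, e i ≠ 0) : (Matrix.diagonal e - Matrix.vecMulVec u v).det =
      (∏ i, e i) * (1 - ∑ i, u i * v i / e i) := by
  have h : Matrix.diagonal e - Matrix.vecMulVec u v = Matrix.diagonal e *
      (1 + Matrix.replicateCol Unit (fun i => -u i / e i) * Matrix.replicateRow Unit v) := by
    ext i j
    have h1 : (Matrix.replicateCol Unit (fun i => -u i / e i) * Matrix.replicateRow Unit v) i j =
        -u i / e i * v j := by simp [Matrix.mul_apply]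
    rw [Matrix.mul_add, Matrix.mul_one, Matrix.add_apply, Matrix.sub_apply, Matrix.diagonal_mul,
      h1, Matrix.vecMulVec_apply]
    have := he i
    field_simp
    ring
  rw [h, Matrix.det_mul, Matrix.det_diagonal, Matrix.det_one_add_replicateCol_mul_replicateRow]
  congr 1
  rw [dotProduct, sub_eq_add_neg, ← Finset.sum_neg_distrib]
  congr 1
  exact Finset.sum_congr rfl fun i _ => by ring

lemma map_range_odd {α : Type*} (g : ℕ → α) (M : ℕ) : (Multiset.range (2 * M + 1)).map g =
    (Multiset.range (M + 1)).map (fun i => g (2 * i)) +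
      (Multiset.range M).map fun i => g (2 * i + 1) := by
  induction M with
  | zero => simp
  | succ M ih =>
    rw [show 2 * (M + 1) + 1 = 2 * M + 1 + 1 + 1 by ring, Multiset.range_succ, Multiset.range_succ,
      Multiset.map_cons, Multiset.map_cons, ih, Multiset.range_succ (M + 1), Multiset.map_cons,
      Multiset.range_succ M, Multiset.map_cons, Multiset.map_cons]
    rw [show 2 * M + 1 + 1 = 2 * (M + 1) by ring]
    simp only [Multiset.cons_add, Multiset.add_cons]
    rw [Multiset.cons_swap]

/-- The factor of the characteristic polynomial with the degenerate eigenvalues as roots. -/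
noncomputable def evenPoly (M : ℕ) : Polynomial ℂ :=
  ((Multiset.range M).map fun i => Polynomial.X -
    Polynomial.C (freeEigenvalue (2 * M + 1) (2 * i + 2) : ℂ)).prod

/-- The factor of the characteristic polynomial with the other eigenvalues as roots. -/
noncomputable def oddPoly (q : ℝ → ℂ) (M : ℕ) : Polynomial ℂ :=
  ∏ i ∈ Finset.range (M + 1), (Polynomial.X -
      Polynomial.C (freeEigenvalue (2 * M + 1) (2 * i + 1) : ℂ)) -
    ∑ i ∈ Finset.range (M + 1), Polynomial.C (discreteCoeff q M i) *
      ∏ j ∈ (Finset.range (M + 1)).erase i, (Polynomial.X -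
        Polynomial.C (freeEigenvalue (2 * M + 1) (2 * j + 1) : ℂ))

lemma eval_oddPoly (q : ℝ → ℂ) (M : ℕ) {z : ℂ}
    (hz : ∀ i ≤ M, z ≠ (freeEigenvalue (2 * M + 1) (2 * i + 1) : ℂ)) : (oddPoly q M).eval z =
      (∏ i ∈ Finset.range (M + 1), (z - (freeEigenvalue (2 * M + 1) (2 * i + 1) : ℂ))) *
        (1 - ∑ i ∈ Finset.range (M + 1),
          discreteCoeff q M i / (z - (freeEigenvalue (2 * M + 1) (2 * i + 1) : ℂ))) := by
  simp only [oddPoly, Polynomial.eval_sub, Polynomial.eval_prod, Polynomial.eval_finsetSum,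
    Polynomial.eval_mul, Polynomial.eval_C, Polynomial.eval_X]
  rw [mul_sub, mul_one, Finset.mul_sum]
  congr 1
  refine Finset.sum_congr rfl fun i hi => ?_
  have h := sub_ne_zero.2 (hz i (Nat.lt_succ_iff.1 (Finset.mem_range.1 hi)))
  rw [← Finset.mul_prod_erase _ _ hi]
  field_simp

lemma charpoly_discreteMatrix (q : ℝ → ℂ) (M : ℕ) :
    (discreteMatrix q (2 * M + 1) (M + 1)).charpoly = evenPoly M * oddPoly q M := by
  have hM : ((M : ℂ) + 1) ≠ 0 := by exact_mod_cast M.succ_ne_zero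
  set A := discreteMatrix q (2 * M + 1) (M + 1) with hA
  set U := sineMatrix M with hU
  set f : ℕ → ℂ := fun k => (freeEigenvalue (2 * M + 1) (k + 1) : ℂ) with hf
  set r : ℕ → ℂ := fun k =>
    (Real.sin ((k + 1 : ℕ) * ((M + 1 : ℕ) * step (2 * M + 1))) : ℂ) with hr
  set u : ℕ → ℂ := fun k => (M + 1 : ℂ)⁻¹ * ∑ j ∈ Finset.range (2 * M + 1),
    (q ((j + 1 : ℕ) * step (2 * M + 1))) *
      (Real.sin ((k + 1 : ℕ) * ((j + 1 : ℕ) * step (2 * M + 1))) : ℂ) with hu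
  have hUU : ((M + 1 : ℂ)⁻¹ • U) * U = 1 := by
    rw [Matrix.smul_mul, hU, sineMatrix_mul_self]
    ext i j
    by_cases h : i = j
    · subst h; simp [hM]
    · simp [h]
  have hUU' : U * ((M + 1 : ℂ)⁻¹ • U) = 1 := by
    rw [Matrix.mul_smul, ← Matrix.smul_mul, hUU]
  have hconj : ((M + 1 : ℂ)⁻¹ • U) * (A * U) =
      Matrix.diagonal (fun k : Fin (2 * M + 1) => f k) +
        Matrix.vecMulVec (fun k : Fin (2 * M + 1) => u k) (fun k : Fin (2 * M + 1) => r k) := by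
    rw [hA, hU, discreteMatrix_mul_sineMatrix, Matrix.mul_add, ← Matrix.mul_assoc, ← hU, hUU,
      Matrix.one_mul, Matrix.mul_vecMulVec]
    congr 2
    ext k
    rw [Matrix.smul_mulVec, Pi.smul_apply, smul_eq_mul, hu]
    congr 1
    rw [Matrix.mulVec, dotProduct, ← Fin.sum_univ_eq_sum_range (fun j =>
      q ((j + 1 : ℕ) * step (2 * M + 1)) *
        (Real.sin (((k : ℕ) + 1 : ℕ) * ((j + 1 : ℕ) * step (2 * M + 1))) : ℂ))]
    refine Finset.sum_congr rfl fun j _ => ?_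
    rw [mul_comm, hU, sineMatrix]
    congr 3
    ring
  have hchar : A.charpoly = (Matrix.diagonal (fun k : Fin (2 * M + 1) => f k) +
        Matrix.vecMulVec (fun k : Fin (2 * M + 1) => u k)
          (fun k : Fin (2 * M + 1) => r k)).charpoly := by
    rw [← hconj, Matrix.charpoly_mul_comm, Matrix.mul_assoc, hUU', Matrix.mul_one]
  -- The index `k` stands for the mode `k + 1`: odd `k` are the even modes, whose sine vanishes at
  -- the midpoint `x_m = π/2`.
  have hr0 : ∀ i, r (2 * i + 1) = 0 := by
    intro i
    have : ((2 * i + 1 + 1 : ℕ) * ((M + 1 : ℕ) * step (2 * M + 1)) : ℝ) = (i + 1 : ℕ) * Real.pi := by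
      rw [← succ_mul_step M]; push_cast; ring
    simp only [hr]
    rw [this, Real.sin_nat_mul_pi, Complex.ofReal_zero]
  have hr1 : ∀ i, r (2 * i) = (-1) ^ i := by
    intro i
    have : ((2 * i + 1 : ℕ) * ((M + 1 : ℕ) * step (2 * M + 1)) : ℝ) = Real.pi / 2 + i * Real.pi := by
      rw [← succ_mul_step M]; push_cast; ring
    simp only [hr]
    rw [this, Real.sin_add_nat_mul_pi, Real.sin_pi_div_two]
    push_cast; ring
  have hc : ∀ i, u (2 * i) * r (2 * i) = discreteCoeff q M i := by
    intro i
    rw [hr1, hu, discreteCoeff]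
    ring
  -- The determinant formula divides by `z - f k`, so the polynomials are compared off this finite
  -- set only.
  refine Polynomial.eq_of_infinite_eval_eq _ _ (Set.Infinite.mono (s :=
    ((Finset.range (2 * M + 1)).image f : Set ℂ)ᶜ) (fun z hz => ?_)
    (Finset.finite_toSet _).infinite_compl)
  have hz' : ∀ k < 2 * M + 1, z - f k ≠ 0 := by
    intro k hk h
    refine hz ?_
    rw [sub_eq_zero.1 h]
    exact Finset.mem_coe.2 (Finset.mem_image_of_mem f (Finset.mem_range.2 hk))
  change A.charpoly.eval z = (evenPoly M * oddPoly q M).eval z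
  have hmat : Matrix.scalar (Fin (2 * M + 1)) z - (Matrix.diagonal (fun k : Fin (2 * M + 1) => f k) +
        Matrix.vecMulVec (fun k : Fin (2 * M + 1) => u k) (fun k : Fin (2 * M + 1) => r k)) =
      Matrix.diagonal (fun k : Fin (2 * M + 1) => z - f k) -
        Matrix.vecMulVec (fun k : Fin (2 * M + 1) => u k) (fun k : Fin (2 * M + 1) => r k) := by
    rw [← sub_sub, Matrix.scalar_apply, Matrix.diagonal_sub]
  rw [hchar, Matrix.eval_charpoly, hmat, 
    det_diagonal_sub_vecMulVec _ _ _ fun i : Fin (2 * M + 1) => hz' i i.2,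
    Fin.prod_univ_eq_prod_range (fun k => z - f k),
    Fin.sum_univ_eq_sum_range (fun k => u k * r k / (z - f k)), Polynomial.eval_mul,
    eval_oddPoly q M fun i hi => sub_ne_zero.1 (hz' (2 * i) (by omega))]
  have hprod : ∏ k ∈ Finset.range (2 * M + 1), (z - f k) =
      (∏ i ∈ Finset.range (M + 1), (z - f (2 * i))) * (evenPoly M).eval z := by
    have := congrArg Multiset.prod (map_range_odd (fun k => z - f k) M)
    rw [Multiset.prod_add] at this
    rw [evenPoly, Polynomial.eval_multiset_prod, Multiset.map_map]
    simp only [Function.comp_def, Polynomial.eval_sub, Polynomial.eval_X, Polynomial.eval_C]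
    exact this
  have hsum : ∑ k ∈ Finset.range (2 * M + 1), u k * r k / (z - f k) =
      ∑ i ∈ Finset.range (M + 1), discreteCoeff q M i / (z - f (2 * i)) := by
    have := congrArg Multiset.sum (map_range_odd (fun k => u k * r k / (z - f k)) M)
    rw [Multiset.sum_add] at this
    simp only [hr0, hc, mul_zero, zero_div, Multiset.map_const', Multiset.sum_replicate,
      smul_zero, add_zero] at this
    exact this
  rw [hprod, hsum]
  ring

/-! ### Localization of the non-degenerate discrete eigenvalues -/

lemma card_filter_eq_of_norm_sub_lt {S T : Multiset ℂ} {R : ℝ} (hR : 0 < R)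
    (h : ∀ z : ℂ, ‖z‖ = R → ‖rootProd S z - rootProd T z‖ < ‖rootProd T z‖) :
    (S.filter fun a => ‖a‖ < R).card = (T.filter fun a => ‖a‖ < R).card := by
  obtain ⟨s, t, hs, ht, hst, hcs, hct⟩ :=
    exists_zeros_card_eq (differentiable_rootProd S) (differentiable_rootProd T) hR h
  have main : ∀ S s : Multiset ℂ, (∀ a ∈ s, ‖a‖ < R) →
      (∀ a : ℂ, ‖a‖ < R → analyticOrderAt (rootProd S) a = s.count a) →
      (S.filter fun a => ‖a‖ < R) = s := by
    intro S s hs hc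
    ext a
    rw [Multiset.count_filter]
    split_ifs with ha
    · have h1 := hc a ha
      have h2 := analyticOrderAt_rootProd_mul (s := S) (g := fun _ => 1) (a := a)
        analyticAt_const one_ne_zero
      simp only [mul_one] at h2
      rw [show rootProd S = fun z => rootProd S z from rfl, h2] at h1
      exact_mod_cast h1
    · exact (Multiset.count_eq_zero_of_notMem fun h => ha (hs a h)).symm
  rw [main S s hs hcs, main T t ht hct, hst]

lemma monic_evenPoly (M : ℕ) : (evenPoly M).Monic :=
  Polynomial.monic_multiset_prod_of_monic _ _ fun _ _ => Polynomial.monic_X_sub_C _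

/-- It is the cofactor of a monic polynomial in a monic characteristic polynomial; no degree count
is needed. -/
lemma monic_oddPoly (q : ℝ → ℂ) (M : ℕ) : (oddPoly q M).Monic := by
  refine (monic_evenPoly M).of_mul_monic_left ?_
  rw [← charpoly_discreteMatrix]
  exact Matrix.charpoly_monic _

lemma roots_evenPoly (M : ℕ) : (evenPoly M).roots =
    (Multiset.range M).map fun i => (freeEigenvalue (2 * M + 1) (2 * i + 2) : ℂ) := by
  have h := Polynomial.roots_multiset_prod_X_sub_C
    ((Multiset.range M).map fun i => (freeEigenvalue (2 * M + 1) (2 * i + 2) : ℂ))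
  rwa [Multiset.map_map] at h

lemma roots_charpoly (q : ℝ → ℂ) (M : ℕ) :
    (discreteMatrix q (2 * M + 1) (M + 1)).charpoly.roots =
      (Multiset.range M).map (fun i => (freeEigenvalue (2 * M + 1) (2 * i + 2) : ℂ)) +
        (oddPoly q M).roots := by
  rw [charpoly_discreteMatrix, Polynomial.roots_mul, roots_evenPoly]
  exact mul_ne_zero (monic_evenPoly M).ne_zero (monic_oddPoly q M).ne_zero

lemma card_roots_oddPoly (q : ℝ → ℂ) (M : ℕ) : (oddPoly q M).roots.card = M + 1 := by
  have h := congrArg Multiset.card (roots_charpoly q M)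
  rw [(IsAlgClosed.splits _).natDegree_eq_card_roots.symm, Matrix.charpoly_natDegree_eq_dim,
    Multiset.card_add, Multiset.card_map, Multiset.card_range, Fintype.card_fin] at h
  omega

lemma eval_oddPoly_eq_rootProd (q : ℝ → ℂ) (M : ℕ) (z : ℂ) :
    (oddPoly q M).eval z = rootProd (oddPoly q M).roots z := by
  rw [(IsAlgClosed.splits _).eval_eq_prod_roots_of_monic (monic_oddPoly q M), rootProd]

lemma exists_locate_roots {q : ℝ → ℂ} (hq : MemW21 q) (hq0 : q 0 + q Real.pi = 0) :
    ∃ (K : ℝ) (J₀ : ℕ), 0 ≤ K ∧ 1 ≤ J₀ ∧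
      (∀ M J : ℕ, J₀ ≤ J → J ≤ M + 1 → ((oddPoly q M).roots.filter fun a =>
        ‖a‖ < freeEigenvalue (2 * M + 1) (2 * J)).card = J) ∧
      ∀ M i : ℕ, J₀ ≤ i → i ≤ M → ∀ z : ℂ, (oddPoly q M).eval z = 0 →
        freeEigenvalue (2 * M + 1) (2 * i) ≤ ‖z‖ →
        ‖z‖ < freeEigenvalue (2 * M + 1) (2 * (i + 1)) →
        ‖z - (freeEigenvalue (2 * M + 1) (2 * i + 1) : ℂ)‖ ≤ K / (2 * i + 1 : ℝ) ^ 2 := by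
  obtain ⟨K, hK, hc⟩ := exists_norm_discreteCoeff_le hq hq0
  obtain ⟨T, hT, hsum⟩ := exists_sum_inv_sq_mul_le
  have hpi := Real.pi_pos
  set δ : ℝ := 4 / Real.pi ^ 2 with hδ
  have hδ0 : 0 < δ := by positivity
  -- On `|z| = f_{2J}` the secular sum is at most `KT/(δJ)`. A quarter, rather than anything below
  -- `1`, is required because two such bounds must later add up to at most `1/2`.
  obtain ⟨J₀, hJ₀⟩ := exists_nat_gt (4 * (K * T / δ))
  have hX : 0 ≤ K * T / δ := by positivity
  have hJ₀1 : 1 ≤ J₀ := by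
    by_contra h0
    have : J₀ = 0 := by omega
    rw [this, Nat.cast_zero] at hJ₀
    linarith
  have hquarter : ∀ J : ℕ, J₀ ≤ J → K * T / δ / J < 1 / 4 := by
    intro J hJ
    have h1 : (J₀ : ℝ) ≤ J := by exact_mod_cast hJ
    rw [div_lt_iff₀ (by linarith)]
    linarith
  have hgap : ∀ M J i : ℕ, J ≤ M + 1 → i ≤ M →
      δ * (2 * J - (2 * i + 1) : ℝ) ^ 2 ≤
        |freeEigenvalue (2 * M + 1) (2 * J) - freeEigenvalue (2 * M + 1) (2 * i + 1)| := by
    intro M J i hJ hi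
    rcases le_total (2 * i + 1) (2 * J) with h | h
    · have := freeEigenvalue_gap (M := M) h (by omega)
      push_cast at this
      exact this.trans (le_abs_self _)
    · have := freeEigenvalue_gap (M := M) h (by omega)
      push_cast at this
      rw [abs_sub_comm]
      refine le_trans (le_of_eq ?_) (this.trans (le_abs_self _))
      ring
  have hodd : ∀ J i : ℕ, (0 : ℝ) < (2 * J - (2 * i + 1) : ℝ) ^ 2 := by
    intro J i
    refine sq_pos_of_ne_zero ?_
    have : (2 * (J : ℤ) - (2 * i + 1)) ≠ 0 := by omega
    exact_mod_cast this
  refine ⟨2 * K, J₀, by positivity, hJ₀1, ?_, ?_⟩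
  · intro M J hJ hJM
    have hR : 0 < freeEigenvalue (2 * M + 1) (2 * J) := by
      have := freeEigenvalue_lt (M := M) (k := 0) (n := 2 * J) (by omega) (by omega)
      simpa using this
    rw [card_filter_eq_of_norm_sub_lt (T := (Multiset.range (M + 1)).map fun i =>
      (freeEigenvalue (2 * M + 1) (2 * i + 1) : ℂ)) hR]
    · rw [Multiset.filter_map, Multiset.card_map]
      have : (Multiset.range (M + 1)).filter ((fun a : ℂ =>
          ‖a‖ < freeEigenvalue (2 * M + 1) (2 * J)) ∘ fun i =>
          (freeEigenvalue (2 * M + 1) (2 * i + 1) : ℂ)) = Multiset.range J := by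
        refine (Multiset.Nodup.ext ((Multiset.nodup_range _).filter _)
          (Multiset.nodup_range _)).2 fun i => ?_
        simp only [Multiset.mem_filter, Multiset.mem_range, Function.comp_apply, Complex.norm_real,
          Real.norm_of_nonneg (freeEigenvalue_nonneg _ _)]
        constructor
        · rintro ⟨h1, h2⟩
          by_contra h3
          exact absurd h2 (freeEigenvalue_lt (M := M) (by omega) (by omega)).not_gt
        · intro h
          exact ⟨by omega, freeEigenvalue_lt (by omega) (by omega)⟩
      rw [this, Multiset.card_range]
    · intro z hz
      have hd : ∀ i ≤ M, δ * (2 * J - (2 * i + 1) : ℝ) ^ 2 ≤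
          ‖z - (freeEigenvalue (2 * M + 1) (2 * i + 1) : ℂ)‖ := by
        intro i hi
        refine (hgap M J i hJM hi).trans ?_
        have := abs_norm_sub_norm_le z (freeEigenvalue (2 * M + 1) (2 * i + 1) : ℂ)
        rwa [hz, Complex.norm_real, Real.norm_of_nonneg (freeEigenvalue_nonneg _ _)] at this
      have hne : ∀ i ≤ M, z ≠ (freeEigenvalue (2 * M + 1) (2 * i + 1) : ℂ) := by
        intro i hi h
        have h1 := hd i hi
        rw [h, sub_self, norm_zero] at h1
        have := mul_pos hδ0 (hodd J i)
        linarith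
      have hG : rootProd ((Multiset.range (M + 1)).map fun i =>
          (freeEigenvalue (2 * M + 1) (2 * i + 1) : ℂ)) z =
          ∏ i ∈ Finset.range (M + 1), (z - (freeEigenvalue (2 * M + 1) (2 * i + 1) : ℂ)) := by
        rw [rootProd, Multiset.map_map]; rfl
      have hG0 : ∏ i ∈ Finset.range (M + 1),
          (z - (freeEigenvalue (2 * M + 1) (2 * i + 1) : ℂ)) ≠ 0 :=
        Finset.prod_ne_zero_iff.2 fun i hi =>
          sub_ne_zero.2 (hne i (Nat.lt_succ_iff.1 (Finset.mem_range.1 hi)))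
      rw [← eval_oddPoly_eq_rootProd, eval_oddPoly q M hne, hG, ← mul_sub_one, norm_mul]
      refine mul_lt_of_lt_one_right (norm_pos_iff.2 hG0) ?_
      rw [sub_sub_cancel_left, norm_neg]
      calc ‖∑ i ∈ Finset.range (M + 1),
            discreteCoeff q M i / (z - (freeEigenvalue (2 * M + 1) (2 * i + 1) : ℂ))‖
          ≤ ∑ i ∈ Finset.range (M + 1), K / δ *
              (1 / ((2 * i + 1 : ℝ) ^ 2 * (2 * J - (2 * i + 1) : ℝ) ^ 2)) := by
            refine (norm_sum_le _ _).trans (Finset.sum_le_sum fun i hi => ?_)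
            have hi := Nat.lt_succ_iff.1 (Finset.mem_range.1 hi)
            have h2 := hodd J i
            rw [norm_div]
            refine (div_le_div₀ (by positivity) (hc M i hi) (by positivity) (hd i hi)).trans
              (le_of_eq ?_)
            field_simp
        _ ≤ K / δ * (T / J) := by
            rw [← Finset.mul_sum]
            exact mul_le_mul_of_nonneg_left (hsum _ J (hJ₀1.trans hJ)) (by positivity)
        _ = K * T / δ / J := by ring
        _ < 1 := by linarith [hquarter J hJ]
  · intro M i hi hiM z hz0 hlo hhi
    set f : ℕ → ℂ := fun j => (freeEigenvalue (2 * M + 1) (2 * j + 1) : ℂ) with hf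
    have hfn : ∀ j, ‖f j‖ = freeEigenvalue (2 * M + 1) (2 * j + 1) := fun j => by
      rw [hf, Complex.norm_real, Real.norm_of_nonneg (freeEigenvalue_nonneg _ _)]
    change ‖z - f i‖ ≤ _
    by_cases hzi : z = f i
    · rw [hzi, sub_self, norm_zero]; positivity
    -- Between the circles, a free eigenvalue below is at least as far from `z` as from the inner
    -- circle, and one above at least as far as from the outer circle.
    have hd : ∀ j ≤ M, j ≠ i → δ * (2 * i - (2 * j + 1) : ℝ) ^ 2 ≤ ‖z - f j‖ ∨
        δ * (2 * (i + 1 : ℕ) - (2 * j + 1) : ℝ) ^ 2 ≤ ‖z - f j‖ := by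
      intro j hj hji
      rcases lt_or_gt_of_ne hji with h | h
      · left
        have h1 := hgap M i j (by omega) hj
        have h2 := freeEigenvalue_lt (M := M) (k := 2 * j + 1) (n := 2 * i) (by omega) (by omega)
        rw [abs_of_pos (by linarith)] at h1
        have h3 := norm_sub_norm_le z (f j)
        rw [hfn] at h3
        linarith
      · right
        have h1 := hgap M (i + 1) j (by omega) hj
        have h2 := freeEigenvalue_lt (M := M) (k := 2 * (i + 1)) (n := 2 * j + 1) (by omega)
          (by omega)
        rw [abs_of_neg (by linarith)] at h1
        have h3 := norm_sub_norm_le (f j) z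
        rw [hfn, norm_sub_rev] at h3
        linarith
    have hne : ∀ j ≤ M, z ≠ f j := by
      intro j hj h
      by_cases hji : j = i
      · exact hzi (hji ▸ h)
      · have h1 := hd j hj hji
        rw [h, sub_self, norm_zero] at h1
        have h2 := mul_pos hδ0 (hodd i j)
        have h3 := mul_pos hδ0 (hodd (i + 1) j)
        rcases h1 with h1 | h1 <;> linarith
    have hprod : ∏ j ∈ Finset.range (M + 1), (z - f j) ≠ 0 :=
      Finset.prod_ne_zero_iff.2 fun j hj =>
        sub_ne_zero.2 (hne j (Nat.lt_succ_iff.1 (Finset.mem_range.1 hj)))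
    have hone : ∑ j ∈ Finset.range (M + 1), discreteCoeff q M j / (z - f j) = 1 := by
      have h1 := eval_oddPoly q M hne
      rw [hz0] at h1
      have h2 := (mul_eq_zero.1 h1.symm).resolve_left hprod
      exact (sub_eq_zero.1 h2).symm
    have hmem : i ∈ Finset.range (M + 1) := Finset.mem_range.2 (by omega)
    rw [← Finset.add_sum_erase _ _ hmem] at hone
    have hrest : ‖∑ j ∈ (Finset.range (M + 1)).erase i, discreteCoeff q M j / (z - f j)‖ ≤
        1 / 2 := by
      calc _ ≤ ∑ j ∈ (Finset.range (M + 1)).erase i,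
            (K / δ * (1 / ((2 * j + 1 : ℝ) ^ 2 * (2 * i - (2 * j + 1) : ℝ) ^ 2)) +
              K / δ * (1 / ((2 * j + 1 : ℝ) ^ 2 * (2 * (i + 1 : ℕ) - (2 * j + 1) : ℝ) ^ 2))) := by
            refine (norm_sum_le _ _).trans (Finset.sum_le_sum fun j hj => ?_)
            obtain ⟨hji, hj⟩ := Finset.mem_erase.1 hj
            have hj := Nat.lt_succ_iff.1 (Finset.mem_range.1 hj)
            have h2 := hodd i j
            have h3 := hodd (i + 1) j
            rw [norm_div]
            rcases hd j hj hji with h | h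
            · refine le_trans ?_ (le_add_of_nonneg_right (by positivity))
              refine (div_le_div₀ (by positivity) (hc M j hj) (by positivity) h).trans
                (le_of_eq ?_)
              field_simp
            · refine le_trans ?_ (le_add_of_nonneg_left (by positivity))
              refine (div_le_div₀ (by positivity) (hc M j hj) (by positivity) h).trans
                (le_of_eq ?_)
              field_simp
        _ ≤ K / δ * (T / i) + K / δ * (T / (i + 1 : ℕ)) := by
            rw [Finset.sum_add_distrib, ← Finset.mul_sum, ← Finset.mul_sum]
            exact add_le_add
              (mul_le_mul_of_nonneg_left (hsum _ i (hJ₀1.trans hi)) (by positivity))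
              (mul_le_mul_of_nonneg_left (hsum _ (i + 1) (by omega)) (by positivity))
        _ = K * T / δ / i + K * T / δ / (i + 1 : ℕ) := by ring
        _ ≤ 1 / 2 := by linarith [hquarter i hi, hquarter (i + 1) (by omega)]
    -- At a root the secular sum equals `1`, and all terms but this one contribute at most `1/2`.
    have hmain : 1 / 2 ≤ ‖discreteCoeff q M i / (z - f i)‖ := by
      have h1 : discreteCoeff q M i / (z - f i) =
          1 - ∑ j ∈ (Finset.range (M + 1)).erase i, discreteCoeff q M j / (z - f j) := by
        rw [← hone]; ring
      rw [h1]
      have h2 := norm_sub_norm_le (1 : ℂ)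
        (∑ j ∈ (Finset.range (M + 1)).erase i, discreteCoeff q M j / (z - f j))
      rw [norm_one] at h2
      linarith
    have hpos : 0 < ‖z - f i‖ := norm_pos_iff.2 (sub_ne_zero.2 hzi)
    rw [norm_div, le_div_iff₀ hpos] at hmain
    have h1 := hc M i hiM
    calc ‖z - f i‖ ≤ 2 * (K / (2 * i + 1 : ℝ) ^ 2) := by linarith
      _ = 2 * K / (2 * i + 1 : ℝ) ^ 2 := by ring

/-! ### Numberings of the discrete eigenvalues -/

lemma map_Icc_one_odd (lam : ℕ → ℂ) (M : ℕ) : (Finset.Icc 1 (2 * M + 1)).val.map lam =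
    (Multiset.range M).map (fun i => lam (2 * i + 2)) +
      (Multiset.range (M + 1)).map fun i => lam (2 * i + 1) := by
  have h : (Finset.Icc 1 (2 * M + 1)) =
      (Finset.range (2 * M + 1)).map ⟨fun i => i + 1, add_left_injective 1⟩ := by
    ext n
    simp only [Finset.mem_Icc, Finset.mem_map, Finset.mem_range, Function.Embedding.coeFn_mk]
    constructor
    · rintro ⟨h1, h2⟩; exact ⟨n - 1, by omega, by omega⟩
    · rintro ⟨i, h1, rfl⟩; omega
  rw [h, Finset.map_val, Multiset.map_map, Finset.range_val, map_range_odd, add_comm]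
  rfl

lemma IsDiscreteNumbering.roots_oddPoly {q : ℝ → ℂ} {M : ℕ} {lam : ℕ → ℂ}
    (h : IsDiscreteNumbering q (2 * M + 1) (M + 1) lam) :
    (Multiset.range (M + 1)).map (fun i => lam (2 * i + 1)) = (oddPoly q M).roots := by
  have h1 := h.roots
  rw [map_Icc_one_odd, roots_charpoly] at h1
  have h2 : (Multiset.range M).map (fun i => lam (2 * i + 2)) = (Multiset.range M).map
      (fun i => (freeEigenvalue (2 * M + 1) (2 * i + 2) : ℂ)) :=
    Multiset.map_congr rfl fun i hi => by
      have := Multiset.mem_range.1 hi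
      exact h.even _ (by omega) (by omega) ⟨i + 1, by ring⟩
  rw [h2] at h1
  exact add_left_cancel h1

lemma exists_discreteNumbering (q : ℝ → ℂ) (M : ℕ) :
    ∃ lam : ℕ → ℂ, IsDiscreteNumbering q (2 * M + 1) (M + 1) lam := by
  set r : ℂ → ℂ → Prop := fun a b => ‖a‖ ≤ ‖b‖ with hr
  have : Std.Total r := ⟨fun a b => le_total _ _⟩
  have : IsTrans ℂ r := ⟨fun a b c h1 h2 => le_trans h1 h2⟩
  classical
  set L := (oddPoly q M).roots.toList.insertionSort r with hL
  have hLs : L.Pairwise r := List.pairwise_insertionSort r _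
  have hLm : (L : Multiset ℂ) = (oddPoly q M).roots := by
    rw [Multiset.coe_eq_coe.2 (List.perm_insertionSort r _), Multiset.coe_toList]
  have hLl : L.length = M + 1 := by
    rw [← card_roots_oddPoly q M, ← hLm, Multiset.coe_card]
  -- The roots sorted by modulus go to the odd indices, `n = 2i + 1` receiving entry `n / 2 = i`;
  -- the default `0` is reached only beyond `l`.
  set lam : ℕ → ℂ := fun n =>
    if Even n then (freeEigenvalue (2 * M + 1) n : ℂ) else L.getD (n / 2) 0 with hlam
  have heven : ∀ n : ℕ, Even n → lam n = (freeEigenvalue (2 * M + 1) n : ℂ) := fun n h => by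
    simp [hlam, h]
  have hodd : ∀ i, lam (2 * i + 1) = L.getD i 0 := fun i => by
    have : (2 * i + 1) / 2 = i := by omega
    simp [hlam, this]
  refine ⟨lam, ?_, fun n _ _ h => heven n h, ?_⟩
  · rw [map_Icc_one_odd, roots_charpoly, ← hLm]
    congr 1
    · exact Multiset.map_congr rfl fun i _ => heven _ ⟨i + 1, by ring⟩
    · rw [Multiset.map_congr rfl fun i _ => hodd i]
      refine congrArg _ (List.ext_getElem (by simp [hLl]) fun i h1 h2 => ?_)
      rw [List.getElem_map, List.getElem_range, List.getD_eq_getElem _ _ h2]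
  · rintro _ _ ⟨i, rfl⟩ ⟨j, rfl⟩ hij hj
    rw [hodd, hodd, List.getD_eq_getElem _ _ (by omega), List.getD_eq_getElem _ _ (by omega)]
    rcases (by omega : i = j ∨ i < j) with h | h
    · subst h; rfl
    · exact List.pairwise_iff_getElem.1 hLs i j (by omega) (by omega) h

/-- A crude bound that does not depend on the numbering, for the finitely many meshes outside the
asymptotic argument. -/
lemma IsDiscreteNumbering.norm_sub_le {q : ℝ → ℂ} {M : ℕ} {lam : ℕ → ℂ}
    (h : IsDiscreteNumbering q (2 * M + 1) (M + 1) lam) {n : ℕ} (h1 : 1 ≤ n)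
    (hn : n ≤ 2 * M + 1) : ‖lam n - (freeEigenvalue (2 * M + 1) n : ℂ)‖ ≤
      ((discreteMatrix q (2 * M + 1) (M + 1)).charpoly.roots.map norm).sum +
        freeEigenvalue (2 * M + 1) (2 * M + 2) := by
  refine (_root_.norm_sub_le _ _).trans (add_le_add ?_ ?_)
  · refine Multiset.single_le_sum (fun x hx => ?_) _ (Multiset.mem_map_of_mem norm ?_)
    · obtain ⟨a, -, rfl⟩ := Multiset.mem_map.1 hx
      exact norm_nonneg a
    · rw [← h.roots]
      exact Multiset.mem_map_of_mem lam (Finset.mem_def.1 (Finset.mem_Icc.2 ⟨h1, hn⟩))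
  · rw [Complex.norm_real, Real.norm_of_nonneg (freeEigenvalue_nonneg _ _)]
    exact (freeEigenvalue_lt (by omega) (by omega)).le

theorem exists_bound_discreteNumbering {q : ℝ → ℂ} (hq : MemW21 q) (hq0 : q 0 + q Real.pi = 0)
    {α : ℝ} (hα : 0 < α) : ∃ C : ℝ, ∀ M : ℕ, ∀ lam : ℕ → ℂ,
      IsDiscreteNumbering q (2 * M + 1) (M + 1) lam → ∀ n : ℕ, Odd n → n ≤ 2 * M + 1 →
        α ≤ (n : ℝ) / (2 * (M + 1 : ℝ)) →
          ‖lam n - (freeEigenvalue (2 * M + 1) n : ℂ)‖ ≤ C * step (2 * M + 1) ^ 2 := by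
  obtain ⟨K, J₀, hK, hJ₀, hcard, hloc⟩ := exists_locate_roots hq hq0
  have hpi := Real.pi_pos
  obtain ⟨B, hB⟩ := exists_nat_ge ((2 * J₀ + 1) / (2 * α))
  set b : ℕ → ℝ := fun M => (((discreteMatrix q (2 * M + 1) (M + 1)).charpoly.roots.map norm).sum +
    freeEigenvalue (2 * M + 1) (2 * M + 2)) / step (2 * M + 1) ^ 2 with hb
  have hb0 : ∀ M, 0 ≤ b M := fun M => by
    refine div_nonneg (add_nonneg (Multiset.sum_nonneg fun x hx => ?_)
      (freeEigenvalue_nonneg _ _)) (sq_nonneg _)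
    obtain ⟨a, -, rfl⟩ := Multiset.mem_map.1 hx
    exact norm_nonneg a
  -- The first term comes from `K/n²` with `n ≥ 2α(M + 1) = απ/h`. The sum dominates each crude
  -- bound `b M`, `M ≤ B`: an index with `i < J₀` satisfies `2α(M + 1) ≤ 2i + 1`, which forces `M +
  -- 1 ≤ B`.
  refine ⟨K / (Real.pi ^ 2 * α ^ 2) + ∑ M ∈ Finset.range (B + 1), b M,
    fun M lam hlam n hn hnl hαn => ?_⟩
  have hh := step_pos (2 * M + 1)
  have hsum0 : 0 ≤ ∑ M ∈ Finset.range (B + 1), b M := Finset.sum_nonneg fun M _ => hb0 M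
  obtain ⟨i, rfl⟩ := hn
  have hnα : α * (2 * (M + 1)) ≤ 2 * i + 1 := by
    rw [le_div_iff₀ (by positivity)] at hαn
    push_cast at hαn
    exact hαn
  rcases lt_or_ge i J₀ with hi | hi
  · have hMB : M < B + 1 := by
      have h1 : (i : ℝ) ≤ J₀ := by exact_mod_cast hi.le
      have h2 : (M : ℝ) + 1 ≤ (2 * J₀ + 1) / (2 * α) := by
        rw [le_div_iff₀ (by positivity)]; nlinarith
      have h3 : (M : ℝ) < (B + 1 : ℕ) := by push_cast; linarith
      exact_mod_cast h3
    have h1 := hlam.norm_sub_le (n := 2 * i + 1) (by omega) hnl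
    calc _ ≤ b M * step (2 * M + 1) ^ 2 := by
          rw [hb]
          simp only
          rw [div_mul_cancel₀ _ (by positivity)]
          exact h1
      _ ≤ _ := by
          refine mul_le_mul_of_nonneg_right ?_ (by positivity)
          have := Finset.single_le_sum (fun M _ => hb0 M) (Finset.mem_range.2 hMB)
          have h2 : 0 ≤ K / (Real.pi ^ 2 * α ^ 2) := by positivity
          linarith
  · have hroots := hlam.roots_oddPoly
    have hlt : ∀ J : ℕ, J₀ ≤ J → J ≤ M + 1 →
        (‖lam (2 * i + 1)‖ < freeEigenvalue (2 * M + 1) (2 * J) ↔ i < J) := by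
      intro J hJ hJM
      rw [norm_lt_iff_lt_card (μ := fun i => lam (2 * i + 1)) (I := Set.Iio (M + 1))
        (s := (oddPoly q M).roots.filter fun a => ‖a‖ < freeEigenvalue (2 * M + 1) (2 * J))
        (fun i hi j hj => lt_of_le_of_lt hj hi)
        (fun i hi j hj => hlam.odd _ _ (odd_two_mul_add_one j) (odd_two_mul_add_one i) (by omega)
          (by have : i < M + 1 := hi; omega))
        (fun a ha => (Multiset.mem_filter.1 ha).2) ?_ (Set.mem_Iio.2 (by omega)), hcard M J hJ hJM]
      intro z hz
      classical
      rw [Multiset.count_filter, if_pos hz, ← hroots, Multiset.count_map]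
      have e : {i | i ∈ Set.Iio (M + 1) ∧ lam (2 * i + 1) = z} =
          ((Finset.range (M + 1)).filter fun i => z = lam (2 * i + 1) : Finset ℕ) := by
        ext j
        simp [eq_comm]
      rw [e, Set.encard_coe_eq_coe_finsetCard]
      rfl
    have h1 := not_lt.1 (mt (hlt i hi (by omega)).1 (lt_irrefl i))
    have h2 := (hlt (i + 1) (by omega) (by omega)).2 (Nat.lt_succ_self i)
    have h0 : (oddPoly q M).eval (lam (2 * i + 1)) = 0 := by
      have : lam (2 * i + 1) ∈ (oddPoly q M).roots := by
        rw [← hroots]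
        exact Multiset.mem_map_of_mem (fun i => lam (2 * i + 1)) (Multiset.mem_range.2 (by omega))
      exact (Polynomial.mem_roots'.1 this).2
    refine (hloc M i hi (by omega) _ h0 h1 h2).trans ?_
    have h3 : K / (2 * i + 1 : ℝ) ^ 2 ≤ K / (α * (2 * (M + 1))) ^ 2 :=
      div_le_div_of_nonneg_left hK (by positivity) (pow_le_pow_left₀ (by positivity) hnα 2)
    refine h3.trans ?_
    calc K / (α * (2 * (M + 1))) ^ 2 = K / (Real.pi ^ 2 * α ^ 2) * step (2 * M + 1) ^ 2 := by
          rw [step_odd]; field_simp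
      _ ≤ _ := mul_le_mul_of_nonneg_right (by linarith) (by positivity)

end FrozenArgument

theorem mainTheorem6 (q : ℝ → ℂ) (hq : FrozenArgument.MemW21 q)
    (hq0 : q 0 + q Real.pi = 0) :
    ((∃ lam : ℕ → ℂ, FrozenArgument.IsNumbering q lam) ∧
      ∃ C : ℝ, ∀ lam : ℕ → ℂ, FrozenArgument.IsNumbering q lam →
        ∀ n : ℕ, Odd n → ‖lam n - (n : ℂ) ^ 2‖ ≤ C / (n : ℝ) ^ 2) ∧
    ((∀ l m : ℕ, 1 ≤ m → l = 2 * m - 1 →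
        ∃ lam : ℕ → ℂ, FrozenArgument.IsDiscreteNumbering q l m lam) ∧
      ∀ α : ℝ, 0 < α → ∃ C : ℝ, ∀ l m : ℕ, 1 ≤ m → l = 2 * m - 1 →
        ∀ lam : ℕ → ℂ, FrozenArgument.IsDiscreteNumbering q l m lam →
          ∀ n : ℕ, Odd n → n ≤ l → α ≤ (n : ℝ) / (2 * (m : ℝ)) →
            ‖lam n - (FrozenArgument.freeEigenvalue l n : ℂ)‖
              ≤ C * FrozenArgument.step l ^ 2) := by
  refine ⟨⟨FrozenArgument.exists_numbering_of_iff hq hq0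
    (FrozenArgument.isEigenvalue_iff hq.differentiableOn.continuousOn),
    FrozenArgument.exists_bound_numbering hq hq0⟩, ?_, fun α hα => ?_⟩
  · rintro l m hm rfl
    obtain ⟨M, rfl⟩ : ∃ M, m = M + 1 := ⟨m - 1, by omega⟩
    rw [show 2 * (M + 1) - 1 = 2 * M + 1 by omega]
    exact FrozenArgument.exists_discreteNumbering q M
  · obtain ⟨C, hC⟩ := FrozenArgument.exists_bound_discreteNumbering hq hq0 hα
    refine ⟨C, ?_⟩
    rintro l m hm rfl lam hlam n hn hnl hαn
    obtain ⟨M, rfl⟩ : ∃ M, m = M + 1 := ⟨m - 1, by omega⟩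
    rw [show 2 * (M + 1) - 1 = 2 * M + 1 by omega] at *
    exact hC M lam hlam n hn hnl (by push_cast at hαn; exact hαn)
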